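/- **The problem.** Let $d \ge 1$. The Manhattan distance of $p,q\in\mathbb{R}^d$ is $\sum_i |p_i-q_i|$. A rectilinear network in $\mathbb{R}^d$ is a finite collection of axis-parallel segments; its length is the sum of the lengths of the segments. A network $N$ M-connects two points $p,q$ if there is a path from $p$ to $q$ that consists of finitely many axis-parallel segments, each contained in the union of the segments of $N$, and whose total length equals the Manhattan distance of $p$ and $q$. In the generalized minimum Manhattan network problem (GMMN) in $d$ dimensions the input is a set $R$ of $n$ pairs of points of $\mathbb{R}^d$ (terminal pairs), and the goal is to find a rectilinear network of minimum length among the feasible ones, that is, among those that M-connect every pair in $R$. **Theorem.** For every fixed dimension $d \ge 1$, GMMN in $d$ dimensions admits a polynomial-time $O(\log^{d+1} n)$-approximation. That is, there are a function $\rho_d:\mathbb{N}\to\mathbb{R}$ with $\rho_d(n) = O(\log^{d+1} n)$ as $n\to\infty$, and a real-RAM program (depending only on $d$) that, given any $n$ terminal pairs in $\mathbb{R}^d$, halts after a number of steps bounded by a polynomial in $n$ (depending only on $d$) and outputs a feasible network whose length is at most $\rho_d(n)$ times the length of every feasible network. Here the real RAM has memory cells for real numbers and for nonnegative integers, rational constants,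 indirect addressing, and unit cost for each addition, subtraction, comparison, memory access and output of a number; no other arithmetic (no multiplication, no rounding) is needed. -/

import Mathlib

/-! ### Rectilinear networks and the generalized minimum Manhattan network problem -/

namespace GMMN

/-- A point of `d`-dimensional space. -/
abbrev Pt (d : ℕ) : Type := Fin d → ℝ

/-- The Manhattan distance of two points. -/
def manhattanDist {d : ℕ} (p q : Pt d) : ℝ := ∑ i, |p i - q i|

/-- Two points differ in at most one coordinate, that is, the straight segment between them is
parallel to a coordinate axis (or is a single point). -/
def AxisParallel {d : ℕ} (p q : Pt d) : Prop := ∃ i, ∀ j, j ≠ i → p j = q j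

/-- An axis-parallel segment, given by its two end points. -/
structure Seg (d : ℕ) where
  src : Pt d
  tgt : Pt d
  axis : AxisParallel src tgt

/-- A rectilinear network: finitely many axis-parallel segments. -/
abbrev Network (d : ℕ) : Type := List (Seg d)

/-- The set of points covered by a network. -/
def Network.support {d : ℕ} (N : Network d) : Set (Pt d) :=
  {x | ∃ s ∈ N, x ∈ segment ℝ s.src s.tgt}

/-- The length of a network: the sum of the lengths of its segments. (Overlapping parts count
with multiplicity; every network can be rewritten without overlaps, so the optimum is the same as
for the length of the covered set.) -/
noncomputable def Network.totalLength {d : ℕ} (N : Network d) : ℝ :=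
  (N.map fun s => manhattanDist s.src s.tgt).sum

/-- `N` contains a Manhattan path from `p` to `q`: a path `v 0, …, v k` of axis-parallel segments
that are covered by `N`, whose total length is the Manhattan distance of `p` and `q`. -/
def MConnected {d : ℕ} (N : Network d) (p q : Pt d) : Prop :=
  ∃ (k : ℕ) (v : ℕ → Pt d), v 0 = p ∧ v k = q ∧
    (∀ i < k, AxisParallel (v i) (v (i + 1)) ∧ segment ℝ (v i) (v (i + 1)) ⊆ N.support) ∧
    ∑ i ∈ Finset.range k, manhattanDist (v i) (v (i + 1)) = manhattanDist p q

/-- An instance: a finite list of terminal pairs. -/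
abbrev Instance (d : ℕ) : Type := List (Pt d × Pt d)

/-- A network is feasible for `R` if it M-connects every terminal pair of `R`. -/
def Feasible {d : ℕ} (R : Instance d) (N : Network d) : Prop :=
  ∀ r ∈ R, MConnected N r.1 r.2

end GMMN

/-! ### A real RAM

Programs are structured (assignment, sequence, branching, loop) and work on two infinite memories
with indirect addressing, one of natural numbers and one of real numbers, and on a write-only
output tape of reals. The arithmetic is only addition and subtraction (truncated on the natural
numbers) and comparison, with rational constants: there is no multiplication, no rounding, and no
conversion between reals and natural numbers. Each elementary operation costs one step. -/

namespace RealRAM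

/-- Configuration of the memories and of the output tape. -/
structure State where
  nat : ℕ → ℕ
  real : ℕ → ℝ
  out : List ℝ

/-- Expressions for natural numbers; `cell e` reads the natural number at address `e`. -/
inductive NExp where
  | const (k : ℕ)
  | cell (addr : NExp)
  | add (a b : NExp)
  | sub (a b : NExp)

/-- Expressions for real numbers; `cell e` reads the real number at address `e`. -/
inductive RExp where
  | const (c : ℚ)
  | cell (addr : NExp)
  | add (a b : RExp)
  | sub (a b : RExp)

/-- Tests. -/
inductive Test where
  | natLe (a b : NExp)
  | realLe (a b : RExp)
  | not (b : Test)
  | and (b c : Test)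

/-- Programs. -/
inductive Prog where
  | nop
  | setNat (addr e : NExp)
  | setReal (addr : NExp) (e : RExp)
  | write (e : RExp)
  | seq (P Q : Prog)
  | cond (b : Test) (P Q : Prog)
  | loop (b : Test) (P : Prog)

def NExp.val (s : State) : NExp → ℕ
  | const k => k
  | cell a => s.nat (a.val s)
  | add a b => a.val s + b.val s
  | sub a b => a.val s - b.val s

/-- Number of operations in the evaluation of an expression. -/
def NExp.cost : NExp → ℕ
  | const _ => 1
  | cell a => a.cost + 1
  | add a b => a.cost + b.cost + 1
  | sub a b => a.cost + b.cost + 1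

noncomputable def RExp.val (s : State) : RExp → ℝ
  | const c => (c : ℝ)
  | cell a => s.real (a.val s)
  | add a b => a.val s + b.val s
  | sub a b => a.val s - b.val s

/-- Number of operations in the evaluation of an expression. -/
def RExp.cost : RExp → ℕ
  | const _ => 1
  | cell a => a.cost + 1
  | add a b => a.cost + b.cost + 1
  | sub a b => a.cost + b.cost + 1

def Test.Holds (s : State) : Test → Prop
  | natLe a b => a.val s ≤ b.val s
  | realLe a b => a.val s ≤ b.val s
  | not b => ¬ b.Holds s
  | and b c => b.Holds s ∧ c.Holds s

/-- Number of operations in the evaluation of a test. -/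
def Test.cost : Test → ℕ
  | natLe a b => a.cost + b.cost + 1
  | realLe a b => a.cost + b.cost + 1
  | not b => b.cost + 1
  | and b c => b.cost + c.cost + 1

/-- `Exec P s t s'`: started in `s`, the program `P` halts after exactly `t` steps in `s'`. -/
inductive Exec : Prog → State → ℕ → State → Prop
  | nop (s : State) : Exec .nop s 1 s
  | setNat (a e : NExp) (s : State) :
      Exec (.setNat a e) s (a.cost + e.cost + 1)
        { s with nat := Function.update s.nat (a.val s) (e.val s) }
  | setReal (a : NExp) (e : RExp) (s : State) :
      Exec (.setReal a e) s (a.cost + e.cost + 1)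
        { s with real := Function.update s.real (a.val s) (e.val s) }
  | write (e : RExp) (s : State) :
      Exec (.write e) s (e.cost + 1) { s with out := s.out ++ [e.val s] }
  | seq {P Q : Prog} {s s' s'' : State} {t t' : ℕ} :
      Exec P s t s' → Exec Q s' t' s'' → Exec (.seq P Q) s (t + t') s''
  | cond_true {b : Test} {P Q : Prog} {s s' : State} {t : ℕ} :
      b.Holds s → Exec P s t s' → Exec (.cond b P Q) s (b.cost + t) s'
  | cond_false {b : Test} {P Q : Prog} {s s' : State} {t : ℕ} :
      ¬ b.Holds s → Exec Q s t s' → Exec (.cond b P Q) s (b.cost + t) s'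
  | loop_true {b : Test} {P : Prog} {s s' s'' : State} {t t' : ℕ} :
      b.Holds s → Exec P s t s' → Exec (.loop b P) s' t' s'' →
        Exec (.loop b P) s (b.cost + t + t') s''
  | loop_false {b : Test} {P : Prog} {s : State} :
      ¬ b.Holds s → Exec (.loop b P) s b.cost s

end RealRAM

/-! ### Approximation algorithms -/

namespace GMMN

/-- The `2 d` coordinates of two points. -/
def coords {d : ℕ} (p q : Pt d) : List ℝ := List.ofFn p ++ List.ofFn q

/-- The initial state on input `R`: the number of pairs is in cell `0` of the memory of natural
numbers, the coordinates of the terminals are in the first `2 d n` cells of the memory of reals,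
all other cells are zero, and the output tape is empty. -/
def input {d : ℕ} (R : Instance d) : RealRAM.State where
  nat := fun a => if a = 0 then R.length else 0
  real := fun a => (R.flatMap fun r => coords r.1 r.2).getD a 0
  out := []

/-- The list of the coordinates of the end points of the segments of a network. -/
def output {d : ℕ} (N : Network d) : List ℝ := N.flatMap fun s => coords s.src s.tgt

/-- The problem in `d` dimensions has a polynomial-time approximation algorithm of ratio `ρ`: one
program which, on every instance `R`, say with `n` pairs, halts within a number of steps that is
polynomial in `n`, and outputs a feasible network whose length is at most `ρ n` times that of
every feasible network. -/
def AdmitsApproximation (d : ℕ) (ρ : ℕ → ℝ) : Prop :=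
  ∃ (P : RealRAM.Prog) (p : Polynomial ℕ), ∀ R : Instance d,
    ∃ (t : ℕ) (s : RealRAM.State) (N : Network d),
      RealRAM.Exec P (input R) t s ∧ t ≤ p.eval R.length ∧ s.out = output N ∧
      Feasible R N ∧ ∀ N' : Network d, Feasible R N' → N.totalLength ≤ ρ R.length * N'.totalLength

end GMMN

/-! Grouping. Replace coordinates by ranks among the 2n terminals. In each direction the rank
interval of a pair has a dyadic scale l, with 2^l ≤ high − low + 1 < 2^(l+1), and a slot, the cell
of length 2^l containing its lower end. Pairs with equal scales and slots in all directions form a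
group. The last rank of the slot belongs to every rank interval of the group, so all bounding boxes
of a group share a point, the centre o (`centre_mem`). These boxes also lie in one box that is three
slots wide in each direction. With L = log₂(2n+1) + 1 scales, a given point is in at most (3L)^d
such group boxes (`card_inBox_le`). Manhattan paths from both terminals of a pair to o combine to
one for the pair, so it suffices to connect every terminal of a group to o.

Lower bound for a group. Cut a feasible network into edges of a grid whose coordinates include those
of the centres (`edgeLength_le_totalLength`), and keep the edges in the group box. Adding the
projections of these edges to the 2^d coordinate subspaces through o gives a graph that connects o
to all terminals of the group: for a pair (p, q), clamping the coordinates at o fixes p, sends q to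
o and acts on each grid edge as one of the projections (`reach_projEdges`). Doubling the edges and
shortcutting the resulting walk turns this into a tree on the sites (terminals and o) alone, at a
cost of 2·2^d times the length of the kept edges (`spannedBy_of_reach`).

Construction for a group. Prim's rule inserts the sites one by one into a linear order, each new
site directly after its nearest visited one. If Θ is the sum of the insertion distances, all site
distances are dominated by distances on a line of length at most 2Θ. The exchange argument
`SpannedBy.exchange` shows that any tree pays for Θ. Now split the positions into dyadic blocks of
all sizes. Represent each block by the point nearest to o in the bounding box of its sites, and join
it to the representative of its parent block. Since boxes grow with the blocks, representatives move
monotonically towards o, so the chain from a site to o is a Manhattan path (`mconnected_centre`).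
One level costs at most 4dΘ, and only L levels are nontrivial (`totalLength_groupNet_le`).

Summing over groups, each edge of the feasible network is charged at most (3L)^d times, and the
ratio is a constant times L·L^d, that is, O(log^(d+1) n).

Running time. Closure lemmas compile a small language of computable numbers, tests and statements to
the machine, each carrying a polynomial time bound. Every coordinate that the algorithm outputs is a
coordinate of some terminal, because centres and clamped points arise by selection only. So the
memory of reals is never written, and a point coordinate is represented by an address. All loops run
2n+2 times: the sites have numbers 0, …, 2n and their positions are 1, …, 2n+1. -/

namespace RealRAM

open Polynomial

/-! ### A functional language compiled to the real RAM -/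

/-- The part of a machine state that expressions can inspect: the size `n` of the input, the
(read-only) memory of reals, and one array of natural numbers. -/
structure World where
  n : ℕ
  X : ℕ → ℝ
  A : ℕ → ℕ

/-- The `i`-th register, stored at an even address. -/
def State.reg (s : State) (i : ℕ) : ℕ := s.nat (2 * (i + 1))

/-- The array, stored at the odd addresses. -/
def State.arr (s : State) (i : ℕ) : ℕ := s.nat (2 * i + 1)

/-- A context: a specification of the contents of the first `size` registers. -/
structure Ctx (Γ : Type) where
  size : ℕ
  Valid : ℕ → Γ → Prop
  Spec : Γ → (ℕ → ℕ) → Prop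
  loc : ∀ γ ρ ρ', (∀ i < size, ρ i = ρ' i) → Spec γ ρ → Spec γ ρ'

/-- The state `s` represents the world `w` and the values `γ` of the variables. -/
structure Rep {Γ : Type} (C : Ctx Γ) (w : World) (γ : Γ) (s : State) : Prop where
  n : s.nat 0 = w.n
  X : s.real = w.X
  A : s.arr = w.A
  valid : C.Valid w.n γ
  spec : C.Spec γ s.reg

/-- Only registers from `m` on differ. -/
structure Frame (m : ℕ) (s s' : State) : Prop where
  n : s'.nat 0 = s.nat 0
  real : s'.real = s.real
  out : s'.out = s.out
  arr : s'.arr = s.arr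
  reg : ∀ i < m, s'.reg i = s.reg i

theorem Frame.refl (m : ℕ) (s : State) : Frame m s s := ⟨rfl, rfl, rfl, rfl, fun _ _ => rfl⟩

theorem Frame.trans {m : ℕ} {s s' s'' : State} (h : Frame m s s') (h' : Frame m s' s'') :
    Frame m s s'' :=
  ⟨h'.n.trans h.n, h'.real.trans h.real, h'.out.trans h.out, h'.arr.trans h.arr,
    fun i hi => (h'.reg i hi).trans (h.reg i hi)⟩

theorem Frame.mono {m m' : ℕ} {s s' : State} (h : Frame m' s s') (hm : m ≤ m') : Frame m s s' :=
  ⟨h.n, h.real, h.out, h.arr, fun i hi => h.reg i (hi.trans_le hm)⟩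

theorem Rep.frame {Γ : Type} {C : Ctx Γ} {w : World} {γ : Γ} {s s' : State} {m : ℕ}
    (h : Rep C w γ s) (hm : C.size ≤ m) (hf : Frame m s s') : Rep C w γ s' :=
  ⟨hf.n.trans h.n, hf.real.trans h.X, hf.arr.trans h.A, h.valid,
    C.loc γ _ _ (fun i hi => (hf.reg i (hi.trans_le hm)).symm) h.spec⟩

/-- Assignment to a register. -/
def State.setReg (s : State) (m v : ℕ) : State :=
  { s with nat := Function.update s.nat (2 * (m + 1)) v }

theorem State.setReg_self (s : State) (m v : ℕ) : (s.setReg m v).reg m = v := by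
  simp [State.setReg, State.reg]

theorem Frame.setReg (s : State) (m v : ℕ) : Frame m s (s.setReg m v) := by
  refine ⟨?_, rfl, rfl, ?_, ?_⟩
  · simp [State.setReg, Function.update]
  · funext i
    have : 2 * i + 1 ≠ 2 * (m + 1) := by omega
    simp [State.setReg, State.arr, Function.update, this]
  · intro i hi
    have : 2 * (i + 1) ≠ 2 * (m + 1) := by omega
    simp [State.setReg, State.reg, Function.update, hi.ne]

/-- The program that assigns to a register. -/
def Prog.setReg (m : ℕ) (e : NExp) : Prog := .setNat (.const (2 * (m + 1))) e

/-- The expression that reads a register. -/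
def NExp.reg (m : ℕ) : NExp := .cell (.const (2 * (m + 1)))

@[simp] theorem NExp.reg_val (m : ℕ) (s : State) : (NExp.reg m).val s = s.reg m := rfl

theorem exec_setReg (m : ℕ) (e : NExp) (s : State) :
    Exec (.setReg m e) s (e.cost + 2) (s.setReg m (e.val s)) := by
  have h := Exec.setNat (.const (2 * (m + 1))) e s
  have e1 : (NExp.const (2 * (m + 1))).cost + e.cost + 1 = e.cost + 2 := by
    simp [NExp.cost]; omega
  rw [e1] at h
  exact h

variable {Γ : Type}

/-- The natural number `f` can be computed in polynomial time. -/
def NComp (C : Ctx Γ) (f : World → Γ → ℕ) : Prop :=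
  ∀ m, C.size ≤ m → ∃ (P : Prog) (p : Polynomial ℕ), ∀ w γ s, Rep C w γ s →
    ∃ t s', Exec P s t s' ∧ t ≤ p.eval w.n ∧ Frame m s s' ∧ s'.reg m = f w γ

/-- The truth value of a proposition. -/
noncomputable def ind (p : Prop) : ℕ := by classical exact if p then 1 else 0

theorem ind_eq (p : Prop) [Decidable p] : ind p = if p then 1 else 0 := by
  unfold ind; congr

/-- The proposition `b` can be decided in polynomial time. -/
def BComp (C : Ctx Γ) (b : World → Γ → Prop) : Prop := NComp C fun w γ => ind (b w γ)

/-- The real number `f` can be computed in polynomial time, as the value of an expression. -/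
def RComp (C : Ctx Γ) (f : World → Γ → ℝ) : Prop :=
  ∀ m, C.size ≤ m → ∃ (P : Prog) (p : Polynomial ℕ) (e : RExp) (m' : ℕ), m ≤ m' ∧
    ∀ w γ s, Rep C w γ s → ∃ t s', Exec P s t s' ∧ t ≤ p.eval w.n ∧ Frame m s s' ∧
      ∀ s'', Frame m' s' s'' → e.val s'' = f w γ

/-- The real number `f` is contained in a memory cell whose address can be computed in polynomial
time. -/
def PComp (C : Ctx Γ) (f : World → Γ → ℝ) : Prop :=
  ∃ e : World → Γ → ℕ, NComp C e ∧ ∀ w γ, f w γ = w.X (e w γ)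

/-! ### Closure properties of polynomial-time computability -/

theorem NComp.congr {C : Ctx Γ} {f g : World → Γ → ℕ} (hf : NComp C f)
    (h : ∀ w γ, C.Valid w.n γ → f w γ = g w γ) : NComp C g := by
  intro m hm
  obtain ⟨P, p, H⟩ := hf m hm
  refine ⟨P, p, fun w γ s hs => ?_⟩
  obtain ⟨t, s', h1, h2, h3, h4⟩ := H w γ s hs
  exact ⟨t, s', h1, h2, h3, h4.trans (h w γ hs.valid)⟩

theorem BComp.congr {C : Ctx Γ} {b c : World → Γ → Prop} (hb : BComp C b)
    (h : ∀ w γ, C.Valid w.n γ → (b w γ ↔ c w γ)) : BComp C c :=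
  NComp.congr hb fun w γ hv => by rw [h w γ hv]

/-- The context extended by a variable in register `m`. -/
def Ctx.up (C : Ctx Γ) (m : ℕ) : Ctx (Γ × ℕ) where
  size := max C.size (m + 1)
  Valid n p := C.Valid n p.1
  Spec p ρ := C.Spec p.1 ρ ∧ ρ m = p.2
  loc _ _ _ h hs := ⟨C.loc _ _ _ (fun i hi => h i (lt_max_of_lt_left hi)) hs.1,
    (h m (lt_max_of_lt_right (Nat.lt_succ_self m))) ▸ hs.2⟩

/-- The context extended by a variable in register `m` that ranges below `2 n + 2`. -/
def Ctx.upLt (C : Ctx Γ) (m : ℕ) : Ctx (Γ × ℕ) where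
  size := max C.size (m + 1)
  Valid n p := C.Valid n p.1 ∧ p.2 < 2 * n + 2
  Spec p ρ := C.Spec p.1 ρ ∧ ρ m = p.2
  loc _ _ _ h hs := ⟨C.loc _ _ _ (fun i hi => h i (lt_max_of_lt_left hi)) hs.1,
    (h m (lt_max_of_lt_right (Nat.lt_succ_self m))) ▸ hs.2⟩

theorem Ctx.up_size {C : Ctx Γ} {m : ℕ} (hm : C.size ≤ m) : (C.up m).size = m + 1 := by
  simp only [Ctx.up]; omega

theorem Ctx.upLt_size {C : Ctx Γ} {m : ℕ} (hm : C.size ≤ m) : (C.upLt m).size = m + 1 := by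
  simp only [Ctx.upLt]; omega

theorem Rep.up {C : Ctx Γ} {w : World} {γ : Γ} {s : State} {m x : ℕ} (h : Rep C w γ s)
    (hx : s.reg m = x) : Rep (C.up m) w (γ, x) s := ⟨h.n, h.X, h.A, h.valid, h.spec, hx⟩

theorem Rep.upLt {C : Ctx Γ} {w : World} {γ : Γ} {s : State} {m x : ℕ} (h : Rep C w γ s)
    (hx : s.reg m = x) (hlt : x < 2 * w.n + 2) : Rep (C.upLt m) w (γ, x) s :=
  ⟨h.n, h.X, h.A, ⟨h.valid, hlt⟩, h.spec, hx⟩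

theorem Rep.of_up {C : Ctx Γ} {w : World} {p : Γ × ℕ} {s : State} {m : ℕ}
    (h : Rep (C.up m) w p s) : Rep C w p.1 s ∧ s.reg m = p.2 :=
  ⟨⟨h.n, h.X, h.A, h.valid, h.spec.1⟩, h.spec.2⟩

theorem Rep.of_upLt {C : Ctx Γ} {w : World} {p : Γ × ℕ} {s : State} {m : ℕ}
    (h : Rep (C.upLt m) w p s) : Rep (C.up m) w p s :=
  ⟨h.n, h.X, h.A, h.valid.1, h.spec⟩

theorem NComp.up {C : Ctx Γ} {f : World → Γ → ℕ} (hf : NComp C f) (k : ℕ) :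
    NComp (C.up k) fun w p => f w p.1 := by
  intro m hm
  obtain ⟨P, p, H⟩ := hf m ((le_max_left _ _).trans hm)
  exact ⟨P, p, fun w γ s hs => H w γ.1 s hs.of_up.1⟩

theorem NComp.restrict {C : Ctx Γ} {k : ℕ} {f : World → Γ × ℕ → ℕ} (hf : NComp (C.up k) f) :
    NComp (C.upLt k) f := by
  intro m hm
  obtain ⟨P, p, H⟩ := hf m hm
  exact ⟨P, p, fun w γ s hs => H w γ s hs.of_upLt⟩

theorem NComp.upLt {C : Ctx Γ} {f : World → Γ → ℕ} (hf : NComp C f) (k : ℕ) :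
    NComp (C.upLt k) fun w p => f w p.1 := (hf.up k).restrict

theorem BComp.restrict {C : Ctx Γ} {k : ℕ} {f : World → Γ × ℕ → Prop} (hf : BComp (C.up k) f) :
    BComp (C.upLt k) f := NComp.restrict hf

/-- Expressions that only read the size of the input and registers that are in use. -/
theorem NComp.of_exp {C : Ctx Γ} {f : World → Γ → ℕ} (e : NExp)
    (he : ∀ w γ s, Rep C w γ s → e.val s = f w γ) : NComp C f := by
  intro m hm
  refine ⟨.setReg m e, Polynomial.C (e.cost + 2), fun w γ s hs => ?_⟩
  exact ⟨_, _, exec_setReg m e s, by simp, Frame.setReg _ _ _,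
    (State.setReg_self _ _ _).trans (he w γ s hs)⟩

theorem NComp.const (C : Ctx Γ) (k : ℕ) : NComp C fun _ _ => k :=
  .of_exp (.const k) fun _ _ _ _ => rfl

theorem NComp.size (C : Ctx Γ) : NComp C fun w _ => w.n :=
  .of_exp (.cell (.const 0)) fun _ _ _ hs => hs.n

theorem NComp.var (C : Ctx Γ) (k : ℕ) : NComp (C.up k) fun _ p => p.2 :=
  .of_exp (.reg k) fun _ _ _ hs => hs.spec.2

theorem NComp.varLt (C : Ctx Γ) (k : ℕ) : NComp (C.upLt k) fun _ p => p.2 :=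
  (NComp.var C k).restrict

theorem NComp.map₂ {C : Ctx Γ} {f g : World → Γ → ℕ} (op : ℕ → ℕ → ℕ) (e : NExp → NExp → NExp)
    (he : ∀ s a b, (e a b).val s = op (a.val s) (b.val s)) (hf : NComp C f) (hg : NComp C g) :
    NComp C fun w γ => op (f w γ) (g w γ) := by
  intro m hm
  obtain ⟨P, p, H⟩ := hf m hm
  obtain ⟨Q, q, G⟩ := hg (m + 1) (by omega)
  -- The first result waits in register m while the second is computed from register m+1 on, so it
  -- survives by the frame condition.
  refine ⟨.seq P (.seq Q (.setReg m (e (.reg m) (.reg (m + 1))))),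
    p + (q + Polynomial.C ((e (.reg m) (.reg (m + 1))).cost + 2)), fun w γ s hs => ?_⟩
  obtain ⟨t, s', h1, h2, h3, h4⟩ := H w γ s hs
  obtain ⟨t', s'', g1, g2, g3, g4⟩ := G w γ s' (hs.frame hm h3)
  refine ⟨_, _, .seq h1 (.seq g1 (exec_setReg _ _ _)), ?_,
    (h3.trans (g3.mono (by omega))).trans (Frame.setReg _ _ _), ?_⟩
  · simp only [eval_add, eval_C]; omega
  · rw [State.setReg_self, he, NExp.reg_val, NExp.reg_val, g4, g3.reg m (by omega), h4]

theorem NComp.add {C : Ctx Γ} {f g : World → Γ → ℕ} (hf : NComp C f) (hg : NComp C g) :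
    NComp C fun w γ => f w γ + g w γ := .map₂ _ .add (fun _ _ _ => rfl) hf hg

theorem NComp.sub {C : Ctx Γ} {f g : World → Γ → ℕ} (hf : NComp C f) (hg : NComp C g) :
    NComp C fun w γ => f w γ - g w γ := .map₂ _ .sub (fun _ _ _ => rfl) hf hg

theorem NComp.read {C : Ctx Γ} {f : World → Γ → ℕ} (hf : NComp C f) :
    NComp C fun w γ => w.A (f w γ) := by
  intro m hm
  obtain ⟨P, p, H⟩ := hf m hm
  let e : NExp := .cell (.add (.add (.reg m) (.reg m)) (.const 1))
  refine ⟨.seq P (.setReg m e), p + Polynomial.C (e.cost + 2), fun w γ s hs => ?_⟩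
  obtain ⟨t, s', h1, h2, h3, h4⟩ := H w γ s hs
  refine ⟨_, _, .seq h1 (exec_setReg _ _ _), ?_, h3.trans (Frame.setReg _ _ _), ?_⟩
  · simp only [eval_add, eval_C]; omega
  · beta_reduce
    rw [State.setReg_self, ← h4, ← hs.A, ← h3.arr]
    change s'.nat (s'.reg m + s'.reg m + 1) = s'.nat (2 * s'.reg m + 1)
    rw [two_mul]

theorem NComp.ite {C : Ctx Γ} {b : World → Γ → Prop} {f g : World → Γ → ℕ}
    [∀ w γ, Decidable (b w γ)] (hb : BComp C b) (hf : NComp C f) (hg : NComp C g) :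
    NComp C fun w γ => if b w γ then f w γ else g w γ := by
  intro m hm
  obtain ⟨B, r, K⟩ := hb m hm
  obtain ⟨P, p, H⟩ := hf m hm
  obtain ⟨Q, q, G⟩ := hg m hm
  let c : Test := .natLe (.const 1) (.reg m)
  refine ⟨.seq B (.cond c P Q), r + (Polynomial.C c.cost + (p + q)), fun w γ s hs => ?_⟩
  obtain ⟨t, s', h1, h2, h3, h4⟩ := K w γ s hs
  beta_reduce at h4
  rw [ind_eq] at h4
  by_cases h : b w γ
  · obtain ⟨t', s'', g1, g2, g3, g4⟩ := H w γ s' (hs.frame hm h3)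
    refine ⟨_, _, .seq h1 (.cond_true ?_ g1), ?_, h3.trans g3, ?_⟩
    · simp [c, Test.Holds, NExp.val, h4, h]
    · simp only [eval_add, eval_C]; omega
    · beta_reduce; rw [g4, if_pos h]
  · obtain ⟨t', s'', g1, g2, g3, g4⟩ := G w γ s' (hs.frame hm h3)
    refine ⟨_, _, .seq h1 (.cond_false ?_ g1), ?_, h3.trans g3, ?_⟩
    · simp [c, Test.Holds, NExp.val, h4, h]
    · simp only [eval_add, eval_C]; omega
    · beta_reduce; rw [g4, if_neg h]

theorem BComp.const (C : Ctx Γ) (p : Prop) : BComp C fun _ _ => p := NComp.const C _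

theorem BComp.not {C : Ctx Γ} {b : World → Γ → Prop} (hb : BComp C b) :
    BComp C fun w γ => ¬ b w γ := by
  classical
  refine (NComp.ite hb (.const C 0) (.const C 1)).congr fun w γ _ => ?_
  simp only [ind_eq]; split_ifs <;> tauto

theorem BComp.and {C : Ctx Γ} {b c : World → Γ → Prop} (hb : BComp C b) (hc : BComp C c) :
    BComp C fun w γ => b w γ ∧ c w γ := by
  classical
  refine (NComp.ite hb hc (.const C 0)).congr fun w γ _ => ?_
  simp only [ind_eq]; split_ifs <;> tauto

theorem BComp.or {C : Ctx Γ} {b c : World → Γ → Prop} (hb : BComp C b) (hc : BComp C c) :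
    BComp C fun w γ => b w γ ∨ c w γ := by
  classical
  refine (NComp.ite hb (.const C 1) hc).congr fun w γ _ => ?_
  simp only [ind_eq]; split_ifs <;> tauto

theorem BComp.forall_mem {ι : Type*} {C : Ctx Γ} {b : ι → World → Γ → Prop} (S : Finset ι)
    (hb : ∀ i ∈ S, BComp C (b i)) : BComp C fun w γ => ∀ i ∈ S, b i w γ := by
  classical
  induction S using Finset.induction_on with
  | empty => exact (BComp.const C True).congr fun w γ _ => by simp
  | insert a S _ ih =>
    refine (BComp.and (hb a (by simp)) (ih fun i hi => hb i (by simp [hi]))).congr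
      fun w γ _ => by simp

theorem BComp.forall_fintype {ι : Type*} [Fintype ι] {C : Ctx Γ} {b : ι → World → Γ → Prop}
    (hb : ∀ i, BComp C (b i)) : BComp C fun w γ => ∀ i, b i w γ :=
  (BComp.forall_mem Finset.univ fun i _ => hb i).congr fun w γ _ => by simp

/-- With truncated subtraction, 1 − (f − g) is already the truth value, so no branching is needed.
-/
theorem BComp.natLe {C : Ctx Γ} {f g : World → Γ → ℕ} (hf : NComp C f) (hg : NComp C g) :
    BComp C fun w γ => f w γ ≤ g w γ := by
  refine (NComp.sub (.const C 1) (NComp.sub hf hg)).congr fun w γ _ => ?_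
  rw [ind_eq]; split_ifs <;> omega

theorem BComp.natLt {C : Ctx Γ} {f g : World → Γ → ℕ} (hf : NComp C f) (hg : NComp C g) :
    BComp C fun w γ => f w γ < g w γ :=
  (BComp.natLe hg hf).not.congr fun _ _ _ => not_le

theorem BComp.natEq {C : Ctx Γ} {f g : World → Γ → ℕ} (hf : NComp C f) (hg : NComp C g) :
    BComp C fun w γ => f w γ = g w γ :=
  ((BComp.natLe hf hg).and (.natLe hg hf)).congr fun _ _ _ => le_antisymm_iff.symm

/-! ### Loops -/

/-- Total correctness with a time bound, by induction on the number j of remaining rounds; the last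
`b.cost` pays for the failing test. -/
theorem exec_loop {b : Test} {Q : Prog} {K T : ℕ} (I : ℕ → State → Prop)
    (hb : ∀ i s, i ≤ K → I i s → (b.Holds s ↔ i < K))
    (hQ : ∀ i s, i < K → I i s → ∃ t s', Exec Q s t s' ∧ t ≤ T ∧ I (i + 1) s') :
    ∀ j i, i + j = K → ∀ s, I i s →
      ∃ t s', Exec (.loop b Q) s t s' ∧ t ≤ j * (b.cost + T) + b.cost ∧ I K s' := by
  intro j
  induction j with
  | zero =>
    intro i hi s hs
    obtain rfl : i = K := by omega
    exact ⟨_, _, .loop_false (by rw [hb i s le_rfl hs]; omega), by omega, hs⟩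
  | succ j ih =>
    intro i hi s hs
    obtain ⟨t, s', h1, h2, h3⟩ := hQ i s (by omega) hs
    obtain ⟨t', s'', g1, g2, g3⟩ := ih (i + 1) (by omega) s' h3
    refine ⟨_, _, .loop_true ((hb i s (by omega) hs).2 (by omega)) h1 g1, ?_, g3⟩
    rw [Nat.succ_mul]; omega

/-- The bound `2 n + 2` of all loops. -/
def NExp.bound : NExp := .add (.add (.cell (.const 0)) (.cell (.const 0))) (.const 2)

theorem NExp.bound_val (s : State) : NExp.bound.val s = 2 * s.nat 0 + 2 := by
  simp only [NExp.bound, NExp.val]; omega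

/-- The test of a loop with its counter in register `m`. -/
def Test.counter (m : ℕ) : Test := .not (.natLe .bound (.reg m))

theorem Test.counter_holds (m : ℕ) (s : State) :
    (Test.counter m).Holds s ↔ s.reg m < 2 * s.nat 0 + 2 := by
  simp only [Test.counter, Test.Holds, NExp.bound_val, NExp.reg_val, not_le]

/-- Iteration with a counter. -/
def iter {α : Type*} (a : α) (g : ℕ → α → α) (K : ℕ) : α := Nat.rec a g K

@[simp] theorem iter_zero {α : Type*} (a : α) (g : ℕ → α → α) : iter a g 0 = a := rfl

@[simp] theorem iter_succ {α : Type*} (a : α) (g : ℕ → α → α) (K : ℕ) :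
    iter a g (K + 1) = g K (iter a g K) := rfl

theorem NComp.iter {C : Ctx Γ} {a : World → Γ → ℕ} {g : World → Γ → ℕ → ℕ → ℕ}
    (ha : NComp C a)
    (hg : ∀ m, C.size ≤ m →
      NComp ((C.up m).upLt (m + 1)) fun w p => g w p.1.1 p.2 p.1.2) :
    NComp C fun w γ => RealRAM.iter (a w γ) (g w γ) (2 * w.n + 2) := by
  intro m hm
  obtain ⟨P, p, H⟩ := ha m hm
  have hs1 : ((C.up m).upLt (m + 1)).size = m + 2 := by
    rw [Ctx.upLt_size (Ctx.up_size hm).le]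
  obtain ⟨Q, q, G⟩ := hg m hm (m + 2) hs1.le
  let body : Prog := .seq Q (.seq (.setReg m (.reg (m + 2)))
    (.setReg (m + 1) (.add (.reg (m + 1)) (.const 1))))
  let c1 : ℕ := (NExp.reg (m + 2)).cost + 2
  let c2 : ℕ := (NExp.add (.reg (m + 1)) (.const 1)).cost + 2
  let c0 : ℕ := (NExp.const 0).cost + 2
  refine ⟨.seq P (.seq (.setReg (m + 1) (.const 0)) (.loop (.counter (m + 1)) body)),
    p + (Polynomial.C c0 + ((Polynomial.C 2 * Polynomial.X + Polynomial.C 2) *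
      (Polynomial.C (Test.counter (m + 1)).cost + (q + Polynomial.C (c1 + c2)))
      + Polynomial.C (Test.counter (m + 1)).cost)), fun w γ s hs => ?_⟩
  obtain ⟨t, s', h1, h2, h3, h4⟩ := H w γ s hs
  have hs' := hs.frame hm h3
  -- The accumulator lives in register m, the counter in m+1, and the body works from m+2 on.
  let I : ℕ → State → Prop := fun i σ =>
    Frame m s' σ ∧ σ.reg m = RealRAM.iter (a w γ) (g w γ) i ∧ σ.reg (m + 1) = i
  have key := exec_loop (b := .counter (m + 1)) (Q := body) (K := 2 * w.n + 2)
    (T := q.eval w.n + (c1 + c2)) I (by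
      intro i σ _ hI
      rw [Test.counter_holds, hI.2.2, hI.1.n, hs'.n]) (by
      intro i σ hi hI
      have hσ := hs'.frame hm hI.1
      obtain ⟨t', σ', g1, g2, g3, g4⟩ := G w ((γ, _), i) σ ((hσ.up hI.2.1).upLt hI.2.2 hi)
      refine ⟨_, _, .seq g1 (.seq (exec_setReg _ _ _) (exec_setReg _ _ _)), ?_, ?_, ?_, ?_⟩
      · simp only [c1, c2]; omega
      · exact hI.1.trans ((g3.mono (by omega)).trans
          ((Frame.setReg _ _ _).trans ((Frame.setReg _ _ _).mono (by omega))))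
      · rw [(Frame.setReg _ (m + 1) _).reg m (by omega), State.setReg_self, NExp.reg_val, g4]
        rfl
      · rw [State.setReg_self]
        change (State.setReg _ _ _).reg (m + 1) + 1 = i + 1
        have : (σ'.setReg m ((NExp.reg (m + 2)).val σ')).reg (m + 1) = σ'.reg (m + 1) := by
          simp [State.setReg, State.reg, Function.update]
        rw [this, g3.reg (m + 1) (by omega), hI.2.2])
    (2 * w.n + 2) 0 (by omega) (s'.setReg (m + 1) 0) ⟨(Frame.setReg _ _ _).mono (by omega),
      by rw [(Frame.setReg s' (m + 1) _).reg m (by omega), h4]; rfl, State.setReg_self _ _ _⟩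
  obtain ⟨t', s'', g1, g2, g3⟩ := key
  refine ⟨_, _, .seq h1 (.seq (exec_setReg _ _ _) g1), ?_, h3.trans g3.1, g3.2.1⟩
  simp only [eval_add, eval_C, eval_mul, eval_X]
  simp only [c0]
  omega

theorem NComp.count {C : Ctx Γ} {b : World → Γ → ℕ → Prop} [∀ w γ, DecidablePred (b w γ)]
    (hb : ∀ m, C.size ≤ m → BComp (C.upLt m) fun w p => b w p.1 p.2) :
    NComp C fun w γ => ((Finset.range (2 * w.n + 2)).filter (b w γ)).card := by
  have key := NComp.iter (C := C) (a := fun _ _ => 0)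
    (g := fun w γ i acc => if b w γ i then acc + 1 else acc) (.const C 0) (by
      intro m hm
      refine NComp.ite ?_ (.add ((NComp.var C m).upLt _) (.const _ 1)) ((NComp.var C m).upLt _)
      intro k hk
      obtain ⟨P, p, H⟩ := hb (m + 1) (by omega) k (by
        rw [Ctx.upLt_size (by omega)]
        rw [Ctx.upLt_size (Ctx.up_size hm).le] at hk
        omega)
      -- The test was compiled for a context with the counter in register m+1 and nothing specified
      -- in register m, so its program also runs beside the accumulator.
      refine ⟨P, p, fun w γ s hs => H w (γ.1.1, γ.2) s ?_⟩
      have h1 := hs.of_upLt.of_up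
      exact h1.1.of_up.1.upLt h1.2 hs.valid.2)
  refine key.congr fun w γ _ => ?_
  generalize 2 * w.n + 2 = K
  induction K with
  | zero => rfl
  | succ K ih =>
    rw [iter_succ, ih, Finset.range_add_one, Finset.filter_insert]
    split_ifs <;> simp

theorem BComp.exists_lt {C : Ctx Γ} {b : World → Γ → ℕ → Prop}
    (hb : ∀ m, C.size ≤ m → BComp (C.upLt m) fun w p => b w p.1 p.2) :
    BComp C fun w γ => ∃ i < 2 * w.n + 2, b w γ i := by
  classical
  refine (BComp.natEq (NComp.count hb) (.const C 0)).not.congr fun w γ _ => ?_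
  rw [Finset.card_eq_zero, ← Ne, ← Finset.nonempty_iff_ne_empty]
  simp [Finset.Nonempty]

/-! ### Integer arithmetic beyond addition, by loops -/

theorem NComp.bound (C : Ctx Γ) : NComp C fun w _ => 2 * w.n + 2 :=
  (((NComp.size C).add (.size C)).add (.const C 2)).congr fun _ _ _ => by omega

theorem NComp.constMul {C : Ctx Γ} {f : World → Γ → ℕ} (hf : NComp C f) (k : ℕ) :
    NComp C fun w γ => k * f w γ := by
  induction k with
  | zero => exact (NComp.const C 0).congr fun _ _ _ => by simp
  | succ k ih => exact (ih.add hf).congr fun _ _ _ => by ring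

theorem NComp.min {C : Ctx Γ} {f g : World → Γ → ℕ} (hf : NComp C f) (hg : NComp C g) :
    NComp C fun w γ => min (f w γ) (g w γ) :=
  (NComp.ite (BComp.natLe hf hg) hf hg).congr fun _ _ _ => by rw [min_def]

theorem NComp.max {C : Ctx Γ} {f g : World → Γ → ℕ} (hf : NComp C f) (hg : NComp C g) :
    NComp C fun w γ => max (f w γ) (g w γ) :=
  (NComp.ite (BComp.natLe hf hg) hg hf).congr fun _ _ _ => by rw [max_def]

/-- Repeated addition: the machine cannot multiply. The loop has 2n+2 rounds, so one factor must not
exceed that bound; rounds beyond it leave the accumulator unchanged. -/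
theorem NComp.mul {C : Ctx Γ} {f g : World → Γ → ℕ} (hf : NComp C f) (hg : NComp C g)
    (hb : ∀ w γ, C.Valid w.n γ → f w γ ≤ 2 * w.n + 2) : NComp C fun w γ => f w γ * g w γ := by
  refine (NComp.iter (a := fun _ _ => 0)
    (g := fun w γ i acc => if i < f w γ then acc + g w γ else acc) (.const C 0) ?_).congr ?_
  · intro m hm
    exact .ite (.natLt (.varLt _ _) ((hf.up m).upLt _))
      (.add ((NComp.var C m).upLt _) ((hg.up m).upLt _)) ((NComp.var C m).upLt _)
  · intro w γ hv
    have h : ∀ K, RealRAM.iter 0 (fun i acc => if i < f w γ then acc + g w γ else acc) K =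
        Min.min K (f w γ) * g w γ := by
      intro K
      induction K with
      | zero => simp
      | succ K ih =>
        rw [iter_succ, ih]
        split_ifs with h
        · rw [min_eq_left h.le, min_eq_left h]; ring
        · rw [min_eq_right (by omega), min_eq_right (by omega)]
    rw [h, min_eq_right (hb w γ hv)]

/-- Repeated doubling; the bound on the exponent makes the 2n+2 rounds sufficient. -/
theorem NComp.pow2 {C : Ctx Γ} {f : World → Γ → ℕ} (hf : NComp C f)
    (hb : ∀ w γ, C.Valid w.n γ → f w γ ≤ 2 * w.n + 2) : NComp C fun w γ => 2 ^ f w γ := by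
  refine (NComp.iter (a := fun _ _ => 1)
    (g := fun w γ i acc => if i < f w γ then acc + acc else acc) (.const C 1) ?_).congr ?_
  · intro m hm
    exact .ite (.natLt (.varLt _ _) ((hf.up m).upLt _))
      (.add ((NComp.var C m).upLt _) ((NComp.var C m).upLt _)) ((NComp.var C m).upLt _)
  · intro w γ hv
    have h : ∀ K, RealRAM.iter 1 (fun i acc => if i < f w γ then acc + acc else acc) K =
        2 ^ Min.min K (f w γ) := by
      intro K
      induction K with
      | zero => simp
      | succ K ih =>
        rw [iter_succ, ih]
        split_ifs with h
        · rw [min_eq_left h.le, min_eq_left h]; ring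
        · rw [min_eq_right (by omega), min_eq_right (by omega)]
    rw [h, min_eq_right (hb w γ hv)]

/-- The quotient is the number of i with (i+1)·g ≤ f, and all such i are below the loop bound. -/
theorem NComp.div {C : Ctx Γ} {f g : World → Γ → ℕ} (hf : NComp C f) (hg : NComp C g)
    (hb : ∀ w γ, C.Valid w.n γ → f w γ ≤ 2 * w.n + 2 ∧ 0 < g w γ) :
    NComp C fun w γ => f w γ / g w γ := by
  refine (NComp.count (C := C) (b := fun w γ i => (i + 1) * g w γ ≤ f w γ) ?_).congr ?_
  · intro m hm
    refine .natLe (.mul ((NComp.varLt _ _).add (.const _ 1)) (hg.upLt m) ?_) (hf.upLt m)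
    intro w γ hv
    exact hv.2
  · intro w γ hv
    obtain ⟨h1, h2⟩ := hb w γ hv
    have : (Finset.range (2 * w.n + 2)).filter (fun i => (i + 1) * g w γ ≤ f w γ) =
        Finset.range (f w γ / g w γ) := by
      ext i
      rw [Finset.mem_filter, Finset.mem_range, Finset.mem_range, ← Nat.add_one_le_iff,
        ← Nat.add_one_le_iff, Nat.le_div_iff_mul_le h2]
      refine ⟨fun h => h.2, fun h => ⟨?_, h⟩⟩
      exact (Nat.le_mul_of_pos_right _ h2).trans (h.trans h1)
    rw [this, Finset.card_range]

/-- Again a count: the logarithm is the number of i with 2^(i+1) ≤ f. -/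
theorem NComp.log2 {C : Ctx Γ} {f : World → Γ → ℕ} (hf : NComp C f)
    (hb : ∀ w γ, C.Valid w.n γ → f w γ ≤ 2 * w.n + 2) : NComp C fun w γ => Nat.log 2 (f w γ) := by
  refine (NComp.count (C := C) (b := fun w γ i => 2 ^ (i + 1) ≤ f w γ) ?_).congr ?_
  · intro m hm
    refine .natLe (.pow2 ((NComp.varLt _ _).add (.const _ 1)) ?_) (hf.upLt m)
    intro w γ hv
    exact hv.2
  · intro w γ hv
    have h1 := hb w γ hv
    have : (Finset.range (2 * w.n + 2)).filter (fun i => 2 ^ (i + 1) ≤ f w γ) =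
        Finset.range (Nat.log 2 (f w γ)) := by
      ext i
      rw [Finset.mem_filter, Finset.mem_range, Finset.mem_range]
      constructor
      · rintro ⟨_, h⟩
        exact Nat.le_log_of_pow_le (by norm_num) h
      · intro h
        have h0 : f w γ ≠ 0 := by rintro h0; simp [h0] at h
        have h2 := Nat.pow_le_of_le_log h0 (x := i + 1) h
        exact ⟨((Nat.lt_pow_self (by norm_num)).trans_le (h2.trans h1)).trans' (by omega), h2⟩
    rw [this, Finset.card_range]

/-! ### Real numbers -/

theorem RComp.const (C : Ctx Γ) (c : ℚ) : RComp C fun _ _ => (c : ℝ) := fun m _ =>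
  ⟨.nop, Polynomial.C 1, .const c, m, le_rfl, fun w γ s _ =>
    ⟨_, _, .nop s, by simp, .refl _ _, fun _ _ => rfl⟩⟩

theorem PComp.rcomp {C : Ctx Γ} {f : World → Γ → ℝ} (hf : PComp C f) : RComp C f := by
  obtain ⟨a, ha, hfa⟩ := hf
  intro m hm
  obtain ⟨P, p, H⟩ := ha m hm
  -- The bound m+1 protects the register holding the address until the expression is evaluated.
  refine ⟨P, p, .cell (.reg m), m + 1, by omega, fun w γ s hs => ?_⟩
  obtain ⟨t, s', h1, h2, h3, h4⟩ := H w γ s hs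
  refine ⟨t, s', h1, h2, h3, fun s'' h => ?_⟩
  change s''.real (s''.reg m) = _
  rw [h.real, h3.real, hs.X, h.reg m (by omega), h4, hfa]

theorem RComp.map₂ {C : Ctx Γ} {f g : World → Γ → ℝ} (op : ℝ → ℝ → ℝ) (e : RExp → RExp → RExp)
    (he : ∀ s a b, (e a b).val s = op (a.val s) (b.val s)) (hf : RComp C f) (hg : RComp C g) :
    RComp C fun w γ => op (f w γ) (g w γ) := by
  intro m hm
  obtain ⟨P, p, e1, m1, hm1, H⟩ := hf m hm
  obtain ⟨Q, q, e2, m2, hm2, G⟩ := hg m1 (hm.trans hm1)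
  refine ⟨.seq P Q, p + q, e e1 e2, m2, hm1.trans hm2, fun w γ s hs => ?_⟩
  obtain ⟨t, s', h1, h2, h3, h4⟩ := H w γ s hs
  obtain ⟨t', s'', g1, g2, g3, g4⟩ := G w γ s' (hs.frame hm h3)
  refine ⟨_, _, .seq h1 g1, ?_, h3.trans (g3.mono hm1), fun σ hσ => ?_⟩
  · simp only [eval_add]; omega
  · rw [he, h4 σ (g3.trans (hσ.mono hm2)), g4 σ hσ]

theorem RComp.add {C : Ctx Γ} {f g : World → Γ → ℝ} (hf : RComp C f) (hg : RComp C g) :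
    RComp C fun w γ => f w γ + g w γ := .map₂ _ .add (fun _ _ _ => rfl) hf hg

theorem RComp.sub {C : Ctx Γ} {f g : World → Γ → ℝ} (hf : RComp C f) (hg : RComp C g) :
    RComp C fun w γ => f w γ - g w γ := .map₂ _ .sub (fun _ _ _ => rfl) hf hg

theorem RComp.congr {C : Ctx Γ} {f g : World → Γ → ℝ} (hf : RComp C f)
    (h : ∀ w γ, f w γ = g w γ) : RComp C g := by
  obtain rfl : f = g := by funext w γ; exact h w γ
  exact hf

theorem RComp.sum {ι : Type*} {C : Ctx Γ} {f : ι → World → Γ → ℝ} (S : Finset ι)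
    (hf : ∀ i, RComp C (f i)) : RComp C fun w γ => ∑ i ∈ S, f i w γ := by
  classical
  induction S using Finset.induction_on with
  | empty => exact (RComp.const C 0).congr fun w γ => by simp
  | insert a S ha ih =>
    exact (RComp.add (hf a) ih).congr fun w γ => by rw [Finset.sum_insert ha]

theorem RComp.up {C : Ctx Γ} {f : World → Γ → ℝ} (hf : RComp C f) (k : ℕ) :
    RComp (C.up k) fun w p => f w p.1 := by
  intro m hm
  obtain ⟨P, p, e, m', hm', H⟩ := hf m ((le_max_left _ _).trans hm)
  exact ⟨P, p, e, m', hm', fun w γ s hs => H w γ.1 s hs.of_up.1⟩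

theorem BComp.realLe {C : Ctx Γ} {f g : World → Γ → ℝ} (hf : RComp C f) (hg : RComp C g) :
    BComp C fun w γ => f w γ ≤ g w γ := by
  classical
  intro m hm
  obtain ⟨P, p, e1, m1, hm1, H⟩ := hf m hm
  obtain ⟨Q, q, e2, m2, hm2, G⟩ := hg m1 (hm.trans hm1)
  let c : Test := .realLe e1 e2
  refine ⟨.seq P (.seq Q (.cond c (.setReg m (.const 1)) (.setReg m (.const 0)))),
    p + (q + Polynomial.C (c.cost + 3)), fun w γ s hs => ?_⟩
  obtain ⟨t, s', h1, h2, h3, h4⟩ := H w γ s hs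
  obtain ⟨t', s'', g1, g2, g3, g4⟩ := G w γ s' (hs.frame hm h3)
  have hc : c.Holds s'' ↔ f w γ ≤ g w γ := by
    simp only [c, Test.Holds]
    rw [h4 s'' g3, g4 s'' (.refl _ _)]
  by_cases h : f w γ ≤ g w γ
  · refine ⟨_, _, .seq h1 (.seq g1 (.cond_true (hc.2 h) (exec_setReg _ _ _))), ?_,
      h3.trans ((g3.mono hm1).trans (Frame.setReg _ _ _)), ?_⟩
    · simp only [eval_add, eval_C, NExp.cost]; omega
    · beta_reduce; rw [State.setReg_self, ind_eq, if_pos h]; rfl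
  · refine ⟨_, _, .seq h1 (.seq g1 (.cond_false (mt hc.1 h) (exec_setReg _ _ _))), ?_,
      h3.trans ((g3.mono hm1).trans (Frame.setReg _ _ _)), ?_⟩
    · simp only [eval_add, eval_C, NExp.cost]; omega
    · beta_reduce; rw [State.setReg_self, ind_eq, if_neg h]; rfl

theorem BComp.realLt {C : Ctx Γ} {f g : World → Γ → ℝ} (hf : RComp C f) (hg : RComp C g) :
    BComp C fun w γ => f w γ < g w γ :=
  (BComp.realLe hg hf).not.congr fun _ _ _ => not_le

theorem PComp.cell {C : Ctx Γ} {e : World → Γ → ℕ} (he : NComp C e) :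
    PComp C fun w γ => w.X (e w γ) := ⟨e, he, fun _ _ => rfl⟩

theorem PComp.up {C : Ctx Γ} {f : World → Γ → ℝ} (hf : PComp C f) (k : ℕ) :
    PComp (C.up k) fun w p => f w p.1 := by
  obtain ⟨e, he, h⟩ := hf
  exact ⟨_, he.up k, fun w γ => h w γ.1⟩

/-- Selecting between two reals means selecting between their addresses. This is why minima, maxima
and clamped coordinates remain cells of the input. -/
theorem PComp.ite {C : Ctx Γ} {b : World → Γ → Prop} {f g : World → Γ → ℝ}
    [∀ w γ, Decidable (b w γ)] (hb : BComp C b) (hf : PComp C f) (hg : PComp C g) :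
    PComp C fun w γ => if b w γ then f w γ else g w γ := by
  obtain ⟨e, he, h⟩ := hf
  obtain ⟨e', he', h'⟩ := hg
  refine ⟨_, NComp.ite hb he he', fun w γ => ?_⟩
  simp only [h, h']
  split_ifs <;> rfl

theorem PComp.min {C : Ctx Γ} {f g : World → Γ → ℝ} (hf : PComp C f) (hg : PComp C g) :
    PComp C fun w γ => min (f w γ) (g w γ) := by
  have := PComp.ite (BComp.realLe hf.rcomp hg.rcomp) hf hg
  simpa only [min_def] using this

theorem PComp.max {C : Ctx Γ} {f g : World → Γ → ℝ} (hf : PComp C f) (hg : PComp C g) :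
    PComp C fun w γ => max (f w γ) (g w γ) := by
  have := PComp.ite (BComp.realLe hf.rcomp hg.rcomp) hg hf
  simpa only [max_def] using this

/-- The machine has no absolute value; the difference of maximum and minimum replaces it. -/
theorem PComp.dist {C : Ctx Γ} {f g : World → Γ → ℝ} (hf : PComp C f) (hg : PComp C g) :
    RComp C fun w γ => |f w γ - g w γ| :=
  ((hf.max hg).rcomp.sub (hf.min hg).rcomp).congr fun _ _ => by rw [max_sub_min_eq_abs']

/-- Exchange of the last two variables, and removal of the variable below the last one. -/
theorem RComp.skip {C : Ctx Γ} {m k : ℕ} {f : World → Γ × ℕ → ℝ} (hf : RComp (C.up k) f)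
    (hm : C.size ≤ m) (hk : m < k) : RComp ((C.up m).up k) fun w p => f w (p.1.1, p.2) := by
  intro l hl
  rw [Ctx.up_size (by rw [Ctx.up_size hm]; omega)] at hl
  obtain ⟨P, p, e, m', hm', H⟩ := hf l (by rw [Ctx.up_size (by omega)]; omega)
  exact ⟨P, p, e, m', hm', fun w γ s hs =>
    H w (γ.1.1, γ.2) s (hs.of_up.1.of_up.1.up hs.of_up.2)⟩

theorem NComp.skip {C : Ctx Γ} {m k : ℕ} {f : World → Γ × ℕ → ℕ} (hf : NComp (C.up k) f)
    (hm : C.size ≤ m) (hk : m < k) : NComp ((C.up m).up k) fun w p => f w (p.1.1, p.2) := by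
  intro l hl
  rw [Ctx.up_size (by rw [Ctx.up_size hm]; omega)] at hl
  obtain ⟨P, p, H⟩ := hf l (by rw [Ctx.up_size (by omega)]; omega)
  exact ⟨P, p, fun w γ s hs => H w (γ.1.1, γ.2) s (hs.of_up.1.of_up.1.up hs.of_up.2)⟩

/-! ### Minimization -/

open Classical in
/-- The first minimizer of `f` among the numbers `i < K` with `b i`; it is `K` if there are none. -/
noncomputable def argmin (K : ℕ) (b : ℕ → Prop) (f : ℕ → ℝ) : ℕ :=
  iter K (fun i acc => if b i ∧ (acc = K ∨ f i < f acc) then i else acc) K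

/-- Loop invariant: after L rounds the accumulator is either the default K, with no candidate below
L, or a best candidate among those below L. -/
theorem argmin_spec {K : ℕ} {b : ℕ → Prop} {f : ℕ → ℝ} :
    (argmin K b f = K ∧ ∀ i < K, ¬ b i) ∨
      (argmin K b f < K ∧ b (argmin K b f) ∧ ∀ i < K, b i → f (argmin K b f) ≤ f i) := by
  classical
  have key : ∀ L ≤ K,
      let a := iter K (fun i acc => if b i ∧ (acc = K ∨ f i < f acc) then i else acc) L
      (a = K ∧ ∀ i < L, ¬ b i) ∨ (a < K ∧ b a ∧ ∀ i < L, b i → f a ≤ f i) := by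
    intro L
    induction L with
    | zero => intro _; left; simp
    | succ L ih =>
      intro hL
      have ih := ih (by omega)
      simp only [iter_succ]
      generalize iter K (fun i acc => if b i ∧ (acc = K ∨ f i < f acc) then i else acc) L = a at ih
      simp only at ih ⊢
      rcases ih with ⟨h1, h2⟩ | ⟨h1, h2, h3⟩
      · by_cases hb : b L
        · right
          rw [if_pos ⟨hb, Or.inl h1⟩]
          refine ⟨by omega, hb, fun i hi hbi => ?_⟩
          rcases Nat.lt_succ_iff_lt_or_eq.1 hi with h | h
          · exact absurd hbi (h2 i h)
          · rw [h]
        · left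
          rw [if_neg (fun h => hb h.1)]
          refine ⟨h1, fun i hi => ?_⟩
          rcases Nat.lt_succ_iff_lt_or_eq.1 hi with h | h
          · exact h2 i h
          · rwa [h]
      · right
        by_cases hb : b L ∧ (a = K ∨ f L < f a)
        · rw [if_pos hb]
          have hlt : f L < f a := hb.2.resolve_left h1.ne
          refine ⟨by omega, hb.1, fun i hi hbi => ?_⟩
          rcases Nat.lt_succ_iff_lt_or_eq.1 hi with h | h
          · exact hlt.le.trans (h3 i h hbi)
          · rw [h]
        · rw [if_neg hb]
          refine ⟨h1, h2, fun i hi hbi => ?_⟩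
          rcases Nat.lt_succ_iff_lt_or_eq.1 hi with h | h
          · exact h3 i h hbi
          · subst h
            by_contra hc
            exact hb ⟨hbi, Or.inr (not_le.1 hc)⟩
  exact key K le_rfl

theorem argmin_of_exists {K : ℕ} {b : ℕ → Prop} {f : ℕ → ℝ} (h : ∃ i < K, b i) :
    argmin K b f < K ∧ b (argmin K b f) ∧ ∀ i < K, b i → f (argmin K b f) ≤ f i := by
  rcases argmin_spec (K := K) (b := b) (f := f) with h' | h'
  · obtain ⟨i, hi, hb⟩ := h
    exact absurd hb (h'.2 i hi)
  · exact h'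

theorem NComp.argmin {C : Ctx Γ} {b : World → Γ → ℕ → Prop} {f : World → Γ → ℕ → ℝ}
    (hb : ∀ m, C.size ≤ m → BComp (C.up m) fun w p => b w p.1 p.2)
    (hf : ∀ m, C.size ≤ m → RComp (C.up m) fun w p => f w p.1 p.2) :
    NComp C fun w γ => RealRAM.argmin (2 * w.n + 2) (b w γ) (f w γ) := by
  classical
  refine NComp.iter (a := fun w γ => 2 * w.n + 2) (g := fun w γ i acc =>
    if b w γ i ∧ (acc = 2 * w.n + 2 ∨ f w γ i < f w γ acc) then i else acc) (.bound C) ?_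
  intro m hm
  have hi : NComp ((C.up m).up (m + 1)) fun _ p => p.2 := .var _ _
  have hacc : NComp ((C.up m).up (m + 1)) fun _ p => p.1.2 := (NComp.var C m).up _
  refine NComp.restrict (.ite (.and ?_ (.or (.natEq hacc (.bound _)) (.realLt ?_ ?_))) hi hacc)
  -- The condition and the first value concern the counter in register m+1 and ignore the
  -- accumulator; the last value is evaluated at the accumulator in register m.
  · exact NComp.skip (hb (m + 1) (by omega)) hm (Nat.lt_succ_self m)
  · exact (hf (m + 1) (by omega)).skip hm (Nat.lt_succ_self m)
  · exact (hf m hm).up (m + 1)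

/-! ### Statements -/

/-- The statement with semantics `F`, which returns the new array and the numbers written, can be
executed in polynomial time. -/
def SComp (C : Ctx Γ) (F : World → Γ → (ℕ → ℕ) × List ℝ) : Prop :=
  ∃ (P : Prog) (p : Polynomial ℕ), ∀ w γ s, Rep C w γ s →
    ∃ t s', Exec P s t s' ∧ t ≤ p.eval w.n ∧ s'.nat 0 = s.nat 0 ∧ s'.real = s.real ∧
      (∀ i < C.size, s'.reg i = s.reg i) ∧ s'.arr = (F w γ).1 ∧ s'.out = s.out ++ (F w γ).2

theorem Rep.after {C : Ctx Γ} {w : World} {γ : Γ} {s s' : State} {A : ℕ → ℕ} (h : Rep C w γ s)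
    (h0 : s'.nat 0 = s.nat 0) (hr : s'.real = s.real) (hreg : ∀ i < C.size, s'.reg i = s.reg i)
    (hA : s'.arr = A) : Rep C { w with A := A } γ s' :=
  ⟨h0.trans h.n, hr.trans h.X, hA, h.valid, C.loc _ _ _ (fun i hi => (hreg i hi).symm) h.spec⟩

theorem SComp.congr {C : Ctx Γ} {F G : World → Γ → (ℕ → ℕ) × List ℝ} (hF : SComp C F)
    (h : ∀ w γ, C.Valid w.n γ → F w γ = G w γ) : SComp C G := by
  obtain ⟨P, p, H⟩ := hF
  refine ⟨P, p, fun w γ s hs => ?_⟩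
  obtain ⟨t, s', h1, h2, h3, h4, h5, h6, h7⟩ := H w γ s hs
  rw [h w γ hs.valid] at h6 h7
  exact ⟨t, s', h1, h2, h3, h4, h5, h6, h7⟩

theorem SComp.skip (C : Ctx Γ) : SComp C fun w _ => (w.A, []) :=
  ⟨.nop, Polynomial.C 1, fun _ _ s hs =>
    ⟨_, _, .nop s, by simp, rfl, rfl, fun _ _ => rfl, hs.A, by simp⟩⟩

theorem SComp.write {C : Ctx Γ} {f : World → Γ → ℝ} (hf : RComp C f) :
    SComp C fun w γ => (w.A, [f w γ]) := by
  obtain ⟨P, p, e, m', hm', H⟩ := hf C.size le_rfl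
  refine ⟨.seq P (.write e), p + Polynomial.C (e.cost + 1), fun w γ s hs => ?_⟩
  obtain ⟨t, s', h1, h2, h3, h4⟩ := H w γ s hs
  refine ⟨_, _, .seq h1 (.write e s'), ?_, h3.n, h3.real, h3.reg, h3.arr.trans hs.A, ?_⟩
  · simp only [eval_add, eval_C]; omega
  · simp only [h3.out, h4 s' (.refl _ _)]

theorem SComp.set {C : Ctx Γ} {f g : World → Γ → ℕ} (hf : NComp C f) (hg : NComp C g) :
    SComp C fun w γ => (Function.update w.A (f w γ) (g w γ), []) := by
  obtain ⟨P, p, H⟩ := hf C.size le_rfl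
  obtain ⟨Q, q, G⟩ := hg (C.size + 1) (by omega)
  let a : NExp := .add (.add (.reg C.size) (.reg C.size)) (.const 1)
  let e : NExp := .reg (C.size + 1)
  refine ⟨.seq P (.seq Q (.setNat a e)), p + (q + Polynomial.C (a.cost + e.cost + 1)),
    fun w γ s hs => ?_⟩
  obtain ⟨t, s', h1, h2, h3, h4⟩ := H w γ s hs
  obtain ⟨t', s'', g1, g2, g3, g4⟩ := G w γ s' (hs.frame le_rfl h3)
  have hf := h3.trans (g3.mono (Nat.le_succ _))
  have ha : a.val s'' = 2 * f w γ + 1 := by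
    change s''.reg C.size + s''.reg C.size + 1 = _
    rw [g3.reg _ (by omega), h4]; omega
  have he : e.val s'' = g w γ := g4
  refine ⟨_, _, .seq h1 (.seq g1 (.setNat a e s'')), ?_, ?_, hf.real, ?_, ?_, ?_⟩
  · simp only [eval_add, eval_C]; omega
  · rw [ha, ← hf.n]; simp [Function.update]
  · intro i hi
    rw [← hf.reg i hi, ha]
    have : 2 * (i + 1) ≠ 2 * f w γ + 1 := by omega
    simp [State.reg, Function.update, this]
  · beta_reduce
    rw [ha, he, ← hs.A, ← hf.arr]
    funext i
    by_cases hi : i = f w γ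
    · subst hi; simp [State.arr]
    · have : 2 * i + 1 ≠ 2 * f w γ + 1 := by omega
      simp [State.arr, Function.update, hi]
  · simp [hf.out]

theorem SComp.seq {C : Ctx Γ} {F G : World → Γ → (ℕ → ℕ) × List ℝ} (hF : SComp C F)
    (hG : SComp C G) : SComp C fun w γ =>
      ((G { w with A := (F w γ).1 } γ).1, (F w γ).2 ++ (G { w with A := (F w γ).1 } γ).2) := by
  obtain ⟨P, p, H⟩ := hF
  obtain ⟨Q, q, K⟩ := hG
  refine ⟨.seq P Q, p + q, fun w γ s hs => ?_⟩
  obtain ⟨t, s', h1, h2, h3, h4, h5, h6, h7⟩ := H w γ s hs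
  obtain ⟨t', s'', g1, g2, g3, g4, g5, g6, g7⟩ := K _ γ s' (hs.after h3 h4 h5 h6)
  refine ⟨_, _, .seq h1 g1, ?_, g3.trans h3, g4.trans h4, fun i hi => (g5 i hi).trans (h5 i hi),
    g6, ?_⟩
  · simp only [eval_add] at g2 ⊢; omega
  · rw [g7, h7, List.append_assoc]

theorem SComp.ite {C : Ctx Γ} {b : World → Γ → Prop} {F G : World → Γ → (ℕ → ℕ) × List ℝ}
    [∀ w γ, Decidable (b w γ)] (hb : BComp C b) (hF : SComp C F) (hG : SComp C G) :
    SComp C fun w γ => if b w γ then F w γ else G w γ := by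
  obtain ⟨B, r, K⟩ := hb C.size le_rfl
  obtain ⟨P, p, H⟩ := hF
  obtain ⟨Q, q, G'⟩ := hG
  let c : Test := .natLe (.const 1) (.reg C.size)
  refine ⟨.seq B (.cond c P Q), r + (Polynomial.C c.cost + (p + q)), fun w γ s hs => ?_⟩
  obtain ⟨t, s', h1, h2, h3, h4⟩ := K w γ s hs
  beta_reduce at h4
  rw [ind_eq] at h4
  by_cases h : b w γ
  · obtain ⟨t', s'', g1, g2, g3, g4, g5, g6, g7⟩ := H w γ s' (hs.frame le_rfl h3)
    refine ⟨_, _, .seq h1 (.cond_true ?_ g1), ?_, g3.trans h3.n, g4.trans h3.real,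
      fun i hi => (g5 i hi).trans (h3.reg i hi), ?_, ?_⟩
    · simp [c, Test.Holds, NExp.val, h4, h]
    · simp only [eval_add, eval_C]; omega
    · beta_reduce; rw [g6, if_pos h]
    · beta_reduce; rw [g7, if_pos h, h3.out]
  · obtain ⟨t', s'', g1, g2, g3, g4, g5, g6, g7⟩ := G' w γ s' (hs.frame le_rfl h3)
    refine ⟨_, _, .seq h1 (.cond_false ?_ g1), ?_, g3.trans h3.n, g4.trans h3.real,
      fun i hi => (g5 i hi).trans (h3.reg i hi), ?_, ?_⟩
    · simp [c, Test.Holds, NExp.val, h4, h]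
    · simp only [eval_add, eval_C]; omega
    · beta_reduce; rw [g6, if_neg h]
    · beta_reduce; rw [g7, if_neg h, h3.out]

theorem SComp.letN {C : Ctx Γ} {e : World → Γ → ℕ} {F : World → Γ × ℕ → (ℕ → ℕ) × List ℝ}
    (he : NComp C e) (hF : SComp (C.up C.size) F) : SComp C fun w γ => F w (γ, e w γ) := by
  obtain ⟨P, p, H⟩ := he C.size le_rfl
  obtain ⟨Q, q, G⟩ := hF
  refine ⟨.seq P Q, p + q, fun w γ s hs => ?_⟩
  obtain ⟨t, s', h1, h2, h3, h4⟩ := H w γ s hs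
  obtain ⟨t', s'', g1, g2, g3, g4, g5, g6, g7⟩ := G w (γ, e w γ) s' ((hs.frame le_rfl h3).up h4)
  rw [Ctx.up_size le_rfl] at g5
  refine ⟨_, _, .seq h1 g1, ?_, g3.trans h3.n, g4.trans h3.real,
    fun i hi => (g5 i (by omega)).trans (h3.reg i hi), g6, by rw [g7, h3.out]⟩
  simp only [eval_add]; omega

/-- The semantics of a loop. -/
def loopSem (f : ℕ → (ℕ → ℕ) → (ℕ → ℕ) × List ℝ) (A : ℕ → ℕ) (K : ℕ) : (ℕ → ℕ) × List ℝ :=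
  iter (A, []) (fun i r => ((f i r.1).1, r.2 ++ (f i r.1).2)) K

theorem loopSem_succ (f : ℕ → (ℕ → ℕ) → (ℕ → ℕ) × List ℝ) (A : ℕ → ℕ) (K : ℕ) :
    loopSem f A (K + 1) = ((f K (loopSem f A K).1).1,
      (loopSem f A K).2 ++ (f K (loopSem f A K).1).2) := rfl

theorem SComp.loop {C : Ctx Γ} {F : World → Γ × ℕ → (ℕ → ℕ) × List ℝ}
    (hF : SComp (C.upLt C.size) F) :
    SComp C fun w γ => loopSem (fun i A => F { w with A := A } (γ, i)) w.A (2 * w.n + 2) := by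
  obtain ⟨Q, q, G⟩ := hF
  rw [Ctx.upLt_size le_rfl] at G
  set m := C.size
  let body : Prog := .seq Q (.setReg m (.add (.reg m) (.const 1)))
  let c2 : ℕ := (NExp.add (.reg m) (.const 1)).cost + 2
  let c0 : ℕ := (NExp.const 0).cost + 2
  refine ⟨.seq (.setReg m (.const 0)) (.loop (.counter m) body),
    Polynomial.C c0 + ((Polynomial.C 2 * Polynomial.X + Polynomial.C 2) *
      (Polynomial.C (Test.counter m).cost + (q + Polynomial.C c2))
      + Polynomial.C (Test.counter m).cost), fun w γ s hs => ?_⟩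
  let L : ℕ → (ℕ → ℕ) × List ℝ := loopSem (fun i A => F { w with A := A } (γ, i)) w.A
  let I : ℕ → State → Prop := fun i σ =>
    (σ.nat 0 = s.nat 0 ∧ σ.real = s.real ∧ (∀ i < m, σ.reg i = s.reg i) ∧ σ.arr = (L i).1 ∧
      σ.out = s.out ++ (L i).2) ∧ σ.reg m = i
  have key := exec_loop (b := .counter m) (Q := body) (K := 2 * w.n + 2)
    (T := q.eval w.n + c2) I (by
      intro i σ _ hI
      rw [Test.counter_holds, hI.2, hI.1.1, hs.n]) (by
      rintro i σ hi ⟨⟨i1, i2, i3, i4, i5⟩, i6⟩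
      have hσ : Rep C { w with A := (L i).1 } γ σ := hs.after i1 i2 i3 i4
      obtain ⟨t', σ', g1, g2, g3, g4, g5, g6, g7⟩ := G _ (γ, i) σ (hσ.upLt i6 hi)
      have hfr := Frame.setReg σ' m ((NExp.add (.reg m) (.const 1)).val σ')
      refine ⟨_, _, .seq g1 (exec_setReg _ _ _), ?_, ⟨?_, ?_, ?_, ?_, ?_⟩, ?_⟩
      · simp only [c2] at g2 ⊢; omega
      · rw [hfr.n, g3, i1]
      · rw [hfr.real, g4, i2]
      · intro j hj
        rw [hfr.reg j hj, g5 j (by omega), i3 j hj]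
      · rw [hfr.arr, g6]; rfl
      · rw [hfr.out, g7, i5, List.append_assoc]; rfl
      · rw [State.setReg_self]
        change σ'.reg m + 1 = i + 1
        rw [g5 m (by omega), i6])
    (2 * w.n + 2) 0 (by omega) (s.setReg m 0) (by
      have hfr := Frame.setReg s m 0
      exact ⟨⟨hfr.n, hfr.real, hfr.reg, hfr.arr.trans hs.A, by rw [hfr.out]; simp [L, loopSem]⟩,
        State.setReg_self _ _ _⟩)
  obtain ⟨t', s'', g1, g2, ⟨i1, i2, i3, i4, i5⟩, _⟩ := key
  refine ⟨_, _, .seq (exec_setReg _ _ _) g1, ?_, i1, i2, i3, i4, i5⟩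
  simp only [eval_add, eval_C, eval_mul, eval_X]
  simp only [c0]
  omega

theorem loopSem_snd (f : ℕ → (ℕ → ℕ) → (ℕ → ℕ) × List ℝ) (A : ℕ → ℕ) (K : ℕ) :
    (loopSem f A K).2 = (List.range K).flatMap fun i => (f i (loopSem f A i).1).2 := by
  induction K with
  | zero => rfl
  | succ K ih =>
    rw [List.range_succ, List.flatMap_append, ← ih]
    simp [loopSem]

theorem SComp.flatMap {C : Ctx Γ} {G : World → Γ → ℕ → List ℝ}
    (hG : SComp (C.upLt C.size) fun w p => (w.A, G w p.1 p.2)) :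
    SComp C fun w γ => (w.A, (List.range (2 * w.n + 2)).flatMap (G w γ)) := by
  refine (SComp.loop hG).congr fun w γ _ => ?_
  have h : ∀ K, (loopSem (fun i A => (A, G { w with A := A } γ i)) w.A K).1 = w.A := by
    intro K
    induction K with
    | zero => rfl
    | succ K ih => simpa [loopSem] using ih
  refine Prod.ext (h _) ?_
  simp only [loopSem_snd, h]

/-- Update all entries of the array. -/
theorem SComp.mapArr {C : Ctx Γ} {g : World → Γ → ℕ → ℕ → ℕ}
    (hg : NComp ((C.upLt C.size).up (C.size + 1)) fun w p => g w p.1.1 p.1.2 p.2)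
    (hA : ∀ w γ A, g { w with A := A } γ = g w γ) :
    SComp C fun w γ => ((fun i => if i < 2 * w.n + 2 then g w γ i (w.A i) else w.A i), []) := by
  -- The new entry depends on the old entry at the same index only, so sequential updates in place
  -- agree with the simultaneous one; `hA` excludes any other dependence on the array.
  have h1 : SComp (C.upLt C.size) fun w p =>
      (Function.update w.A p.2 (g w p.1 p.2 (w.A p.2)), []) :=
    SComp.letN (F := fun w p => (Function.update w.A p.1.2 (g w p.1.1 p.1.2 p.2), []))
      (NComp.varLt C _).read (by
        rw [Ctx.upLt_size le_rfl]
        exact SComp.set ((NComp.varLt C _).up _) hg)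
  refine (SComp.loop h1).congr fun w γ _ => ?_
  have h : ∀ K, loopSem (fun i A => (Function.update A i (g { w with A := A } γ i (A i)), []))
      w.A K = ((fun i => if i < K then g w γ i (w.A i) else w.A i), []) := by
    intro K
    induction K with
    | zero => simp [loopSem]
    | succ K ih =>
      rw [loopSem_succ, ih]
      refine Prod.ext ?_ rfl
      funext i
      simp only [hA, Function.update_apply]
      split_ifs <;> first | omega | simp_all
  exact h _

theorem SComp.writeList {C : Ctx Γ} (l : List (World → Γ → ℝ)) (hl : ∀ f ∈ l, RComp C f) :
    SComp C fun w γ => (w.A, l.map fun f => f w γ) := by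
  induction l with
  | nil => exact SComp.skip C
  | cons f l ih =>
    exact (SComp.write (hl f (by simp))).seq (ih fun g hg => hl g (by simp [hg]))

/-- Iterate a statement that only modifies the array. -/
theorem SComp.iterate {C : Ctx Γ} {H : World → Γ → (ℕ → ℕ)}
    (hH : SComp (C.upLt C.size) fun w p => (H w p.1, [])) :
    SComp C fun w γ => ((fun A => H { w with A := A } γ)^[2 * w.n + 2] w.A, []) := by
  refine (SComp.loop hH).congr fun w γ _ => ?_
  have h : ∀ K, loopSem (fun i A => (H { w with A := A } γ, [])) w.A K =
      ((fun A => H { w with A := A } γ)^[K] w.A, []) := by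
    intro K
    induction K with
    | zero => rfl
    | succ K ih =>
      rw [loopSem_succ, ih, Function.iterate_succ_apply']
      rfl
  exact h _

/-- The empty context. -/
def Ctx.empty : Ctx Unit where
  size := 0
  Valid _ _ := True
  Spec _ _ := True
  loc _ _ _ _ h := h

end RealRAM

namespace GMMN

/-! ### The algorithm -/

open Finset

/-- The `v`-th terminal; the terminals of the `r`-th pair are numbered `2 r` and `2 r + 1`. -/
def terminal {d : ℕ} (X : ℕ → ℝ) (v : ℕ) : Pt d := fun j => X (d * v + j)

open Classical in
/-- The number of terminals whose `j`-th coordinate is less than `x`. -/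
noncomputable def rank {d : ℕ} (n : ℕ) (X : ℕ → ℝ) (j : Fin d) (x : ℝ) : ℕ :=
  ((range (2 * n + 2)).filter fun w => w < 2 * n ∧ terminal X w j < x).card

noncomputable def rankLow {d : ℕ} (n : ℕ) (X : ℕ → ℝ) (j : Fin d) (r : ℕ) : ℕ :=
  min (rank n X j (terminal X (2 * r) j)) (rank n X j (terminal X (2 * r + 1) j))

noncomputable def rankHigh {d : ℕ} (n : ℕ) (X : ℕ → ℝ) (j : Fin d) (r : ℕ) : ℕ :=
  max (rank n X j (terminal X (2 * r) j)) (rank n X j (terminal X (2 * r + 1) j))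

/-- The scale of a pair in direction `j`. -/
noncomputable def level {d : ℕ} (n : ℕ) (X : ℕ → ℝ) (j : Fin d) (r : ℕ) : ℕ :=
  Nat.log 2 (rankHigh n X j r - rankLow n X j r + 1)

/-- The position of a pair in direction `j`, at its scale. -/
noncomputable def slot {d : ℕ} (n : ℕ) (X : ℕ → ℝ) (j : Fin d) (r : ℕ) : ℕ :=
  rankLow n X j r / 2 ^ level n X j r

/-- Two pairs are in the same group if they have the same scale and position in all directions. -/
def SameGroup (d n : ℕ) (X : ℕ → ℝ) (r r' : ℕ) : Prop :=
  ∀ j : Fin d, level n X j r = level n X j r' ∧ slot n X j r = slot n X j r'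

/-- The smaller one of the `j`-th coordinates of the terminals of a pair. -/
noncomputable def lowCoord {d : ℕ} (X : ℕ → ℝ) (j : Fin d) (r : ℕ) : ℝ :=
  min (terminal X (2 * r) j) (terminal X (2 * r + 1) j)

/-- A point contained in the bounding boxes of all pairs in the group of `r`. -/
noncomputable def centre {d : ℕ} (n : ℕ) (X : ℕ → ℝ) (r : ℕ) : Pt d := fun j =>
  lowCoord X j (RealRAM.argmin (2 * n + 2) (fun r' => r' < n ∧ SameGroup d n X r r')
    (fun r' => 0 - lowCoord X j r'))

/-- The terminals of the pairs in the group of `r`. -/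
def IsTerminal (d n : ℕ) (X : ℕ → ℝ) (r v : ℕ) : Prop :=
  ∃ r' < 2 * n + 2, (r' < n ∧ SameGroup d n X r r') ∧ (v = 2 * r' ∨ v = 2 * r' + 1)

/-- The points to be connected in the group of `r`: the terminals and, with number `2 n`, the
centre. -/
noncomputable def site {d : ℕ} (n : ℕ) (X : ℕ → ℝ) (r v : ℕ) : Pt d := fun j =>
  if v < 2 * n then terminal X v j else centre n X r j

noncomputable def siteDist (d n : ℕ) (X : ℕ → ℝ) (r u v : ℕ) : ℝ :=
  manhattanDist (site n X r u : Pt d) (site n X r v)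

/-- The site of the tour that is nearest to the site `v`. A tour is given by the positions `A v`
of the sites, with `A v = 0` for the sites that are not on the tour. -/
noncomputable def nearest (d n : ℕ) (X : ℕ → ℝ) (r : ℕ) (A : ℕ → ℕ) (v : ℕ) : ℕ :=
  RealRAM.argmin (2 * n + 2) (fun u => A u ≠ 0) (fun u => siteDist d n X r u v)

/-- The terminal outside the tour that is nearest to the tour. -/
noncomputable def nextSite (d n : ℕ) (X : ℕ → ℝ) (r : ℕ) (A : ℕ → ℕ) : ℕ :=
  RealRAM.argmin (2 * n + 2) (fun v => IsTerminal d n X r v ∧ A v = 0)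
    (fun v => siteDist d n X r (nearest d n X r A v) v)

/-- The new position of the `i`-th site when `v` is inserted after position `p`. -/
def shift (v p i a : ℕ) : ℕ := if i = v then p + 1 else if p < a then a + 1 else a

/-- Insert the next terminal into the tour. -/
noncomputable def tourStep (d n : ℕ) (X : ℕ → ℝ) (r : ℕ) (A : ℕ → ℕ) : ℕ → ℕ :=
  if nextSite d n X r A < 2 * n + 2 then
    fun i => if i < 2 * n + 2 then
      shift (nextSite d n X r A) (A (nearest d n X r A (nextSite d n X r A))) i (A i) else A i
  else A

/-- The tour of the centre only. -/
def tourStart (n : ℕ) (A : ℕ → ℕ) : ℕ → ℕ := fun i =>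
  if i < 2 * n + 2 then (if i = 2 * n then 1 else 0) else A i

noncomputable def tour (d n : ℕ) (X : ℕ → ℝ) (r : ℕ) (A : ℕ → ℕ) : ℕ → ℕ :=
  (tourStep d n X r)^[2 * n + 2] (tourStart n A)

/-- The sites with a position in the `q`-th block of length `2 ^ k`. -/
def InBlock (A : ℕ → ℕ) (k q i : ℕ) : Prop := A i ≠ 0 ∧ q * 2 ^ k ≤ A i ∧ A i < (q + 1) * 2 ^ k

noncomputable def blockLow {d : ℕ} (n : ℕ) (X : ℕ → ℝ) (r : ℕ) (A : ℕ → ℕ) (k q : ℕ) : Pt d :=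
  fun j => site n X r
    (RealRAM.argmin (2 * n + 2) (InBlock A k q) (fun i => (site n X r i : Pt d) j)) j

noncomputable def blockHigh {d : ℕ} (n : ℕ) (X : ℕ → ℝ) (r : ℕ) (A : ℕ → ℕ) (k q : ℕ) : Pt d :=
  fun j => site n X r
    (RealRAM.argmin (2 * n + 2) (InBlock A k q) (fun i => 0 - (site n X r i : Pt d) j)) j

/-- The point of the bounding box of a block that is nearest to the centre. -/
noncomputable def blockPt {d : ℕ} (n : ℕ) (X : ℕ → ℝ) (r : ℕ) (A : ℕ → ℕ) (k q : ℕ) : Pt d :=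
  fun j => max (blockLow n X r A k q j) (min (centre n X r j) (blockHigh n X r A k q j))

/-- The point with the first `k` coordinates of `w` and the other ones of `u`. -/
def mix {d : ℕ} (u w : Pt d) (k : ℕ) : Pt d := fun i => if i.val < k then w i else u i

theorem axisParallel_mix {d : ℕ} (u w : Pt d) (j : Fin d) :
    AxisParallel (mix u w j) (mix u w (j + 1)) := by
  refine ⟨j, fun i hi => ?_⟩
  have : i.val ≠ j.val := fun h => hi (Fin.ext h)
  unfold mix
  split_ifs <;> first | rfl | omega

/-- A path from `u` to `w` that changes one coordinate after the other. -/
def pathNet {d : ℕ} (u w : Pt d) : Network d :=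
  (List.finRange d).map fun j : Fin d => ⟨mix u w j, mix u w (j + 1), axisParallel_mix u w j⟩

open Classical in
/-- The network for the group of `r`, given a tour. -/
noncomputable def groupNet (d n : ℕ) (X : ℕ → ℝ) (r : ℕ) (A : ℕ → ℕ) : Network d :=
  (List.range (2 * n + 2)).flatMap fun k => (List.range (2 * n + 2)).flatMap fun q =>
    if ∃ i < 2 * n + 2, InBlock A k q i then
      pathNet (blockPt n X r A k q) (blockPt n X r A (k + 1) (q / 2)) else []

/-- The pair `r` is the first one of its group. -/
def IsFirst (d n : ℕ) (X : ℕ → ℝ) (r : ℕ) : Prop :=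
  r < n ∧ ¬ ∃ r' < 2 * n + 2, r' < r ∧ SameGroup d n X r' r

open Classical in
/-- The network computed by the algorithm; `A r` is the content of the array before the group of
`r` is treated. -/
noncomputable def algNet (d n : ℕ) (X : ℕ → ℝ) (A : ℕ → ℕ → ℕ) : Network d :=
  (List.range (2 * n + 2)).flatMap fun r =>
    if IsFirst d n X r then groupNet d n X r (tour d n X r (A r)) else []

theorem rank_le {d : ℕ} (n : ℕ) (X : ℕ → ℝ) (j : Fin d) (x : ℝ) : rank n X j x ≤ 2 * n := by
  classical
  calc rank n X j x ≤ (range (2 * n)).card := by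
        refine card_le_card fun w hw => ?_
        simp only [mem_filter, mem_range] at hw ⊢
        exact hw.2.1
    _ = 2 * n := card_range _

/-! ### Its implementation -/

open RealRAM

variable {Γ : Type} {C : Ctx Γ} {d : ℕ}

theorem pcomp_terminal (j : Fin d) {v : World → Γ → ℕ} (hv : NComp C v) :
    PComp C fun w γ => (terminal w.X (v w γ) : Pt d) j :=
  .cell ((hv.constMul d).add (.const C j))

theorem ncomp_rank (j : Fin d) {x : World → Γ → ℝ} (hx : PComp C x) :
    NComp C fun w γ => rank w.n w.X j (x w γ) := by
  classical
  refine NComp.count (b := fun w γ v => v < 2 * w.n ∧ terminal w.X v j < x w γ) fun m _ => ?_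
  exact BComp.restrict (.and (.natLt (.var _ _) ((NComp.size _).constMul 2))
    (.realLt (pcomp_terminal j (.var _ _)).rcomp (hx.up m).rcomp))

theorem ncomp_rankLow (j : Fin d) {r : World → Γ → ℕ} (hr : NComp C r) :
    NComp C fun w γ => rankLow w.n w.X j (r w γ) :=
  .min (ncomp_rank j (pcomp_terminal j (hr.constMul 2)))
    (ncomp_rank j (pcomp_terminal j ((hr.constMul 2).add (.const C 1))))

theorem ncomp_rankHigh (j : Fin d) {r : World → Γ → ℕ} (hr : NComp C r) :
    NComp C fun w γ => rankHigh w.n w.X j (r w γ) :=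
  .max (ncomp_rank j (pcomp_terminal j (hr.constMul 2)))
    (ncomp_rank j (pcomp_terminal j ((hr.constMul 2).add (.const C 1))))

theorem rankLow_le (n : ℕ) (X : ℕ → ℝ) (j : Fin d) (r : ℕ) : rankLow n X j r ≤ 2 * n :=
  (min_le_left _ _).trans (rank_le _ _ _ _)

theorem rankHigh_le (n : ℕ) (X : ℕ → ℝ) (j : Fin d) (r : ℕ) : rankHigh n X j r ≤ 2 * n :=
  max_le (rank_le _ _ _ _) (rank_le _ _ _ _)

theorem level_le (n : ℕ) (X : ℕ → ℝ) (j : Fin d) (r : ℕ) :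
    level n X j r ≤ Nat.log 2 (2 * n + 1) :=
  Nat.log_mono_right (by have := rankHigh_le n X j r; omega)

theorem ncomp_level (j : Fin d) {r : World → Γ → ℕ} (hr : NComp C r) :
    NComp C fun w γ => level w.n w.X j (r w γ) :=
  .log2 (((ncomp_rankHigh j hr).sub (ncomp_rankLow j hr)).add (.const C 1))
    fun w γ _ => by have := rankHigh_le w.n w.X j (r w γ); omega

theorem ncomp_slot (j : Fin d) {r : World → Γ → ℕ} (hr : NComp C r) :
    NComp C fun w γ => slot w.n w.X j (r w γ) := by
  refine .div (ncomp_rankLow j hr) (.pow2 (ncomp_level j hr) fun w γ _ => ?_) fun w γ _ => ⟨?_, ?_⟩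
  · exact (level_le _ _ _ _).trans ((Nat.log_le_self _ _).trans (by omega))
  · exact (rankLow_le _ _ _ _).trans (by omega)
  · positivity

theorem bcomp_sameGroup {r r' : World → Γ → ℕ} (hr : NComp C r) (hr' : NComp C r') :
    BComp C fun w γ => SameGroup d w.n w.X (r w γ) (r' w γ) :=
  BComp.forall_fintype fun j => .and (.natEq (ncomp_level j hr) (ncomp_level j hr'))
    (.natEq (ncomp_slot j hr) (ncomp_slot j hr'))

theorem pcomp_lowCoord (j : Fin d) {r : World → Γ → ℕ} (hr : NComp C r) :
    PComp C fun w γ => lowCoord w.X j (r w γ) :=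
  .min (pcomp_terminal j (hr.constMul 2)) (pcomp_terminal j ((hr.constMul 2).add (.const C 1)))

theorem RComp.zero_sub {f : World → Γ → ℝ} (hf : RComp C f) : RComp C fun w γ => 0 - f w γ :=
  ((RComp.const C 0).sub hf).congr fun _ _ => by simp

theorem pcomp_centre (j : Fin d) {r : World → Γ → ℕ} (hr : NComp C r) :
    PComp C fun w γ => centre w.n w.X (r w γ) j := by
  refine pcomp_lowCoord j (.argmin
    (b := fun w γ r' => r' < w.n ∧ SameGroup d w.n w.X (r w γ) r')
    (f := fun w γ r' => 0 - lowCoord w.X j r') (fun m _ => ?_) (fun m _ => ?_))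
  · exact .and (.natLt (.var _ _) (.size _)) (bcomp_sameGroup (hr.up m) (.var _ _))
  · exact RComp.zero_sub (pcomp_lowCoord j (.var _ _)).rcomp

theorem bcomp_isTerminal {r v : World → Γ → ℕ} (hr : NComp C r) (hv : NComp C v) :
    BComp C fun w γ => IsTerminal d w.n w.X (r w γ) (v w γ) := by
  refine .exists_lt (b := fun w γ r' => (r' < w.n ∧ SameGroup d w.n w.X (r w γ) r') ∧
    (v w γ = 2 * r' ∨ v w γ = 2 * r' + 1)) fun m _ => ?_
  exact BComp.restrict (.and (.and (.natLt (.var _ _) (.size _))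
    (bcomp_sameGroup (hr.up m) (.var _ _))) (.or (.natEq (hv.up m) ((NComp.var _ _).constMul 2))
    (.natEq (hv.up m) (((NComp.var _ _).constMul 2).add (.const _ 1)))))

theorem pcomp_site (j : Fin d) {r v : World → Γ → ℕ} (hr : NComp C r) (hv : NComp C v) :
    PComp C fun w γ => site w.n w.X (r w γ) (v w γ) j :=
  .ite (.natLt hv ((NComp.size _).constMul 2)) (pcomp_terminal j hv) (pcomp_centre j hr)

theorem rcomp_siteDist {r u v : World → Γ → ℕ} (hr : NComp C r) (hu : NComp C u)
    (hv : NComp C v) : RComp C fun w γ => siteDist d w.n w.X (r w γ) (u w γ) (v w γ) :=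
  RComp.sum (f := fun j w γ => |(site w.n w.X (r w γ) (u w γ) : Pt d) j -
    (site w.n w.X (r w γ) (v w γ) : Pt d) j|) univ
    fun j => (pcomp_site j hr hu).dist (pcomp_site j hr hv)

theorem ncomp_nearest {r v : World → Γ → ℕ} (hr : NComp C r) (hv : NComp C v) :
    NComp C fun w γ => nearest d w.n w.X (r w γ) w.A (v w γ) := by
  refine .argmin (b := fun w γ u => w.A u ≠ 0)
    (f := fun w γ u => siteDist d w.n w.X (r w γ) u (v w γ)) (fun m _ => ?_) (fun m _ => ?_)
  · exact (BComp.natEq (NComp.var _ _).read (.const _ 0)).not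
  · exact rcomp_siteDist (hr.up m) (.var _ _) (hv.up m)

theorem ncomp_nextSite {r : World → Γ → ℕ} (hr : NComp C r) :
    NComp C fun w γ => nextSite d w.n w.X (r w γ) w.A := by
  refine .argmin (b := fun w γ v => IsTerminal d w.n w.X (r w γ) v ∧ w.A v = 0)
    (f := fun w γ v => siteDist d w.n w.X (r w γ) (nearest d w.n w.X (r w γ) w.A v) v)
    (fun m _ => ?_) (fun m _ => ?_)
  · exact .and (bcomp_isTerminal (hr.up m) (.var _ _)) (.natEq (NComp.var _ _).read (.const _ 0))
  · exact rcomp_siteDist (hr.up m) (ncomp_nearest (hr.up m) (.var _ _)) (.var _ _)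

theorem scomp_tourStep {r : World → Γ → ℕ} (hr : NComp C r) :
    SComp C fun w γ => (tourStep d w.n w.X (r w γ) w.A, []) := by
  classical
  have h := SComp.letN (F := fun w p => if p.2 < 2 * w.n + 2 then
      ((fun i => if i < 2 * w.n + 2 then
        shift p.2 (w.A (nearest d w.n w.X (r w p.1) w.A p.2)) i (w.A i) else w.A i), [])
      else (w.A, [])) (ncomp_nextSite (d := d) hr) (by
    refine .ite (.natLt (.var _ _) (.bound _)) ?_ (.skip _)
    -- The insertion position is stored before the update loop, because the loop overwrites the
    -- array that it is read from.
    have hn : NComp (C.up C.size) fun w p => w.A (nearest d w.n w.X (r w p.1) w.A p.2) :=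
      (ncomp_nearest (hr.up _) (.var _ _)).read
    refine SComp.letN (F := fun w (q : (Γ × ℕ) × ℕ) => ((fun i => if i < 2 * w.n + 2 then
        shift q.1.2 q.2 i (w.A i) else w.A i), [])) hn ?_
    refine SComp.mapArr (g := fun _ (q : (Γ × ℕ) × ℕ) i a => shift q.1.2 q.2 i a) ?_ (fun _ _ _ => rfl)
    have hv : NComp (C.up C.size) fun _ p => p.2 := .var _ _
    have hp : NComp ((C.up C.size).up (C.up C.size).size) fun _ p => p.2 := .var _ _
    have hi : NComp (((C.up C.size).up (C.up C.size).size).upLt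
      ((C.up C.size).up (C.up C.size).size).size) fun _ p => p.2 := .varLt _ _
    exact .ite (.natEq (hi.up _) (((hv.up _).upLt _).up _))
      (((hp.upLt _).up _).add (.const _ 1))
      (.ite (.natLt ((hp.upLt _).up _) (.var _ _)) ((NComp.var _ _).add (.const _ 1)) (.var _ _)))
  refine h.congr fun w γ _ => ?_
  unfold tourStep
  split_ifs <;> rfl

/-- The index r must not depend on the array, since it is evaluated again after the initialization
and each step have changed the array. -/
theorem scomp_tour {r : World → Γ → ℕ} (hr : NComp C r)
    (hA : ∀ w γ A, r { w with A := A } γ = r w γ) :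
    SComp C fun w γ => (tour d w.n w.X (r w γ) w.A, []) := by
  have h1 : SComp C fun w _ => (tourStart w.n w.A, []) := by
    refine SComp.mapArr (g := fun w _ i _ => if i = 2 * w.n then 1 else 0) ?_ (fun _ _ _ => rfl)
    exact .ite (.natEq ((NComp.varLt _ _).up _) ((NComp.size _).constMul 2)) (.const _ 1)
      (.const _ 0)
  have h2 := SComp.iterate (C := C) (H := fun w γ => tourStep d w.n w.X (r w γ) w.A)
    (scomp_tourStep (hr.upLt _))
  refine (h1.seq h2).congr fun w γ _ => ?_
  simp only [hA, tour]
  rfl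

/-- The two bounds are those under which powers and products are computable; the larger product has
the factor q + 1. -/
theorem bcomp_inBlock {k q i : World → Γ → ℕ} (hk : NComp C k) (hq : NComp C q) (hi : NComp C i)
    (hkb : ∀ w γ, C.Valid w.n γ → k w γ ≤ 2 * w.n + 2)
    (hqb : ∀ w γ, C.Valid w.n γ → q w γ + 1 ≤ 2 * w.n + 2) :
    BComp C fun w γ => InBlock w.A (k w γ) (q w γ) (i w γ) :=
  .and (BComp.natEq hi.read (.const _ 0)).not (.and
    (.natLe (.mul hq (hk.pow2 hkb) fun w γ h => (Nat.le_succ _).trans (hqb w γ h)) hi.read)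
    (.natLt hi.read (.mul (hq.add (.const _ 1)) (hk.pow2 hkb) hqb)))

theorem pcomp_blockPt (j : Fin d) {r k q : World → Γ → ℕ} (hr : NComp C r) (hk : NComp C k)
    (hq : NComp C q) (hkb : ∀ w γ, C.Valid w.n γ → k w γ ≤ 2 * w.n + 2)
    (hqb : ∀ w γ, C.Valid w.n γ → q w γ + 1 ≤ 2 * w.n + 2) :
    PComp C fun w γ => blockPt w.n w.X (r w γ) w.A (k w γ) (q w γ) j := by
  have hb : ∀ m, C.size ≤ m → BComp (C.up m) fun w p => InBlock w.A (k w p.1) (q w p.1) p.2 :=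
    fun m _ => bcomp_inBlock (hk.up m) (hq.up m) (.var _ _) (fun w γ h => hkb w γ.1 h)
      (fun w γ h => hqb w γ.1 h)
  have hs : ∀ m, RComp (C.up m) fun w p => (site w.n w.X (r w p.1) p.2 : Pt d) j :=
    fun m => (pcomp_site j (hr.up m) (.var _ _)).rcomp
  exact .max (pcomp_site j hr (.argmin (b := fun w γ => InBlock w.A (k w γ) (q w γ))
      (f := fun w γ i => (site w.n w.X (r w γ) i : Pt d) j) hb fun m _ => hs m))
    (.min (pcomp_centre j hr) (pcomp_site j hr (.argmin
      (b := fun w γ => InBlock w.A (k w γ) (q w γ))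
      (f := fun w γ i => 0 - (site w.n w.X (r w γ) i : Pt d) j) hb
      fun m _ => RComp.zero_sub (hs m))))

theorem scomp_pathNet {u v : World → Γ → Pt d} (hu : ∀ j, PComp C fun w γ => u w γ j)
    (hv : ∀ j, PComp C fun w γ => v w γ j) :
    SComp C fun w γ => (w.A, output (pathNet (u w γ) (v w γ))) := by
  have hm : ∀ k i, PComp C fun w γ => mix (u w γ) (v w γ) k i := by
    intro k i
    unfold mix
    split_ifs
    · exact hv i
    · exact hu i
  have h := SComp.writeList (C := C) ((List.finRange d).flatMap fun j : Fin d =>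
    (List.ofFn fun i w γ => mix (u w γ) (v w γ) j i) ++
    (List.ofFn fun i w γ => mix (u w γ) (v w γ) (j + 1) i)) (by
      intro f hf
      simp only [List.mem_flatMap, List.mem_append, List.mem_ofFn] at hf
      obtain ⟨j, _, ⟨i, rfl⟩ | ⟨i, rfl⟩⟩ := hf
      · exact (hm _ i).rcomp
      · exact (hm _ i).rcomp)
  refine h.congr fun w γ _ => ?_
  simp only [output, pathNet, coords, List.map_flatMap, List.flatMap_map, List.map_append,
    List.map_ofFn]
  rfl

theorem output_flatMap {ι : Type*} (l : List ι) (f : ι → Network d) :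
    output (l.flatMap f) = l.flatMap fun i => output (f i) := by
  simp only [output, List.flatMap_assoc]

theorem scomp_groupNet {r : World → Γ → ℕ} (hr : NComp C r) :
    SComp C fun w γ => (w.A, output (groupNet d w.n w.X (r w γ) w.A)) := by
  classical
  have h := SComp.flatMap (C := C) (G := fun w γ k => (List.range (2 * w.n + 2)).flatMap fun q =>
      if ∃ i < 2 * w.n + 2, InBlock w.A k q i then
      output (pathNet (blockPt w.n w.X (r w γ) w.A k q : Pt d)
        (blockPt w.n w.X (r w γ) w.A (k + 1) (q / 2))) else []) (by
    refine SComp.flatMap (C := C.upLt C.size) (G := fun w p q =>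
      if ∃ i < 2 * w.n + 2, InBlock w.A p.2 q i then
      output (pathNet (blockPt w.n w.X (r w p.1) w.A p.2 q : Pt d)
        (blockPt w.n w.X (r w p.1) w.A (p.2 + 1) (q / 2))) else []) ?_
    set C' := C.upLt C.size
    have hk : NComp (C'.upLt C'.size) fun _ p => p.1.2 := (NComp.varLt C _).upLt _
    have hq : NComp (C'.upLt C'.size) fun _ p => p.2 := .varLt _ _
    have hr' : NComp (C'.upLt C'.size) fun w p => r w p.1.1 := (hr.upLt _).upLt _
    have hb : BComp (C'.upLt C'.size) fun w p => ∃ i < 2 * w.n + 2, InBlock w.A p.1.2 p.2 i :=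
      .exists_lt (b := fun w (p : (Γ × ℕ) × ℕ) i => InBlock w.A p.1.2 p.2 i) fun m _ =>
        bcomp_inBlock (hk.upLt m) (hq.upLt m) (.varLt _ _) (fun w p h => h.1.1.2.le)
          fun w p h => h.1.2
    have hn := scomp_pathNet (C := C'.upLt C'.size) (d := d)
      (u := fun w p => blockPt w.n w.X (r w p.1.1) w.A p.1.2 p.2)
      (v := fun w p => blockPt w.n w.X (r w p.1.1) w.A (p.1.2 + 1) (p.2 / 2))
      (fun j => pcomp_blockPt j hr' hk hq (fun w p h => h.1.2.le) fun w p h => h.2)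
      (fun j => pcomp_blockPt j hr' (hk.add (.const _ 1))
        (hq.div (.const _ 2) fun w p h => ⟨h.2.le, by norm_num⟩)
        (fun w p h => h.1.2) fun w p h => by have := h.2; omega)
    refine (SComp.ite hb hn (.skip _)).congr fun w p _ => ?_
    split_ifs <;> rfl)
  refine h.congr fun w γ _ => ?_
  simp only [groupNet, output_flatMap]
  refine congrArg (Prod.mk w.A) ?_
  congr 1; funext k; congr 1; funext q
  split_ifs <;> rfl

theorem bcomp_isFirst {r : World → Γ → ℕ} (hr : NComp C r) :
    BComp C fun w γ => IsFirst d w.n w.X (r w γ) :=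
  .and (.natLt hr (.size _)) (BComp.not (.exists_lt
    (b := fun w γ r' => r' < r w γ ∧ SameGroup d w.n w.X r' (r w γ)) fun m _ =>
      BComp.restrict (.and (.natLt (.var _ _) (hr.up m)) (bcomp_sameGroup (.var _ _) (hr.up m)))))

/-- The array contents before each group are existentially quantified: whatever earlier groups left
there is irrelevant, as each tour resets all entries that it uses. -/
theorem exists_program (d : ℕ) : ∃ (P : Prog) (p : Polynomial ℕ), ∀ R : Instance d,
    ∃ (t : ℕ) (s : State) (A : ℕ → ℕ → ℕ), Exec P (input R) t s ∧ t ≤ p.eval R.length ∧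
      s.out = output (algNet d R.length (input R).real A) := by
  classical
  have hr : NComp (Ctx.empty.upLt Ctx.empty.size) fun _ p => p.2 := .varLt _ _
  have h := SComp.loop (C := Ctx.empty) (SComp.ite (bcomp_isFirst (d := d) hr)
    ((scomp_tour (d := d) hr fun _ _ _ => rfl).seq (scomp_groupNet (d := d) hr)) (.skip _))
  obtain ⟨P, p, H⟩ := h
  refine ⟨P, p, fun R => ?_⟩
  let w : World := ⟨R.length, (input R).real, fun _ => 0⟩
  have hrep : Rep Ctx.empty w () (input R) := by
    refine ⟨rfl, rfl, ?_, trivial, trivial⟩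
    funext i
    simp [State.arr, input, w]
  obtain ⟨t, s, h1, h2, _, _, _, _, h7⟩ := H w () _ hrep
  refine ⟨t, s, fun r => (loopSem (fun i A => if IsFirst d w.n w.X i then
      (tour d w.n w.X i A, output (groupNet d w.n w.X i (tour d w.n w.X i A))) else (A, []))
      w.A r).1, h1, h2, ?_⟩
  rw [h7]
  simp only [algNet, output_flatMap, List.nil_append]
  rw [loopSem_snd]
  change [] ++ _ = _
  rw [List.nil_append]
  congr 1; funext r
  split_ifs <;> rfl

end GMMN

namespace GMMN

open Finset

/-! ### Manhattan paths -/

variable {d : ℕ}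

theorem manhattanDist_comm (p q : Pt d) : manhattanDist p q = manhattanDist q p :=
  sum_congr rfl fun _ _ => abs_sub_comm _ _

theorem manhattanDist_nonneg (p q : Pt d) : 0 ≤ manhattanDist p q :=
  sum_nonneg fun _ _ => abs_nonneg _

theorem manhattanDist_self (p : Pt d) : manhattanDist p p = 0 := by simp [manhattanDist]

theorem manhattanDist_triangle (p q r : Pt d) :
    manhattanDist p r ≤ manhattanDist p q + manhattanDist q r := by
  unfold manhattanDist
  rw [← sum_add_distrib]
  exact sum_le_sum fun _ _ => abs_sub_le _ _ _

theorem abs_sub_le_manhattanDist (p q : Pt d) (j : Fin d) : |p j - q j| ≤ manhattanDist p q :=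
  single_le_sum (f := fun j => |p j - q j|) (fun _ _ => abs_nonneg _) (mem_univ j)

/-- The distances add up if each coordinate of `q` lies between the ones of `p` and `r`. -/
theorem manhattanDist_add {p q r : Pt d} (h : ∀ j, q j ∈ Set.uIcc (p j) (r j)) :
    manhattanDist p q + manhattanDist q r = manhattanDist p r := by
  unfold manhattanDist
  rw [← sum_add_distrib]
  refine sum_congr rfl fun j _ => ?_
  rcases Set.mem_uIcc.1 (h j) with ⟨h1, h2⟩ | ⟨h1, h2⟩
  · rw [abs_of_nonpos, abs_of_nonpos, abs_of_nonpos] <;> linarith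
  · rw [abs_of_nonneg, abs_of_nonneg, abs_of_nonneg] <;> linarith

/-- The triangle inequality holds in each coordinate, so equality of the sums forces equality in
every coordinate. -/
theorem mem_uIcc_of_manhattanDist_le {p q r : Pt d}
    (h : manhattanDist p q + manhattanDist q r ≤ manhattanDist p r) (j : Fin d) :
    q j ∈ Set.uIcc (p j) (r j) := by
  unfold manhattanDist at h
  rw [← sum_add_distrib] at h
  have h1 : ∀ i ∈ univ, |p i - r i| ≤ |p i - q i| + |q i - r i| := fun i _ => abs_sub_le _ _ _
  have h2 := (sum_eq_sum_iff_of_le h1).1 (le_antisymm (sum_le_sum h1) h) j (mem_univ j)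
  rw [Set.mem_uIcc]
  by_contra hc
  push Not at hc
  rcases le_total (p j) (r j) with h3 | h3
  · rcases le_or_gt (p j) (q j) with h4 | h4
    · have := hc.1 h4
      rw [abs_of_nonpos (by linarith), abs_of_nonpos (by linarith), abs_of_pos (by linarith)] at h2
      linarith
    · rw [abs_of_nonpos (by linarith), abs_of_pos (by linarith), abs_of_nonpos (by linarith)] at h2
      linarith
  · rcases le_or_gt (r j) (q j) with h4 | h4
    · have := hc.2 h4
      rw [abs_of_nonneg (by linarith), abs_of_neg (by linarith), abs_of_nonneg (by linarith)] at h2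
      linarith
    · rw [abs_of_nonneg (by linarith), abs_of_nonneg (by linarith), abs_of_neg (by linarith)] at h2
      linarith

theorem MConnected.refl (N : Network d) (p : Pt d) : MConnected N p p :=
  ⟨0, fun _ => p, rfl, rfl, fun _ h => absurd h (Nat.not_lt_zero _), by simp [manhattanDist_self]⟩

theorem AxisParallel.symm {p q : Pt d} (h : AxisParallel p q) : AxisParallel q p := by
  obtain ⟨i, hi⟩ := h
  exact ⟨i, fun j hj => (hi j hj).symm⟩

theorem MConnected.symm {N : Network d} {p q : Pt d} (h : MConnected N p q) :
    MConnected N q p := by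
  obtain ⟨k, v, h0, hk, hs, hl⟩ := h
  refine ⟨k, fun i => v (k - i), by simpa, by simpa, fun i hi => ?_, ?_⟩
  · have h1 : k - i = k - (i + 1) + 1 := by omega
    obtain ⟨h2, h3⟩ := hs (k - (i + 1)) (by omega)
    rw [← h1] at h2 h3
    exact ⟨h2.symm, by rwa [segment_symm]⟩
  · rw [manhattanDist_comm q p, ← hl,
      ← sum_range_reflect (fun i => manhattanDist (v i) (v (i + 1)))]
    refine sum_congr rfl fun i hi => ?_
    rw [mem_range] at hi
    beta_reduce
    rw [manhattanDist_comm]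
    have h1 : k - 1 - i = k - (i + 1) := by omega
    have h2 : k - (i + 1) + 1 = k - i := by omega
    rw [h1, h2]

theorem MConnected.trans {N : Network d} {p q r : Pt d} (h : MConnected N p q)
    (h' : MConnected N q r) (hd : manhattanDist p q + manhattanDist q r = manhattanDist p r) :
    MConnected N p r := by
  obtain ⟨k, v, h0, hk, hs, hl⟩ := h
  obtain ⟨k', v', h0', hk', hs', hl'⟩ := h'
  obtain ⟨V, e1, e2⟩ : ∃ V : ℕ → Pt d, (∀ i ≤ k, V i = v i) ∧ ∀ i, V (k + i) = v' i := by
    refine ⟨fun i => if i ≤ k then v i else v' (i - k), fun i hi => if_pos hi, fun i => ?_⟩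
    beta_reduce
    split_ifs with h
    · obtain rfl : i = 0 := by omega
      rw [add_zero, hk, h0']
    · congr 1; omega
  refine ⟨k + k', V, ?_, ?_, fun i hi => ?_, ?_⟩
  · rw [e1 0 (Nat.zero_le _), h0]
  · rw [e2, hk']
  · by_cases h : i < k
    · rw [e1 i h.le, e1 (i + 1) h]
      exact hs i h
    · obtain ⟨j, rfl⟩ := Nat.exists_eq_add_of_le (not_lt.1 h)
      rw [e2 j, add_assoc, e2 (j + 1)]
      exact hs' j (by omega)
  · rw [sum_range_add, ← hd, ← hl, ← hl']
    congr 1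
    · refine sum_congr rfl fun i hi => ?_
      rw [mem_range] at hi
      rw [e1 i hi.le, e1 (i + 1) hi]
    · refine sum_congr rfl fun i _ => ?_
      rw [e2 i, add_assoc, e2 (i + 1)]

theorem MConnected.mono {N N' : Network d} (hN : N ⊆ N') {p q : Pt d} (h : MConnected N p q) :
    MConnected N' p q := by
  obtain ⟨k, v, h0, hk, hs, hl⟩ := h
  refine ⟨k, v, h0, hk, fun i hi => ⟨(hs i hi).1, fun x hx => ?_⟩, hl⟩
  obtain ⟨s, hs1, hs2⟩ := (hs i hi).2 hx
  exact ⟨s, hN hs1, hs2⟩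

theorem mix_zero (u w : Pt d) : mix u w 0 = u := by funext i; simp [mix]

theorem mix_dim (u w : Pt d) : mix u w d = w := by funext i; simp [mix]

theorem manhattanDist_mix (u w : Pt d) (j : Fin d) :
    manhattanDist (mix u w j) (mix u w (j + 1)) = |u j - w j| := by
  unfold manhattanDist
  rw [sum_eq_single j]
  · simp [mix]
  · intro i _ hi
    have : i.val ≠ j.val := fun h => hi (Fin.ext h)
    have h1 : mix u w j i = mix u w (j + 1) i := by
      unfold mix
      split_ifs <;> first | rfl | omega
    rw [h1, sub_self, abs_zero]
  · simp

theorem mconnected_pathNet (u w : Pt d) : MConnected (pathNet u w) u w := by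
  refine ⟨d, mix u w, mix_zero u w, mix_dim u w, fun i hi => ?_, ?_⟩
  · refine ⟨axisParallel_mix u w ⟨i, hi⟩, fun x hx => ?_⟩
    exact ⟨_, List.mem_map.2 ⟨⟨i, hi⟩, List.mem_finRange _, rfl⟩, hx⟩
  · rw [sum_range]
    exact sum_congr rfl fun j _ => manhattanDist_mix u w j

theorem totalLength_pathNet (u w : Pt d) : (pathNet u w).totalLength = manhattanDist u w := by
  unfold Network.totalLength pathNet
  rw [List.map_map]
  have : ((fun s : Seg d => manhattanDist s.src s.tgt) ∘ fun j : Fin d =>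
      (⟨mix u w j, mix u w (j + 1), axisParallel_mix u w j⟩ : Seg d)) = fun j => |u j - w j| := by
    funext j
    exact manhattanDist_mix u w j
  rw [this, manhattanDist, ← List.ofFn_eq_map, List.sum_ofFn]

theorem totalLength_append (N N' : Network d) :
    Network.totalLength (N ++ N') = N.totalLength + N'.totalLength := by
  simp [Network.totalLength]

theorem totalLength_flatMap_range (f : ℕ → Network d) (K : ℕ) :
    Network.totalLength ((List.range K).flatMap f) = ∑ k ∈ range K, (f k).totalLength := by
  induction K with
  | zero => simp [Network.totalLength]
  | succ K ih =>
    rw [List.range_succ, List.flatMap_append, totalLength_append, ih, sum_range_succ]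
    simp

/-- The vertices of a Manhattan path lie in the bounding box of its end points. -/
theorem vertex_mem_uIcc {k : ℕ} {v : ℕ → Pt d}
    (hl : ∑ i ∈ range k, manhattanDist (v i) (v (i + 1)) = manhattanDist (v 0) (v k))
    {i : ℕ} (hi : i ≤ k) (j : Fin d) : v i j ∈ Set.uIcc (v 0 j) (v k j) := by
  have h1 : ∀ a b, manhattanDist (v a) (v (a + b)) ≤
      ∑ i ∈ range b, manhattanDist (v (a + i)) (v (a + i + 1)) := by
    intro a b
    induction b with
    | zero => simp [manhattanDist_self]
    | succ b ih =>
      rw [sum_range_succ]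
      exact (manhattanDist_triangle _ (v (a + b)) _).trans (by rw [← add_assoc]; linarith)
  obtain ⟨m, rfl⟩ := Nat.exists_eq_add_of_le hi
  refine mem_uIcc_of_manhattanDist_le ?_ j
  rw [← hl, sum_range_add]
  have h2 := h1 0 i
  simp only [zero_add] at h2
  exact add_le_add h2 (h1 i m)

end GMMN

namespace GMMN

open Finset

/-! ### Groups -/

variable {d : ℕ}

/-! ### Reading the terminals from the input -/

theorem getD_flatMap_of_length {α β : Type*} (f : α → List β) (m : ℕ) (hf : ∀ a, (f a).length = m)
    (z : β) (l : List α) (i : ℕ) (hi : i < l.length) (k : ℕ) (hk : k < m) :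
    (l.flatMap f).getD (m * i + k) z = (f l[i]).getD k z := by
  induction l generalizing i with
  | nil => simp at hi
  | cons a l ih =>
    rw [List.flatMap_cons]
    cases i with
    | zero =>
      rw [mul_zero, zero_add, List.getD_append _ _ _ _ (by rw [hf]; exact hk)]
      rfl
    | succ i =>
      rw [List.getD_append_right _ _ _ _ (by rw [hf]; nlinarith), hf]
      have h1 : m * (i + 1) + k - m = m * i + k := by
        rw [Nat.mul_succ]; omega
      rw [h1, ih i (by simpa using hi)]
      rfl

theorem terminal_input (R : Instance d) {i : ℕ} (hi : i < R.length) :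
    terminal (input R).real (2 * i) = R[i].1 ∧ terminal (input R).real (2 * i + 1) = R[i].2 := by
  have hlen : ∀ r : Pt d × Pt d, (coords r.1 r.2).length = 2 * d := by
    intro r; simp [coords]; ring
  have key : ∀ k < 2 * d, (input R).real (2 * d * i + k) = (coords R[i].1 R[i].2).getD k 0 :=
    fun k hk => getD_flatMap_of_length _ _ hlen 0 R i hi k hk
  constructor
  · funext j
    have hj := j.isLt
    have h1 : d * (2 * i) + j.val = 2 * d * i + j.val := by ring
    unfold terminal
    rw [h1, key j.val (by omega), coords, List.getD_append _ _ _ _ (by simp)]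
    simp
  · funext j
    have hj := j.isLt
    have h1 : d * (2 * i + 1) + j.val = 2 * d * i + (d + j.val) := by ring
    unfold terminal
    rw [h1, key (d + j.val) (by omega), coords, List.getD_append_right _ _ _ _ (by simp)]
    simp

/-! ### Ranks, dyadic scales and the common point of a group -/

theorem rank_mono (n : ℕ) (X : ℕ → ℝ) (j : Fin d) : Monotone (rank n X j) := by
  classical
  intro x y hxy
  refine card_le_card fun w hw => ?_
  rw [mem_filter] at hw ⊢
  exact ⟨hw.1, hw.2.1, hw.2.2.trans_le hxy⟩

/-- Strictness comes from the terminal v itself, which is counted for y but not for its own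
coordinate. -/
theorem rank_lt_of_terminal {n : ℕ} {X : ℕ → ℝ} {j : Fin d} {v : ℕ} (hv : v < 2 * n) {y : ℝ}
    (h : terminal X v j < y) : rank n X j (terminal X v j) < rank n X j y := by
  classical
  refine card_lt_card ⟨fun w hw => ?_, fun hs => ?_⟩
  · rw [mem_filter] at hw ⊢
    exact ⟨hw.1, hw.2.1, hw.2.2.trans h⟩
  · have : v ∈ (range (2 * n + 2)).filter fun w => w < 2 * n ∧ terminal X w j < y := by
      rw [mem_filter, mem_range]
      exact ⟨by omega, hv, h⟩
    have h1 := hs this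
    rw [mem_filter] at h1
    exact lt_irrefl _ h1.2.2

/-- The larger one of the `j`-th coordinates of the terminals of a pair. -/
noncomputable def highCoord (X : ℕ → ℝ) (j : Fin d) (r : ℕ) : ℝ :=
  max (terminal X (2 * r) j) (terminal X (2 * r + 1) j)

theorem rank_lowCoord (n : ℕ) (X : ℕ → ℝ) (j : Fin d) (r : ℕ) :
    rank n X j (lowCoord X j r) = rankLow n X j r := (rank_mono n X j).map_min

theorem rank_highCoord (n : ℕ) (X : ℕ → ℝ) (j : Fin d) (r : ℕ) :
    rank n X j (highCoord X j r) = rankHigh n X j r := (rank_mono n X j).map_max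

theorem SameGroup.refl (n : ℕ) (X : ℕ → ℝ) (r : ℕ) : SameGroup d n X r r := fun _ => ⟨rfl, rfl⟩

theorem SameGroup.symm {n : ℕ} {X : ℕ → ℝ} {r r' : ℕ} (h : SameGroup d n X r r') :
    SameGroup d n X r' r := fun j => ⟨(h j).1.symm, (h j).2.symm⟩

theorem SameGroup.trans {n : ℕ} {X : ℕ → ℝ} {r r' r'' : ℕ} (h : SameGroup d n X r r')
    (h' : SameGroup d n X r' r'') : SameGroup d n X r r'' :=
  fun j => ⟨(h j).1.trans (h' j).1, (h j).2.trans (h' j).2⟩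

/-- With s = 2^level, the number of ranks from low to high is at least s and less than 2s. So the
interval starts in its slot, reaches the last rank of the slot and ends before the third slot is
over. -/
theorem slot_spec (n : ℕ) (X : ℕ → ℝ) (j : Fin d) (r : ℕ) :
    slot n X j r * 2 ^ level n X j r ≤ rankLow n X j r ∧
    rankLow n X j r < (slot n X j r + 1) * 2 ^ level n X j r ∧
    (slot n X j r + 1) * 2 ^ level n X j r ≤ rankHigh n X j r + 1 ∧
    rankHigh n X j r < (slot n X j r + 3) * 2 ^ level n X j r := by
  have h0 : 0 < 2 ^ level n X j r := by positivity
  have h1 : slot n X j r * 2 ^ level n X j r ≤ rankLow n X j r := Nat.div_mul_le_self _ _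
  have h2 : rankLow n X j r < (slot n X j r + 1) * 2 ^ level n X j r := by
    rw [mul_comm]; exact Nat.lt_mul_div_succ _ h0
  have h3 : rankLow n X j r ≤ rankHigh n X j r := min_le_max
  have h4 : 2 ^ level n X j r ≤ rankHigh n X j r - rankLow n X j r + 1 :=
    Nat.pow_log_le_self 2 (by omega)
  have h5 : rankHigh n X j r - rankLow n X j r + 1 < 2 ^ (level n X j r + 1) :=
    Nat.lt_pow_succ_log_self (by norm_num) _
  rw [pow_succ] at h5
  generalize 2 ^ level n X j r = s at *
  refine ⟨h1, h2, ?_, ?_⟩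
  · rw [add_mul]; omega
  · rw [add_mul] at h2 ⊢; omega

/-- Both rank intervals contain the last rank of the common slot. A gap between the real intervals
would be a strict gap between ranks, as both ends are coordinates of terminals. -/
theorem lowCoord_le_highCoord {n : ℕ} {X : ℕ → ℝ} {r r' : ℕ} (hr : r < n)
    (h : SameGroup d n X r r') (j : Fin d) : lowCoord X j r' ≤ highCoord X j r := by
  by_contra hc
  rw [not_le] at hc
  have h1 : rankHigh n X j r < rankLow n X j r' := by
    rw [← rank_highCoord, ← rank_lowCoord]
    rcases max_choice (terminal X (2 * r) j) (terminal X (2 * r + 1) j) with h2 | h2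
    · unfold highCoord at hc ⊢
      rw [h2] at hc ⊢
      exact rank_lt_of_terminal (by omega) hc
    · unfold highCoord at hc ⊢
      rw [h2] at hc ⊢
      exact rank_lt_of_terminal (by omega) hc
  obtain ⟨_, _, h3, _⟩ := slot_spec n X j r
  obtain ⟨_, h4, _, _⟩ := slot_spec n X j r'
  rw [(h j).1, (h j).2] at h3
  omega

/-- The centre is contained in the bounding box of each pair of the group. -/
theorem centre_mem {n : ℕ} {X : ℕ → ℝ} {r r' : ℕ} (hr : r < n) (hr' : r' < n)
    (h : SameGroup d n X r r') (j : Fin d) :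
    (centre n X r : Pt d) j ∈ Set.uIcc (terminal X (2 * r') j) (terminal X (2 * r' + 1) j) := by
  obtain ⟨h1, ⟨h2, h3⟩, h4⟩ := RealRAM.argmin_of_exists (K := 2 * n + 2)
    (b := fun r' => r' < n ∧ SameGroup d n X r r') (f := fun r' => 0 - lowCoord X j r')
    ⟨r, by omega, hr, .refl n X r⟩
  -- Minimizing the negated values makes each centre coordinate the largest low coordinate in the
  -- group: at least the own one of each pair, and at most every high one.
  refine ⟨?_, lowCoord_le_highCoord hr' (h.symm.trans h3) j⟩
  have := h4 r' (by omega) ⟨hr', h⟩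
  change lowCoord X j r' ≤ lowCoord X j _
  linarith

/-- A box containing the bounding boxes of all pairs of the group of `r`. -/
def InBox (n : ℕ) (X : ℕ → ℝ) (r : ℕ) (x : Pt d) : Prop := ∀ j,
  slot n X j r * 2 ^ level n X j r ≤ rank n X j (x j) ∧
    rank n X j (x j) < (slot n X j r + 3) * 2 ^ level n X j r

theorem inBox_of_mem {n : ℕ} {X : ℕ → ℝ} {r r' : ℕ} (h : SameGroup d n X r r') {x : Pt d}
    (hx : ∀ j, x j ∈ Set.uIcc (terminal X (2 * r') j) (terminal X (2 * r' + 1) j)) :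
    InBox n X r x := by
  intro j
  obtain ⟨h1, _, _, h4⟩ := slot_spec n X j r'
  rw [(h j).1, (h j).2]
  refine ⟨h1.trans ?_, lt_of_le_of_lt ?_ h4⟩
  · rw [← rank_lowCoord]
    exact rank_mono n X j (hx j).1
  · rw [← rank_highCoord]
    exact rank_mono n X j (hx j).2

theorem IsFirst.eq {n : ℕ} {X : ℕ → ℝ} {r r' : ℕ} (hr : IsFirst d n X r)
    (hr' : IsFirst d n X r') (h : SameGroup d n X r r') : r = r' := by
  rcases lt_trichotomy r r' with h1 | h1 | h1
  · exact absurd ⟨r, by have := hr.1; omega, h1, h⟩ hr'.2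
  · exact h1
  · exact absurd ⟨r', by have := hr'.1; omega, h1, h.symm⟩ hr.2

theorem exists_isFirst {n : ℕ} (X : ℕ → ℝ) {r : ℕ} (hr : r < n) :
    ∃ r', IsFirst d n X r' ∧ SameGroup d n X r' r := by
  classical
  have hex : ∃ r', r' < n ∧ SameGroup d n X r' r := ⟨r, hr, .refl n X r⟩
  refine ⟨Nat.find hex, ⟨(Nat.find_spec hex).1, ?_⟩, (Nat.find_spec hex).2⟩
  rintro ⟨r', _, h1, h2⟩
  exact Nat.find_min hex h1 ⟨h1.trans (Nat.find_spec hex).1, h2.trans (Nat.find_spec hex).2⟩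

/-- Each point lies in few of the boxes of the groups. -/
theorem card_inBox_le (n : ℕ) (X : ℕ → ℝ) (x : Pt d) (S : Finset ℕ)
    (hS : ∀ r ∈ S, IsFirst d n X r ∧ InBox n X r x) :
    S.card ≤ (3 * (Nat.log 2 (2 * n + 1) + 1)) ^ d := by
  classical
  let T : Finset (Fin d → ℕ × ℕ) :=
    Fintype.piFinset fun _ => range (Nat.log 2 (2 * n + 1) + 1) ×ˢ range 3
  have hT : T.card = (3 * (Nat.log 2 (2 * n + 1) + 1)) ^ d := by
    simp [T, Fintype.card_piFinset, card_product, mul_comm]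
  rw [← hT]
  -- At a given scale, x lies in one dyadic cell, and the slot of the group is that cell or one of
  -- the two before it; the scale and this offset in {0, 1, 2} determine the group.
  let f : ℕ → Fin d → ℕ × ℕ := fun r j =>
    (level n X j r, rank n X j (x j) / 2 ^ level n X j r - slot n X j r)
  have hq : ∀ r ∈ S, ∀ j, slot n X j r ≤ rank n X j (x j) / 2 ^ level n X j r ∧
      rank n X j (x j) / 2 ^ level n X j r < slot n X j r + 3 := by
    intro r hr j
    obtain ⟨h1, h2⟩ := (hS r hr).2 j
    have h0 : 0 < 2 ^ level n X j r := by positivity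
    exact ⟨(Nat.le_div_iff_mul_le h0).2 h1, (Nat.div_lt_iff_lt_mul h0).2 h2⟩
  refine card_le_card_of_injOn f (fun r hr => ?_) (fun r hr r' hr' h => ?_)
  · rw [mem_coe, Fintype.mem_piFinset]
    intro j
    rw [mem_product, mem_range, mem_range]
    have := level_le n X j r
    have := hq r hr j
    constructor
    · change level n X j r < _
      omega
    · change rank n X j (x j) / 2 ^ level n X j r - slot n X j r < 3
      omega
  · refine (hS r hr).1.eq (hS r' hr').1 fun j => ?_
    have h1 := congrFun h j
    obtain ⟨h2, h3⟩ := Prod.mk.inj h1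
    refine ⟨h2, ?_⟩
    have := hq r hr j
    have := hq r' hr' j
    rw [h2] at *
    omega

end GMMN

namespace GMMN

open Finset Relation

/-! ### Spanning trees -/

variable {d : ℕ}

/-- Adjacency in a graph given by its edges. -/
def EdgeAdj (E : Finset (Pt d × Pt d)) (x y : Pt d) : Prop := (x, y) ∈ E ∨ (y, x) ∈ E

theorem EdgeAdj.symm {E : Finset (Pt d × Pt d)} {x y : Pt d} (h : EdgeAdj E x y) :
    EdgeAdj E y x := Or.symm h

theorem edgeAdj_reach_symm {E : Finset (Pt d × Pt d)} {x y : Pt d}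
    (h : ReflTransGen (EdgeAdj E) x y) : ReflTransGen (EdgeAdj E) y x := by
  induction h with
  | refl => exact .refl
  | tail _ h ih => exact .head h.symm ih

/-- The total length of the edges. -/
noncomputable def edgeLength (E : Finset (Pt d × Pt d)) : ℝ := ∑ e ∈ E, manhattanDist e.1 e.2

theorem edgeLength_nonneg (E : Finset (Pt d × Pt d)) : 0 ≤ edgeLength E :=
  sum_nonneg fun _ _ => manhattanDist_nonneg _ _

/-- Some set of edges of total length at most `c` with end points in `V` connects all points of
`V` with `S`. -/
def SpannedBy (S V : Set (Pt d)) (c : ℝ) : Prop :=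
  ∃ E : Finset (Pt d × Pt d), (∀ e ∈ E, e.1 ∈ V ∧ e.2 ∈ V) ∧
    (∀ v ∈ V, ∃ s ∈ S, ReflTransGen (EdgeAdj E) s v) ∧ edgeLength E ≤ c

theorem SpannedBy.nonneg {S V : Set (Pt d)} {c : ℝ} (h : SpannedBy S V c) : 0 ≤ c := by
  obtain ⟨E, _, _, h⟩ := h
  exact (edgeLength_nonneg E).trans h

/-- The exchange step of Prim's algorithm, with S regarded as contracted to a root. Delete the last
edge ab on which a path to v leaves S: what hung on b is still connected to the new root v, and what
hung on a is rooted at a itself. Iterated, it bounds the sum of all δ by c without ever naming a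
minimum spanning tree. -/
theorem SpannedBy.exchange {S V : Set (Pt d)} {c δ : ℝ} (h : SpannedBy S V c) {v : Pt d}
    (hv : v ∈ V) (hvS : v ∉ S) (hδ : ∀ a ∈ S, ∀ b ∈ V, b ∉ S → δ ≤ manhattanDist a b) :
    SpannedBy (insert v S) V (c - δ) := by
  classical
  obtain ⟨E, hEV, hE, hc⟩ := h
  -- If no such last exit existed, tracing the path back from v would never enter S, although it
  -- starts there.
  have hexit : ∃ a ∈ S, ∃ b, b ∉ S ∧ EdgeAdj E a b ∧
      ReflTransGen (fun x y => EdgeAdj E x y ∧ x ∉ S ∧ y ∉ S) b v := by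
    obtain ⟨s, hs, hp⟩ := hE v hv
    by_contra hcon
    have hQ : s ∉ S ∧ ReflTransGen (fun x y => EdgeAdj E x y ∧ x ∉ S ∧ y ∉ S) s v := by
      clear hs
      induction hp using ReflTransGen.head_induction_on with
      | refl => exact ⟨hvS, .refl⟩
      | @head x y hxy _ ih =>
        by_cases hx : x ∈ S
        · exact absurd ⟨x, hx, y, ih.1, hxy, ih.2⟩ hcon
        · exact ⟨hx, .head ⟨hxy, hx, ih.1⟩ ih.2⟩
    exact hQ.1 hs
  obtain ⟨a, ha, b, hb, hab, hbv⟩ := hexit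
  obtain ⟨e, he, hcase⟩ : ∃ e ∈ E, e = (a, b) ∨ e = (b, a) := by
    rcases hab with h | h
    exacts [⟨_, h, .inl rfl⟩, ⟨_, h, .inr rfl⟩]
  have hadj : ∀ x y, EdgeAdj E x y → EdgeAdj (E.erase e) x y ∨ (x = a ∧ y = b) ∨ x = b ∧ y = a := by
    intro x y hxy
    by_contra hcon
    push Not at hcon
    obtain ⟨h1, h2, h3⟩ := hcon
    unfold EdgeAdj at h1 hxy
    simp only [mem_erase, not_or, not_and] at h1
    rcases hxy with h | h
    · have h4 : (x, y) = e := by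
        by_contra h5
        exact h1.1 h5 h
      rcases hcase with h6 | h6 <;> rw [h6, Prod.mk.injEq] at h4 <;> tauto
    · have h4 : (y, x) = e := by
        by_contra h5
        exact h1.2 h5 h
      rcases hcase with h6 | h6 <;> rw [h6, Prod.mk.injEq] at h4 <;> tauto
  have hbv' : ReflTransGen (EdgeAdj (E.erase e)) b v := by
    refine ReflTransGen.mono (fun x y hxy => ?_) _ _ hbv
    rcases hadj x y hxy.1 with h | h | h
    · exact h
    · exact absurd ha (h.1 ▸ hxy.2.1)
    · exact absurd ha (h.2 ▸ hxy.2.2)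
  refine ⟨E.erase e, fun e' he' => hEV e' (mem_of_mem_erase he'), fun w hw => ?_, ?_⟩
  · obtain ⟨s, hs, hp⟩ := hE w hw
    clear hw
    induction hp with
    | refl => exact ⟨s, Set.mem_insert_of_mem _ hs, .refl⟩
    | @tail x y _ hxy ih =>
      obtain ⟨s', hs', hp'⟩ := ih
      rcases hadj x y hxy with h | ⟨_, rfl⟩ | ⟨_, rfl⟩
      · exact ⟨s', hs', hp'.tail h⟩
      · exact ⟨v, Set.mem_insert _ _, edgeAdj_reach_symm hbv'⟩
      · exact ⟨y, Set.mem_insert_of_mem _ ha, .refl⟩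
  · have h1 : edgeLength (E.erase e) + manhattanDist e.1 e.2 = edgeLength E :=
      sum_erase_add E _ he
    have h2 : δ ≤ manhattanDist e.1 e.2 := by
      obtain ⟨h3, h4⟩ := hEV e he
      rcases hcase with rfl | rfl
      · exact hδ a ha b h4 hb
      · rw [manhattanDist_comm]
        exact hδ a ha b h3 hb
    linarith

/-! ### Doubling and shortcutting walks -/

/-- The length of the path through a list of points. -/
noncomputable def pathLength : List (Pt d) → ℝ
  | [] => 0
  | [_] => 0
  | a :: b :: l => manhattanDist a b + pathLength (b :: l)

theorem pathLength_cons_le (a b : Pt d) (l : List (Pt d)) :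
    pathLength (a :: l) ≤ pathLength (a :: b :: l) := by
  cases l with
  | nil => simpa [pathLength] using manhattanDist_nonneg a b
  | cons c l =>
    simp only [pathLength]
    linarith [manhattanDist_triangle a b c]

theorem pathLength_le_cons (b : Pt d) (l : List (Pt d)) : pathLength l ≤ pathLength (b :: l) := by
  cases l with
  | nil => simp [pathLength]
  | cons c l =>
    simp only [pathLength]
    linarith [manhattanDist_nonneg b c]

/-- Skipping points shortens a path by the triangle inequality. The fixed first point a, arbitrary
in the induction, provides the predecessor of a skipped point. -/
theorem pathLength_cons_sublist {l l' : List (Pt d)} (h : l.Sublist l') (a : Pt d) :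
    pathLength (a :: l) ≤ pathLength (a :: l') := by
  induction h generalizing a with
  | slnil => exact le_rfl
  | cons b _ ih => exact (ih a).trans (pathLength_cons_le a b _)
  | cons_cons b _ ih =>
    simp only [pathLength]
    linarith [ih b]

theorem pathLength_sublist {l l' : List (Pt d)} (h : l.Sublist l') :
    pathLength l ≤ pathLength l' := by
  induction h with
  | slnil => exact le_rfl
  | cons b _ ih => exact ih.trans (pathLength_le_cons b _)
  | cons_cons b h _ => exact pathLength_cons_sublist h b

theorem pathLength_detour (l l' : List (Pt d)) (x y : Pt d) :
    pathLength (l ++ x :: y :: x :: l') =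
      pathLength (l ++ x :: l') + 2 * manhattanDist x y := by
  induction l with
  | nil =>
    simp only [List.nil_append, pathLength, manhattanDist_comm y x]
    ring
  | cons a l ih =>
    cases l with
    | nil =>
      simp only [List.cons_append, List.nil_append, pathLength, manhattanDist_comm y x]
      ring
    | cons b l =>
      simp only [List.cons_append, pathLength] at ih ⊢
      rw [ih]; ring

/-- A connected graph has a closed walk of at most twice its length. -/
theorem exists_walk (F : Finset (Pt d × Pt d)) (L : List (Pt d)) :
    ∃ L' : List (Pt d), L ⊆ L' ∧ (∀ x ∈ L', ∀ y, EdgeAdj F x y → y ∈ L') ∧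
      pathLength L' ≤ pathLength L + 2 * edgeLength F := by
  classical
  induction hk : F.card generalizing F L with
  | zero =>
    obtain rfl : F = ∅ := card_eq_zero.1 hk
    exact ⟨L, fun _ h => h, fun x _ y h => by simp [EdgeAdj] at h, by simp [edgeLength]⟩
  | succ k ih =>
    by_cases hcl : ∀ x ∈ L, ∀ y, EdgeAdj F x y → y ∈ L
    · exact ⟨L, fun _ h => h, hcl, by linarith [edgeLength_nonneg F]⟩
    · push Not at hcl
      obtain ⟨x, hx, y, hxy, hy⟩ := hcl
      obtain ⟨e, he, hcase⟩ : ∃ e ∈ F, e = (x, y) ∨ e = (y, x) := by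
        rcases hxy with h | h
        exacts [⟨_, h, .inl rfl⟩, ⟨_, h, .inr rfl⟩]
      obtain ⟨l, l', rfl⟩ := List.append_of_mem hx
      -- An edge leaving the walk is traversed forth and back by the detour x, y, x and then
      -- removed, so each edge is paid for at most twice.
      obtain ⟨L', h1, h2, h3⟩ := ih (F.erase e) (l ++ x :: y :: x :: l')
        (by rw [card_erase_of_mem he, hk]; rfl)
      have hxL : x ∈ L' := h1 (by simp)
      have hyL : y ∈ L' := h1 (by simp)
      refine ⟨L', fun z hz => h1 ?_, fun z hz w hzw => ?_, ?_⟩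
      · simp only [List.mem_append, List.mem_cons] at hz ⊢
        tauto
      · by_cases h4 : EdgeAdj (F.erase e) z w
        · exact h2 z hz w h4
        · unfold EdgeAdj at h4 hzw
          simp only [mem_erase, not_or, not_and] at h4
          rcases hzw with h | h
          · have h5 : (z, w) = e := by
              by_contra h6
              exact h4.1 h6 h
            rcases hcase with rfl | rfl
            · rw [(Prod.mk.inj h5).2]; exact hyL
            · rw [(Prod.mk.inj h5).2]; exact hxL
          · have h5 : (w, z) = e := by
              by_contra h6
              exact h4.2 h6 h
            rcases hcase with rfl | rfl
            · rw [(Prod.mk.inj h5).1]; exact hxL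
            · rw [(Prod.mk.inj h5).1]; exact hyL
      · rw [pathLength_detour] at h3
        have h4 : edgeLength (F.erase e) + manhattanDist e.1 e.2 = edgeLength F :=
          sum_erase_add F _ he
        have h5 : manhattanDist e.1 e.2 = manhattanDist x y := by
          rcases hcase with rfl | rfl
          · rfl
          · exact manhattanDist_comm _ _
        linarith

open Classical in
/-- The edges of the path through a list of points. -/
noncomputable def pathEdges : List (Pt d) → Finset (Pt d × Pt d)
  | [] => ∅
  | [_] => ∅
  | a :: b :: l => insert (a, b) (pathEdges (b :: l))

theorem edgeLength_pathEdges (l : List (Pt d)) : edgeLength (pathEdges l) ≤ pathLength l := by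
  classical
  induction l with
  | nil => simp [pathEdges, edgeLength, pathLength]
  | cons a l ih =>
    cases l with
    | nil => simp [pathEdges, edgeLength, pathLength]
    | cons b l =>
      simp only [pathEdges, pathLength]
      by_cases h : (a, b) ∈ pathEdges (b :: l)
      · rw [insert_eq_of_mem h]
        linarith [manhattanDist_nonneg a b]
      · unfold edgeLength at ih ⊢
        rw [sum_insert h]
        linarith

theorem mem_of_mem_pathEdges {l : List (Pt d)} {e : Pt d × Pt d} (h : e ∈ pathEdges l) :
    e.1 ∈ l ∧ e.2 ∈ l := by
  induction l with
  | nil => simp [pathEdges] at h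
  | cons a l ih =>
    cases l with
    | nil => simp [pathEdges] at h
    | cons b l =>
      simp only [pathEdges, mem_insert] at h
      rcases h with rfl | h
      · simp
      · exact ⟨List.mem_cons_of_mem _ (ih h).1, List.mem_cons_of_mem _ (ih h).2⟩

theorem reach_pathEdges (a : Pt d) (l : List (Pt d)) :
    ∀ x ∈ a :: l, ReflTransGen (EdgeAdj (pathEdges (a :: l))) a x := by
  induction l generalizing a with
  | nil =>
    intro x hx
    rw [List.mem_singleton.1 hx]
  | cons b l ih =>
    intro x hx
    rcases List.mem_cons.1 hx with rfl | hx
    · exact .refl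
    · refine .head (b := b) (Or.inl (by simp [pathEdges])) (ReflTransGen.mono (fun u v h => ?_) _ _ (ih b x hx))
      unfold EdgeAdj at h ⊢
      simp only [pathEdges, mem_insert]
      tauto

/-- A minimum spanning tree is at most twice as long as a connected graph with additional
vertices. -/
theorem spannedBy_of_reach {V : Set (Pt d)} {o : Pt d} (ho : o ∈ V) (F : Finset (Pt d × Pt d))
    (hF : ∀ v ∈ V, ReflTransGen (EdgeAdj F) o v) : SpannedBy {o} V (2 * edgeLength F) := by
  classical
  obtain ⟨L, h1, h2, h3⟩ := exists_walk F [o]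
  have hL : ∀ v ∈ V, v ∈ L := by
    intro v hv
    have hp := hF v hv
    clear hv
    induction hp with
    | refl => exact h1 (by simp)
    | tail _ h ih => exact h2 _ ih _ h
  -- Shortcut the walk past the additional vertices; the path that remains is the required tree.
  let l := L.filter (fun v => decide (v ∈ V))
  have hl : ∀ v, v ∈ l ↔ v ∈ V := by
    intro v
    simp only [l, List.mem_filter, decide_eq_true_eq]
    exact ⟨fun h => h.2, fun h => ⟨hL v h, h⟩⟩
  refine ⟨pathEdges l, fun e he => ?_, fun v hv => ⟨o, rfl, ?_⟩, ?_⟩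
  · have := mem_of_mem_pathEdges he
    exact ⟨(hl _).1 this.1, (hl _).1 this.2⟩
  · have ho' := (hl o).2 ho
    have hv' := (hl v).2 hv
    rcases hl' : l with _ | ⟨a, m⟩
    · rw [hl'] at ho'; simp at ho'
    · rw [hl'] at ho' hv'
      exact (edgeAdj_reach_symm (reach_pathEdges a m o ho')).trans (reach_pathEdges a m v hv')
  · refine (edgeLength_pathEdges l).trans ((pathLength_sublist List.filter_sublist).trans ?_)
    simpa [pathLength] using h3

end GMMN

namespace GMMN

open Finset Relation

/-! ### The tour -/

variable {d : ℕ}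

theorem IsTerminal.lt {n : ℕ} {X : ℕ → ℝ} {r v : ℕ} (h : IsTerminal d n X r v) : v < 2 * n := by
  obtain ⟨r', _, ⟨h1, _⟩, h2⟩ := h
  omega

theorem siteDist_comm (n : ℕ) (X : ℕ → ℝ) (r u v : ℕ) :
    siteDist d n X r u v = siteDist d n X r v u := manhattanDist_comm _ _

theorem siteDist_nonneg (n : ℕ) (X : ℕ → ℝ) (r u v : ℕ) : 0 ≤ siteDist d n X r u v :=
  manhattanDist_nonneg _ _

theorem siteDist_triangle (n : ℕ) (X : ℕ → ℝ) (r u v w : ℕ) :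
    siteDist d n X r u w ≤ siteDist d n X r u v + siteDist d n X r v w :=
  manhattanDist_triangle _ _ _

theorem site_centre (n : ℕ) (X : ℕ → ℝ) (r : ℕ) : (site n X r (2 * n) : Pt d) = centre n X r := by
  funext j
  simp [site]

/-- The sites on a tour. -/
def visited (n : ℕ) (A : ℕ → ℕ) : Finset ℕ := (range (2 * n + 2)).filter fun w => A w ≠ 0

theorem mem_visited {n : ℕ} {A : ℕ → ℕ} {w : ℕ} :
    w ∈ visited n A ↔ w < 2 * n + 2 ∧ A w ≠ 0 := by simp [visited]

/-- The sites of the group of `r`. -/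
def siteSet (d n : ℕ) (X : ℕ → ℝ) (r : ℕ) : Set (Pt d) :=
  {x | ∃ v, (v = 2 * n ∨ IsTerminal d n X r v) ∧ site n X r v = x}

/-- `A` is a tour: the distances of the sites are bounded by the differences of their positions on
a line, and the length of the line is bounded by the part of a minimum spanning tree. -/
structure TourInv (d n : ℕ) (X : ℕ → ℝ) (r : ℕ) (A : ℕ → ℕ) (τ : ℕ → ℝ) (Θ : ℝ) : Prop where
  centre : A (2 * n) ≠ 0
  isTerminal : ∀ w ∈ visited n A, w = 2 * n ∨ IsTerminal d n X r w
  inj : ∀ v ∈ visited n A, ∀ w ∈ visited n A, A v = A w → v = w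
  le_card : ∀ w ∈ visited n A, A w ≤ (visited n A).card
  mono : Monotone τ
  nonneg : 0 ≤ τ 0
  le : ∀ i, τ i ≤ 2 * Θ
  dist : ∀ v ∈ visited n A, ∀ w ∈ visited n A, A v ≤ A w →
    siteDist d n X r v w ≤ τ (A w) - τ (A v)
  span : ∀ c, SpannedBy {GMMN.centre n X r} (siteSet d n X r) c →
    SpannedBy ((fun v => (site n X r v : Pt d)) '' (visited n A)) (siteSet d n X r) (c - Θ)

theorem tourInv_start (d n : ℕ) (X : ℕ → ℝ) (r : ℕ) (A : ℕ → ℕ) :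
    TourInv d n X r (tourStart n A) (fun _ => 0) 0 := by
  have h1 : ∀ w, w ∈ visited n (tourStart n A) ↔ w = 2 * n := by
    intro w
    rw [mem_visited]
    unfold tourStart
    split_ifs with h2 h3
    · simp [h3]
    · simp [h3]
    · simp only [h2, false_and, false_iff]; omega
  have h2 : visited n (tourStart n A) = {2 * n} := by
    ext w; rw [h1, mem_singleton]
  constructor
  · simp [tourStart]
  · exact fun w hw => .inl ((h1 w).1 hw)
  · exact fun v hv w hw _ => ((h1 v).1 hv).trans ((h1 w).1 hw).symm
  · intro w hw
    rw [h2, (h1 w).1 hw]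
    simp [tourStart]
  · exact monotone_const
  · exact le_rfl
  · intro i; simp
  · intro v hv w hw _
    rw [(h1 v).1 hv, (h1 w).1 hw]
    simp [siteDist, manhattanDist_self]
  · intro c hc
    rw [h2, sub_zero]
    simpa [site_centre] using hc

/-- The position on the line after an insertion. -/
theorem exists_insert_line {τ : ℕ → ℝ} (hτ : Monotone τ) (p : ℕ) {δ : ℝ} (hδ : 0 ≤ δ) :
    ∃ τ' : ℕ → ℝ, Monotone τ' ∧ (∀ i ≤ p, τ' i = τ i) ∧ τ' (p + 1) = τ p + δ ∧
      ∀ i, p < i → τ' (i + 1) = τ i + 2 * δ := by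
  refine ⟨fun i => if i ≤ p then τ i else if i = p + 1 then τ p + δ else τ (i - 1) + 2 * δ,
    monotone_nat_of_le_succ fun i => ?_, fun i hi => if_pos hi, ?_, fun i hi => ?_⟩
  · have h0 := hτ (Nat.le_succ i)
    rcases lt_trichotomy i p with h | rfl | h
    · rw [if_pos h.le, if_pos (Nat.succ_le_of_lt h)]; exact h0
    · rw [if_pos le_rfl, if_neg (by omega), if_pos rfl]; linarith
    · rw [if_neg (by omega), if_neg (by omega : ¬ i + 1 ≤ p), if_neg (by omega : i + 1 ≠ p + 1),
        Nat.add_sub_cancel]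
      split_ifs with h1
      · have := hτ h.le; linarith
      · have := hτ (Nat.sub_le i 1); linarith
  · beta_reduce
    rw [if_neg (by omega), if_pos rfl]
  · beta_reduce
    rw [if_neg (by omega), if_neg (by omega), Nat.add_sub_cancel]

/-- The line is cut open behind u by a gap of length 2δ with v in its middle. Old distances do not
shrink, and v is at distance δ from both ends of the gap, so the triangle inequality through u
covers the new pairs. The line grows by 2δ while the exchange argument takes δ from the tree. -/
theorem TourInv.insert_site {n : ℕ} {X : ℕ → ℝ} {r : ℕ} {A A' : ℕ → ℕ} {τ : ℕ → ℝ} {Θ : ℝ}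
    (h : TourInv d n X r A τ Θ) {u v : ℕ} (hu : u ∈ visited n A) (hv : IsTerminal d n X r v)
    (hAv : A v = 0) (hmin : ∀ a ∈ visited n A, ∀ b, IsTerminal d n X r b → A b = 0 →
      siteDist d n X r u v ≤ siteDist d n X r a b)
    (hA' : ∀ i < 2 * n + 2, A' i = shift v (A u) i (A i)) :
    (visited n A').card = (visited n A).card + 1 ∧
      ∃ τ', TourInv d n X r A' τ' (Θ + siteDist d n X r u v) := by
  classical
  set δ := siteDist d n X r u v with hδdef
  have hδ : 0 ≤ δ := siteDist_nonneg _ _ _ _ _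
  have hvlt := hv.lt
  have hvK : v < 2 * n + 2 := by omega
  have hvv : v ∉ visited n A := fun h => (mem_visited.1 h).2 hAv
  have hA'v : A' v = A u + 1 := by rw [hA' v hvK]; simp [shift]
  have hold : ∀ w ∈ visited n A, A' w = if A u < A w then A w + 1 else A w := by
    intro w hw
    have hne : w ≠ v := fun h => hvv (h ▸ hw)
    rw [hA' w (mem_visited.1 hw).1, shift, if_neg hne]
  have hvis : visited n A' = insert v (visited n A) := by
    ext w
    rw [mem_insert, mem_visited, mem_visited]
    constructor
    · rintro ⟨h1, h2⟩
      by_cases hwv : w = v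
      · exact .inl hwv
      · rw [hA' w h1, shift, if_neg hwv] at h2
        refine .inr ⟨h1, fun h3 => h2 ?_⟩
        rw [h3]; simp
    · rintro (rfl | h1)
      · exact ⟨hvK, by rw [hA'v]; omega⟩
      · refine ⟨h1.1, ?_⟩
        rw [hold w (mem_visited.2 h1)]
        split_ifs
        · omega
        · exact h1.2
  have hcard : (visited n A').card = (visited n A).card + 1 := by
    rw [hvis, card_insert_of_notMem hvv]
  obtain ⟨τ', m1, m2, m3, m4⟩ := exists_insert_line h.mono (A u) hδ
  have hτle : ∀ i, τ' i ≤ 2 * (Θ + δ) := by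
    intro i
    rcases Nat.lt_or_ge (A u + 1) i with h1 | h1
    · obtain ⟨j, rfl⟩ : ∃ j, i = j + 1 := ⟨i - 1, by omega⟩
      rw [m4 j (by omega)]
      linarith [h.le j]
    · rcases Nat.lt_or_ge i (A u + 1) with h2 | h2
      · rw [m2 i (by omega)]
        linarith [h.le i]
      · rw [le_antisymm h1 h2, m3]
        linarith [h.le (A u)]
  refine ⟨hcard, τ', ?_, ?_, ?_, ?_, m1, ?_, hτle, ?_, ?_⟩
  · rw [hold (2 * n) (mem_visited.2 ⟨by omega, h.centre⟩)]
    have := h.centre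
    split_ifs <;> omega
  · intro w hw
    rw [hvis, mem_insert] at hw
    rcases hw with rfl | hw
    · exact .inr hv
    · exact h.isTerminal w hw
  · intro w hw x hx hwx
    rw [hvis, mem_insert] at hw hx
    rcases hw with rfl | hw <;> rcases hx with rfl | hx
    · rfl
    · rw [hA'v, hold x hx] at hwx
      split_ifs at hwx <;> omega
    · rw [hA'v, hold w hw] at hwx
      split_ifs at hwx <;> omega
    · rw [hold w hw, hold x hx] at hwx
      refine h.inj w hw x hx ?_
      split_ifs at hwx <;> omega
  · intro w hw
    rw [hcard]
    rw [hvis, mem_insert] at hw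
    rcases hw with rfl | hw
    · rw [hA'v]
      have := h.le_card u hu
      omega
    · rw [hold w hw]
      have := h.le_card w hw
      split_ifs <;> omega
  · rw [m2 0 (Nat.zero_le _)]; exact h.nonneg
  · have hline : ∀ w ∈ visited n A, A w ≤ A u ∧ A' w = A w ∧ τ' (A' w) = τ (A w) ∨
        A u < A w ∧ A' w = A w + 1 ∧ τ' (A' w) = τ (A w) + 2 * δ := by
      intro w hw
      have h1 := hold w hw
      rcases Nat.lt_or_ge (A u) (A w) with h2 | h2
      · rw [if_pos h2] at h1
        exact .inr ⟨h2, h1, by rw [h1, m4 _ h2]⟩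
      · rw [if_neg (by omega)] at h1
        exact .inl ⟨h2, h1, by rw [h1, m2 _ h2]⟩
    intro w hw x hx hwx
    rw [hvis, mem_insert] at hw hx
    rcases hw with rfl | hw <;> rcases hx with rfl | hx
    · simp [siteDist, manhattanDist_self]
    · rw [hA'v] at hwx ⊢
      rw [m3]
      rcases hline x hx with ⟨h1, h2, h3⟩ | ⟨h1, h2, h3⟩
      · omega
      · rw [h3]
        have h4 := h.dist u hu x hx h1.le
        have h5 := siteDist_triangle (d := d) n X r w u x
        rw [siteDist_comm n X r w u] at h5
        linarith
    · rw [hA'v] at hwx ⊢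
      rw [m3]
      rcases hline w hw with ⟨h1, h2, h3⟩ | ⟨h1, h2, h3⟩
      · rw [h3]
        have h4 := h.dist w hw u hu h1
        have h5 := siteDist_triangle (d := d) n X r w u x
        linarith
      · omega
    · rcases hline w hw with ⟨h1, h2, h3⟩ | ⟨h1, h2, h3⟩ <;>
        rcases hline x hx with ⟨h1', h2', h3'⟩ | ⟨h1', h2', h3'⟩ <;>
        rw [h3, h3'] <;> rw [h2, h2'] at hwx
      · exact h.dist w hw x hx hwx
      · linarith [h.dist w hw x hx (by omega)]
      · omega
      · linarith [h.dist w hw x hx (by omega)]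
  · intro c hc
    have h1 := h.span c hc
    rw [hvis, coe_insert, Set.image_insert_eq]
    -- Distinct site numbers can denote the same point. If v coincides with a visited point, then δ
    -- = 0 and the set of points is unchanged, so there is nothing to exchange.
    by_cases hin : (site n X r v : Pt d) ∈ (fun v => (site n X r v : Pt d)) '' (visited n A)
    · rw [Set.insert_eq_of_mem hin]
      obtain ⟨a, ha, hav⟩ := hin
      have h2 := hmin a ha v hv hAv
      have h3 : siteDist d n X r a v = 0 := by
        unfold siteDist
        rw [show (site n X r a : Pt d) = site n X r v from hav, manhattanDist_self]
      have h4 : δ = 0 := le_antisymm (h3 ▸ h2) hδ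
      rwa [h4, add_zero]
    · rw [← sub_sub]
      refine h1.exchange ⟨v, .inr hv, rfl⟩ hin ?_
      rintro _ ⟨a, ha, rfl⟩ _ ⟨b, hb, rfl⟩ hbS
      have hbv : b ∉ visited n A := fun h => hbS ⟨b, h, rfl⟩
      rcases hb with rfl | hb
      · exact absurd (mem_visited.2 ⟨by omega, h.centre⟩) hbv
      · have hblt := hb.lt
        refine hmin a ha b hb ?_
        by_contra hb0
        exact hbv (mem_visited.2 ⟨by omega, hb0⟩)

/-- Two nested minimizations find a closest pair of a visited site and an unvisited terminal, as
Prim's rule requires; the second alternative measures progress. -/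
theorem tourInv_step {n : ℕ} {X : ℕ → ℝ} {r : ℕ} {A : ℕ → ℕ} {τ : ℕ → ℝ} {Θ : ℝ}
    (h : TourInv d n X r A τ Θ) :
    (∃ τ' Θ', TourInv d n X r (tourStep d n X r A) τ' Θ') ∧
      ((tourStep d n X r A = A ∧ ∀ v, IsTerminal d n X r v → A v ≠ 0) ∨
        (visited n (tourStep d n X r A)).card = (visited n A).card + 1 ∧
          ∃ v, IsTerminal d n X r v ∧ A v = 0) := by
  rcases RealRAM.argmin_spec (K := 2 * n + 2) (b := fun v => IsTerminal d n X r v ∧ A v = 0)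
    (f := fun v => siteDist d n X r (nearest d n X r A v) v) with ⟨h1, h2⟩ | ⟨h1, ⟨h2, h3⟩, h4⟩
  · have hstep : tourStep d n X r A = A := by
      unfold tourStep nextSite
      rw [if_neg (by rw [h1]; exact lt_irrefl _)]
    rw [hstep]
    refine ⟨⟨τ, Θ, h⟩, .inl ⟨rfl, fun v hv h0 => h2 v ?_ ⟨hv, h0⟩⟩⟩
    have := hv.lt
    omega
  · have hnear : ∀ v, nearest d n X r A v ∈ visited n A ∧ ∀ a ∈ visited n A,
        siteDist d n X r (nearest d n X r A v) v ≤ siteDist d n X r a v := by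
      intro v
      obtain ⟨g1, g2, g3⟩ := RealRAM.argmin_of_exists (K := 2 * n + 2) (b := fun u => A u ≠ 0)
        (f := fun u => siteDist d n X r u v) ⟨2 * n, by omega, h.centre⟩
      exact ⟨mem_visited.2 ⟨g1, g2⟩, fun a ha => g3 a (mem_visited.1 ha).1 (mem_visited.1 ha).2⟩
    have hins := h.insert_site (u := nearest d n X r A (nextSite d n X r A)) (v := nextSite d n X r A)
      (A' := tourStep d n X r A) (hnear _).1 h2 h3 (fun a ha b hb hb0 => ?_) (fun i hi => ?_)
    · exact ⟨⟨_, _, hins.2.choose_spec⟩, .inr ⟨hins.1, _, h2, h3⟩⟩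
    · have := hb.lt
      exact (h4 b (by omega) ⟨hb, hb0⟩).trans ((hnear b).2 a ha)
    · unfold tourStep
      rw [if_pos (show nextSite d n X r A < 2 * n + 2 from h1), if_pos hi]

theorem tour_spec (d n : ℕ) (X : ℕ → ℝ) (r : ℕ) (A : ℕ → ℕ) :
    ∃ τ Θ, TourInv d n X r (tour d n X r A) τ Θ ∧
      (∀ v, IsTerminal d n X r v → tour d n X r A v ≠ 0) ∧
      (visited n (tour d n X r A)).card ≤ 2 * n + 1 := by
  have hbound : ∀ {B τ Θ}, TourInv d n X r B τ Θ → (visited n B).card ≤ 2 * n + 1 := by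
    intro B τ Θ h
    rw [← card_range (2 * n + 1)]
    refine card_le_card fun w hw => mem_range.2 ?_
    rcases h.isTerminal w hw with rfl | h1
    · omega
    · have := h1.lt; omega
  have key : ∀ t, ∃ τ Θ, TourInv d n X r ((tourStep d n X r)^[t] (tourStart n A)) τ Θ ∧
      ((∀ v, IsTerminal d n X r v → (tourStep d n X r)^[t] (tourStart n A) v ≠ 0) ∨
        t ≤ (visited n ((tourStep d n X r)^[t] (tourStart n A))).card) := by
    intro t
    induction t with
    | zero => exact ⟨_, _, tourInv_start d n X r A, .inr (Nat.zero_le _)⟩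
    | succ t ih =>
      obtain ⟨τ, Θ, h1, h2⟩ := ih
      rw [Function.iterate_succ_apply']
      obtain ⟨⟨τ', Θ', h3⟩, h4⟩ := tourInv_step h1
      refine ⟨τ', Θ', h3, ?_⟩
      rcases h4 with ⟨h4, h5⟩ | ⟨h4, v, h5, h6⟩
      · rw [h4]
        exact .inl h5
      · rcases h2 with h2 | h2
        · exact absurd h6 (h2 v h5)
        · right; omega
  -- There are at most 2n+1 sites, so 2n+2 steps cannot all have inserted one.
  obtain ⟨τ, Θ, h1, h2⟩ := key (2 * n + 2)
  refine ⟨τ, Θ, h1, ?_, hbound h1⟩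
  rcases h2 with h2 | h2
  · exact h2
  · have := hbound h1
    omega

end GMMN

namespace GMMN

open Finset Relation

/-! ### The network of a group -/

variable {d : ℕ}

/-! ### Bounding boxes of blocks and their points nearest to the centre -/

theorem blockLow_spec {n : ℕ} (X : ℕ → ℝ) (r : ℕ) {A : ℕ → ℕ} {k q : ℕ}
    (h : ∃ i < 2 * n + 2, InBlock A k q i) (j : Fin d) :
    (∃ i < 2 * n + 2, InBlock A k q i ∧ blockLow n X r A k q j = site n X r i j) ∧
      ∀ i < 2 * n + 2, InBlock A k q i → blockLow n X r A k q j ≤ site n X r i j := by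
  obtain ⟨h1, h2, h3⟩ := RealRAM.argmin_of_exists (f := fun i => (site n X r i : Pt d) j) h
  exact ⟨⟨_, h1, h2, rfl⟩, h3⟩

theorem blockHigh_spec {n : ℕ} (X : ℕ → ℝ) (r : ℕ) {A : ℕ → ℕ} {k q : ℕ}
    (h : ∃ i < 2 * n + 2, InBlock A k q i) (j : Fin d) :
    (∃ i < 2 * n + 2, InBlock A k q i ∧ blockHigh n X r A k q j = site n X r i j) ∧
      ∀ i < 2 * n + 2, InBlock A k q i → site n X r i j ≤ blockHigh n X r A k q j := by
  obtain ⟨h1, h2, h3⟩ := RealRAM.argmin_of_exists (f := fun i => 0 - (site n X r i : Pt d) j) h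
  refine ⟨⟨_, h1, h2, rfl⟩, fun i hi hb => ?_⟩
  have := h3 i hi hb
  simp only [blockHigh]
  linarith

theorem InBlock.parent {A : ℕ → ℕ} {k q i : ℕ} (h : InBlock A k q i) :
    InBlock A (k + 1) (q / 2) i := by
  obtain ⟨h1, h2, h3⟩ := h
  have h4 : q / 2 * 2 ≤ q := Nat.div_mul_le_self q 2
  have h5 : q + 1 ≤ (q / 2 + 1) * 2 := by omega
  have h6 := Nat.mul_le_mul_right (2 ^ k) h4
  have h7 := Nat.mul_le_mul_right (2 ^ k) h5
  refine ⟨h1, ?_, ?_⟩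
  · rw [pow_succ, mul_comm (2 ^ k), ← mul_assoc]
    exact h6.trans h2
  · rw [pow_succ, mul_comm (2 ^ k), ← mul_assoc]
    exact h3.trans_le h7

theorem inBlock_iff {A : ℕ → ℕ} {k q i : ℕ} : InBlock A k q i ↔ A i ≠ 0 ∧ A i / 2 ^ k = q := by
  have h0 : 0 < 2 ^ k := by positivity
  unfold InBlock
  rw [← Nat.le_div_iff_mul_le h0, ← Nat.div_lt_iff_lt_mul h0]
  constructor
  · rintro ⟨h1, h2, h3⟩; exact ⟨h1, by omega⟩
  · rintro ⟨h1, h2⟩; exact ⟨h1, by omega, by omega⟩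

/-- The nearest point to o in a larger interval lies between o and the nearest point in a smaller
one. This monotonicity makes the paths through the blocks Manhattan paths. -/
theorem clamp_mem_uIcc {l l' h h' o : ℝ} (h1 : l' ≤ l) (h2 : l ≤ h) (h3 : h ≤ h') :
    max l' (min o h') ∈ Set.uIcc (max l (min o h)) o := by
  rw [Set.mem_uIcc]
  rcases le_total o l with h4 | h4
  · right
    rw [min_eq_left (h4.trans h2), min_eq_left (h4.trans (h2.trans h3)), max_eq_left h4]
    exact ⟨le_max_right _ _, max_le h1 h4⟩
  · left
    rw [max_eq_right (le_min h4 h2), max_eq_right (le_min (h1.trans h4) (h1.trans (h2.trans h3)))]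
    exact ⟨min_le_min_left _ h3, min_le_left _ _⟩

theorem clamp_mem_Icc {l h o : ℝ} (h1 : l ≤ h) : max l (min o h) ∈ Set.Icc l h :=
  ⟨le_max_left _ _, max_le h1 (min_le_right _ _)⟩

theorem blockLow_le_blockHigh {n : ℕ} (X : ℕ → ℝ) (r : ℕ) {A : ℕ → ℕ} {k q : ℕ}
    (h : ∃ i < 2 * n + 2, InBlock A k q i) (j : Fin d) :
    blockLow n X r A k q j ≤ blockHigh n X r A k q j := by
  obtain ⟨i, hi, hb⟩ := h
  exact ((blockLow_spec X r ⟨i, hi, hb⟩ j).2 i hi hb).trans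
    ((blockHigh_spec X r ⟨i, hi, hb⟩ j).2 i hi hb)

theorem exists_parent {n : ℕ} {A : ℕ → ℕ} {k q : ℕ} (h : ∃ i < 2 * n + 2, InBlock A k q i) :
    ∃ i < 2 * n + 2, InBlock A (k + 1) (q / 2) i := by
  obtain ⟨i, hi, hb⟩ := h
  exact ⟨i, hi, hb.parent⟩

theorem block_nested {n : ℕ} (X : ℕ → ℝ) (r : ℕ) {A : ℕ → ℕ} {k q : ℕ}
    (h : ∃ i < 2 * n + 2, InBlock A k q i) (j : Fin d) :
    blockLow n X r A (k + 1) (q / 2) j ≤ blockLow n X r A k q j ∧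
      blockHigh n X r A k q j ≤ blockHigh n X r A (k + 1) (q / 2) j := by
  constructor
  · obtain ⟨i, hi, hb, he⟩ := (blockLow_spec X r h j).1
    rw [he]
    exact (blockLow_spec X r (exists_parent h) j).2 i hi hb.parent
  · obtain ⟨i, hi, hb, he⟩ := (blockHigh_spec X r h j).1
    rw [he]
    exact (blockHigh_spec X r (exists_parent h) j).2 i hi hb.parent

theorem blockPt_parent_mem {n : ℕ} (X : ℕ → ℝ) (r : ℕ) {A : ℕ → ℕ} {k q : ℕ}
    (h : ∃ i < 2 * n + 2, InBlock A k q i) (j : Fin d) :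
    blockPt n X r A (k + 1) (q / 2) j ∈ Set.uIcc (blockPt n X r A k q j) (centre n X r j) :=
  clamp_mem_uIcc (block_nested X r h j).1 (blockLow_le_blockHigh X r h j) (block_nested X r h j).2

/-- A block that contains the centre is represented by the centre. -/
theorem blockPt_eq_centre {n : ℕ} (X : ℕ → ℝ) (r : ℕ) {A : ℕ → ℕ} {k q : ℕ}
    (h : InBlock A k q (2 * n)) : (blockPt n X r A k q : Pt d) = centre n X r := by
  funext j
  have h1 := (blockLow_spec (d := d) (n := n) X r ⟨2 * n, by omega, h⟩ j).2 (2 * n) (by omega) h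
  have h2 := (blockHigh_spec (d := d) (n := n) X r ⟨2 * n, by omega, h⟩ j).2 (2 * n) (by omega) h
  rw [site_centre] at h1 h2
  unfold blockPt
  rw [min_eq_left h2, max_eq_right h1]

theorem pathNet_subset_groupNet {n : ℕ} (X : ℕ → ℝ) (r : ℕ) {A : ℕ → ℕ} {k q : ℕ}
    (hk : k < 2 * n + 2) (hq : q < 2 * n + 2) (h : ∃ i < 2 * n + 2, InBlock A k q i) :
    pathNet (blockPt n X r A k q) (blockPt n X r A (k + 1) (q / 2)) ⊆ groupNet d n X r A := by
  intro s hs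
  unfold groupNet
  simp only [List.mem_flatMap, List.mem_range]
  exact ⟨k, hk, q, hq, by rwa [if_pos h]⟩

/-- Follow the blocks that contain v. At level 0 the block is v alone, because positions are
distinct; at level 2n+2 it contains all sites, so its representative is the centre. Each step moves
every coordinate towards the centre, so the lengths add up. -/
theorem mconnected_centre {n : ℕ} {X : ℕ → ℝ} {r : ℕ} {A : ℕ → ℕ} {τ : ℕ → ℝ} {Θ : ℝ}
    (hA : TourInv d n X r A τ Θ) (hcard : (visited n A).card ≤ 2 * n + 1) {v : ℕ}
    (hv : v ∈ visited n A) : MConnected (groupNet d n X r A) (site n X r v) (centre n X r) := by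
  have hle : ∀ w ∈ visited n A, A w ≤ 2 * n + 1 := fun w hw => (hA.le_card w hw).trans hcard
  have hblk : ∀ k, ∃ i < 2 * n + 2, InBlock A k (A v / 2 ^ k) i := fun k =>
    ⟨v, (mem_visited.1 hv).1, inBlock_iff.2 ⟨(mem_visited.1 hv).2, rfl⟩⟩
  have h0 : (blockPt n X r A 0 (A v / 2 ^ 0) : Pt d) = site n X r v := by
    have hone : ∀ i < 2 * n + 2, InBlock A 0 (A v / 2 ^ 0) i → i = v := by
      intro i hi hb
      rw [inBlock_iff] at hb
      refine hA.inj i (mem_visited.2 ⟨hi, hb.1⟩) v hv ?_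
      simpa using hb.2
    funext j
    obtain ⟨i, hi, hb, he⟩ := (blockLow_spec (d := d) X r (hblk 0) j).1
    obtain ⟨i', hi', hb', he'⟩ := (blockHigh_spec (d := d) X r (hblk 0) j).1
    unfold blockPt
    rw [he, he', hone i hi hb, hone i' hi' hb', max_eq_left (min_le_right _ _)]
  have hpow : 2 * n + 1 < 2 ^ (2 * n + 2) :=
    (Nat.lt_succ_self _).trans (Nat.lt_pow_self (by norm_num))
  have hK : (blockPt n X r A (2 * n + 2) (A v / 2 ^ (2 * n + 2)) : Pt d) = centre n X r := by
    refine blockPt_eq_centre X r (inBlock_iff.2 ⟨hA.centre, ?_⟩)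
    rw [Nat.div_eq_of_lt ((hle v hv).trans_lt hpow), Nat.div_eq_of_lt]
    exact (hle (2 * n) (mem_visited.2 ⟨by omega, hA.centre⟩)).trans_lt hpow
  have key : ∀ t ≤ 2 * n + 2, MConnected (groupNet d n X r A)
      (blockPt n X r A (2 * n + 2 - t) (A v / 2 ^ (2 * n + 2 - t))) (centre n X r) := by
    intro t
    induction t with
    | zero =>
      intro _
      rw [Nat.sub_zero, hK]
      exact .refl _ _
    | succ t ih =>
      intro ht
      have h1 := ih (by omega)
      obtain ⟨k, hk⟩ : ∃ k, 2 * n + 2 - (t + 1) = k := ⟨_, rfl⟩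
      have hk' : 2 * n + 2 - t = k + 1 := by omega
      rw [hk'] at h1
      rw [hk]
      have hq : A v / 2 ^ (k + 1) = A v / 2 ^ k / 2 := by
        rw [Nat.div_div_eq_div_mul, pow_succ]
      rw [hq] at h1
      have hqlt : A v / 2 ^ k < 2 * n + 2 :=
        (Nat.div_le_self _ _).trans_lt (Nat.lt_succ_of_le (hle v hv))
      refine MConnected.trans ((mconnected_pathNet _ _).mono
        (pathNet_subset_groupNet X r (by omega) hqlt (hblk k))) h1 (manhattanDist_add fun j => ?_)
      exact blockPt_parent_mem X r (hblk k) j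
  have := key (2 * n + 2) le_rfl
  rwa [Nat.sub_self, h0] at this

/-- Both representatives lie in the bounding box of the parent block. Each width of that box is
realized by two sites, whose distance is at most the part of the line covered by the parent; the d
coordinates give the factor d. -/
theorem manhattanDist_blockPt_le {n : ℕ} {X : ℕ → ℝ} {r : ℕ} {A : ℕ → ℕ} {τ : ℕ → ℝ} {Θ : ℝ}
    (hA : TourInv d n X r A τ Θ) {k q : ℕ} (h : ∃ i < 2 * n + 2, InBlock A k q i) :
    manhattanDist (blockPt n X r A k q : Pt d) (blockPt n X r A (k + 1) (q / 2)) ≤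
      d * (τ ((q / 2 + 1) * 2 ^ (k + 1)) - τ (q / 2 * 2 ^ (k + 1))) := by
  have hj : ∀ j : Fin d, |blockPt n X r A k q j - blockPt n X r A (k + 1) (q / 2) j| ≤
      τ ((q / 2 + 1) * 2 ^ (k + 1)) - τ (q / 2 * 2 ^ (k + 1)) := by
    intro j
    have hp := exists_parent h
    obtain ⟨n1, n2⟩ := block_nested (d := d) X r h j
    have c1 := clamp_mem_Icc (o := centre n X r j) (blockLow_le_blockHigh (d := d) X r h j)
    have c2 := clamp_mem_Icc (o := centre n X r j) (blockLow_le_blockHigh (d := d) X r hp j)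
    have h1 : |blockPt n X r A k q j - blockPt n X r A (k + 1) (q / 2) j| ≤
        blockHigh n X r A (k + 1) (q / 2) j - blockLow n X r A (k + 1) (q / 2) j := by
      unfold blockPt
      rw [abs_le]
      constructor <;> linarith [c1.1, c1.2, c2.1, c2.2]
    refine h1.trans ?_
    obtain ⟨i, hi, hb, he⟩ := (blockLow_spec (d := d) X r hp j).1
    obtain ⟨i', hi', hb', he'⟩ := (blockHigh_spec (d := d) X r hp j).1
    rw [he, he']
    have hm : ∀ a b, a < 2 * n + 2 → b < 2 * n + 2 → InBlock A (k + 1) (q / 2) a →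
        InBlock A (k + 1) (q / 2) b → A a ≤ A b → siteDist d n X r a b ≤
        τ ((q / 2 + 1) * 2 ^ (k + 1)) - τ (q / 2 * 2 ^ (k + 1)) := by
      intro a b ha hb ia ib hab
      have h2 := hA.dist a (mem_visited.2 ⟨ha, ia.1⟩) b (mem_visited.2 ⟨hb, ib.1⟩) hab
      have h3 := hA.mono ib.2.2.le
      have h4 := hA.mono ia.2.1
      linarith
    have h5 : site n X r i' j - site n X r i j ≤ siteDist d n X r i' i :=
      (le_abs_self _).trans (abs_sub_le_manhattanDist _ _ j)
    refine h5.trans ?_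
    rcases le_total (A i') (A i) with h6 | h6
    · exact hm i' i hi' hi hb' hb h6
    · rw [siteDist_comm]
      exact hm i i' hi hi' hb hb' h6
  calc _ ≤ ∑ _j : Fin d, (τ ((q / 2 + 1) * 2 ^ (k + 1)) - τ (q / 2 * 2 ^ (k + 1))) :=
        sum_le_sum fun j _ => hj j
    _ = _ := by rw [sum_const, card_univ, Fintype.card_fin, nsmul_eq_mul]

theorem sum_range_two_mul_div (g : ℕ → ℝ) (m : ℕ) :
    ∑ q ∈ range (2 * m), g (q / 2) = 2 * ∑ q ∈ range m, g q := by
  induction m with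
  | zero => simp
  | succ m ih =>
    rw [Nat.mul_succ, sum_range_succ, sum_range_succ, ih, sum_range_succ]
    have h1 : 2 * m / 2 = m := by omega
    have h2 : (2 * m + 1) / 2 = m := by omega
    rw [h1, h2]; ring

/-- The blocks of one level have parents that partition the line, so the bounds telescope to at most
2Θ, with a factor 2 for the two children of each parent and d for the coordinates. Summation over
the L lowest levels finishes. -/
theorem totalLength_groupNet_le {n : ℕ} {X : ℕ → ℝ} {r : ℕ} {A : ℕ → ℕ} {τ : ℕ → ℝ} {Θ : ℝ}
    (hA : TourInv d n X r A τ Θ) (hcard : (visited n A).card ≤ 2 * n + 1) :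
    (groupNet d n X r A).totalLength ≤ (Nat.log 2 (2 * n + 1) + 1) * (4 * d * Θ) := by
  classical
  have hle : ∀ w ∈ visited n A, A w ≤ 2 * n + 1 := fun w hw => (hA.le_card w hw).trans hcard
  have hΘ : 0 ≤ Θ := by
    have := hA.le 0
    have := hA.nonneg
    linarith
  let L : ℕ := Nat.log 2 (2 * n + 1) + 1
  have hlevel : ∀ k, ∑ q ∈ range (2 * n + 2), (if ∃ i < 2 * n + 2, InBlock A k q i then
      manhattanDist (blockPt n X r A k q : Pt d) (blockPt n X r A (k + 1) (q / 2)) else 0) ≤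
      if k < L then 4 * d * Θ else 0 := by
    intro k
    split_ifs with hk
    · calc _ ≤ ∑ q ∈ range (2 * (n + 1)),
            (d * (τ ((q / 2 + 1) * 2 ^ (k + 1)) - τ (q / 2 * 2 ^ (k + 1))) : ℝ) := by
            refine sum_le_sum fun q _ => ?_
            split_ifs with h
            · exact manhattanDist_blockPt_le hA h
            · refine mul_nonneg (Nat.cast_nonneg _) (sub_nonneg.2 (hA.mono ?_))
              exact Nat.mul_le_mul_right _ (Nat.le_succ _)
        _ = 2 * (d * (τ ((n + 1) * 2 ^ (k + 1)) - τ (0 * 2 ^ (k + 1)))) := by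
            rw [sum_range_two_mul_div
              (fun q => (d * (τ ((q + 1) * 2 ^ (k + 1)) - τ (q * 2 ^ (k + 1))) : ℝ)), ← mul_sum,
              sum_range_sub (fun q => τ (q * 2 ^ (k + 1)))]
        _ ≤ 2 * (d * (2 * Θ)) := by
            have h1 := hA.le ((n + 1) * 2 ^ (k + 1))
            have h2 := hA.nonneg
            rw [zero_mul]
            have : τ ((n + 1) * 2 ^ (k + 1)) - τ 0 ≤ 2 * Θ := by linarith
            gcongr
        _ = 4 * d * Θ := by ring
    -- Once 2^k exceeds all positions, block 0 is the only nonempty one. It contains the centre, so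
    -- its path is degenerate.
    · refine (sum_eq_zero fun q _ => ?_).le
      have hpow : 2 * n + 1 < 2 ^ k :=
        (Nat.lt_pow_succ_log_self (by norm_num) _).trans_le
          (Nat.pow_le_pow_right (by norm_num) (not_lt.1 hk))
      split_ifs with h
      · obtain ⟨i, hi, hb⟩ := h
        have hb' := inBlock_iff.1 hb
        have hc := hle (2 * n) (mem_visited.2 ⟨by omega, hA.centre⟩)
        have hq : q = 0 := by
          rw [← hb'.2]
          exact Nat.div_eq_of_lt ((hle i (mem_visited.2 ⟨hi, hb'.1⟩)).trans_lt hpow)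
        have hin : InBlock A k q (2 * n) :=
          inBlock_iff.2 ⟨hA.centre, by rw [hq]; exact Nat.div_eq_of_lt (hc.trans_lt hpow)⟩
        rw [blockPt_eq_centre X r hin, blockPt_eq_centre X r hin.parent, manhattanDist_self]
      · rfl
  unfold groupNet
  simp only [totalLength_flatMap_range]
  calc _ ≤ ∑ k ∈ range (2 * n + 2), (if k < L then 4 * d * Θ else 0) := by
        refine sum_le_sum fun k _ => le_trans (le_of_eq ?_) (hlevel k)
        refine sum_congr rfl fun q _ => ?_
        split_ifs
        · exact totalLength_pathNet _ _
        · simp [Network.totalLength]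
    _ ≤ ∑ k ∈ range L, 4 * d * Θ := by
        rw [← sum_filter]
        refine sum_le_sum_of_subset_of_nonneg (fun k hk => ?_) fun _ _ _ => by positivity
        exact mem_range.2 (mem_filter.1 hk).2
    _ = _ := by simp [L]

/-- The network computed by the algorithm is feasible. -/
theorem feasible_algNet (R : Instance d) (A : ℕ → ℕ → ℕ) :
    Feasible R (algNet d R.length (input R).real A) := by
  classical
  intro pq hpq
  obtain ⟨i, hi, rfl⟩ := List.mem_iff_getElem.1 hpq
  obtain ⟨t1, t2⟩ := terminal_input R hi
  set n := R.length
  set X := (input R).real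
  obtain ⟨r, hr, hri⟩ := exists_isFirst (d := d) X hi
  obtain ⟨τ, Θ, hA, hall, hcard⟩ := tour_spec d n X r (A r)
  have hsub : groupNet d n X r (tour d n X r (A r)) ⊆ algNet d n X A := by
    intro s hs
    unfold algNet
    rw [List.mem_flatMap]
    refine ⟨r, List.mem_range.2 (by have := hr.1; omega), ?_⟩
    rwa [if_pos hr]
  have hmem : ∀ v, v = 2 * i ∨ v = 2 * i + 1 → v ∈ visited n (tour d n X r (A r)) ∧
      (site n X r v : Pt d) = terminal X v := by
    intro v hv
    refine ⟨mem_visited.2 ⟨by omega, hall v ⟨i, by omega, ⟨hi, hri⟩, hv⟩⟩, ?_⟩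
    funext j
    unfold site
    rw [if_pos (by omega)]
  obtain ⟨m1, e1⟩ := hmem (2 * i) (.inl rfl)
  obtain ⟨m2, e2⟩ := hmem (2 * i + 1) (.inr rfl)
  have c1 := mconnected_centre hA hcard m1
  have c2 := mconnected_centre hA hcard m2
  rw [e1, t1] at c1
  rw [e2, t2] at c2
  refine (c1.trans c2.symm (manhattanDist_add fun j => ?_)).mono hsub
  rw [← t1, ← t2]
  exact centre_mem hr.1 hi hri j

end GMMN

namespace GMMN

open Finset Relation

/-! ### Decomposition of a network into the edges of a grid -/

variable {d : ℕ}

/-- Membership in an axis-parallel segment is an interval condition in one coordinate, which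
replaces convex combinations from here on. -/
theorem mem_segment_iff {x y : Pt d} {j : Fin d} (h : ∀ i, i ≠ j → x i = y i) (z : Pt d) :
    z ∈ segment ℝ x y ↔ (∀ i, i ≠ j → z i = x i) ∧ z j ∈ Set.uIcc (x j) (y j) := by
  have hx : Function.update x j (x j) = x := Function.update_eq_self j x
  have hy : Function.update x j (y j) = y := by
    funext i
    by_cases hi : i = j
    · subst hi; simp
    · simp [hi, h i hi]
  have key := Pi.image_update_segment (𝕜 := ℝ) j (x j) (y j) x
  rw [hx, hy] at key
  rw [← key, segment_eq_uIcc]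
  constructor
  · rintro ⟨c, hc, rfl⟩
    exact ⟨fun i hi => by simp [hi], by simpa using hc⟩
  · rintro ⟨h1, h2⟩
    refine ⟨z j, h2, ?_⟩
    funext i
    by_cases hi : i = j
    · subst hi; simp
    · simp [hi, h1 i hi]

/-- An edge of the grid with coordinates in `C`. -/
structure IsGridEdge (C : Finset ℝ) (j : Fin d) (x y : Pt d) : Prop where
  fst_mem : ∀ i, x i ∈ C
  snd_mem : ∀ i, y i ∈ C
  eq : ∀ i, i ≠ j → x i = y i
  lt : x j < y j
  gap : ∀ c ∈ C, x j < c → y j ≤ c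

theorem IsGridEdge.dist_eq {C : Finset ℝ} {j : Fin d} {x y : Pt d} (h : IsGridEdge C j x y) :
    manhattanDist x y = y j - x j := by
  unfold manhattanDist
  rw [sum_eq_single j]
  · rw [abs_sub_comm, abs_of_pos (sub_pos.2 h.lt)]
  · intro i _ hi
    rw [h.eq i hi, sub_self, abs_zero]
  · simp

/-- The total length of disjoint intervals. -/
theorem sum_sub_le_of_disjoint {ι : Type*} (E : Finset ι) (f g : ι → ℝ) {a b : ℝ} (hab : a ≤ b)
    (hf : ∀ e ∈ E, a ≤ f e) (hfg : ∀ e ∈ E, f e ≤ g e) (hg : ∀ e ∈ E, g e ≤ b)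
    (hd : ∀ e ∈ E, ∀ e' ∈ E, e ≠ e' → Disjoint (Set.Ioo (f e) (g e)) (Set.Ioo (f e') (g e'))) :
    ∑ e ∈ E, (g e - f e) ≤ b - a := by
  -- Lebesgue measure: the disjoint open intervals all lie in [a, b].
  have h1 : MeasureTheory.volume (⋃ e ∈ E, Set.Ioo (f e) (g e)) =
      ∑ e ∈ E, MeasureTheory.volume (Set.Ioo (f e) (g e)) :=
    MeasureTheory.measure_biUnion_finset (fun e he e' he' hne => hd e he e' he' hne)
      fun _ _ => measurableSet_Ioo
  have h2 : (⋃ e ∈ E, Set.Ioo (f e) (g e)) ⊆ Set.Icc a b := by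
    intro x hx
    simp only [Set.mem_iUnion] at hx
    obtain ⟨e, he, hx⟩ := hx
    exact ⟨(hf e he).trans hx.1.le, hx.2.le.trans (hg e he)⟩
  have h3 := MeasureTheory.measure_mono (μ := MeasureTheory.volume) h2
  rw [h1, Real.volume_Icc] at h3
  simp only [Real.volume_Ioo] at h3
  rw [← ENNReal.ofReal_sum_of_nonneg fun e he => sub_nonneg.2 (hfg e he)] at h3
  exact (ENNReal.ofReal_le_ofReal_iff (sub_nonneg.2 hab)).1 h3

/-- The grid edges covered by a segment are not longer than the segment. -/
theorem edgeLength_le_of_segment {C : Finset ℝ} (s : Seg d) (E : Finset (Pt d × Pt d))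
    (hE : ∀ e ∈ E, (∃ j, IsGridEdge C j e.1 e.2) ∧
      segment ℝ e.1 e.2 ⊆ segment ℝ s.src s.tgt) :
    edgeLength E ≤ manhattanDist s.src s.tgt := by
  obtain ⟨j, hj⟩ := s.axis
  have hend : ∀ e ∈ E, e.1 ∈ segment ℝ s.src s.tgt ∧ e.2 ∈ segment ℝ s.src s.tgt := fun e he =>
    ⟨(hE e he).2 (left_mem_segment _ _ _), (hE e he).2 (right_mem_segment _ _ _)⟩
  simp only [mem_segment_iff hj] at hend
  -- An edge in another direction would have both ends equal in that coordinate, contrary to its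
  -- strict orientation.
  have hgrid : ∀ e ∈ E, IsGridEdge C j e.1 e.2 := by
    intro e he
    obtain ⟨⟨j', h⟩, _⟩ := hE e he
    by_cases hjj : j' = j
    · rwa [hjj] at h
    · have h1 := (hend e he).1.1 j' hjj
      have h2 := (hend e he).2.1 j' hjj
      exact absurd h.lt (by rw [h1, h2]; exact lt_irrefl _)
  calc edgeLength E = ∑ e ∈ E, (e.2 j - e.1 j) := sum_congr rfl fun e he => (hgrid e he).dist_eq
    _ ≤ max (s.src j) (s.tgt j) - min (s.src j) (s.tgt j) := by
        refine sum_sub_le_of_disjoint E (fun e => e.1 j) (fun e => e.2 j) min_le_max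
          (fun e he => (hend e he).1.2.1) (fun e he => (hgrid e he).lt.le)
          (fun e he => (hend e he).2.2.2) fun e he e' he' hne => ?_
        rw [Set.disjoint_left]
        rintro x ⟨h1, h2⟩ ⟨h3, h4⟩
        refine hne ?_
        have g := hgrid e he
        have g' := hgrid e' he'
        have e1 : e.1 j = e'.1 j := by
          refine le_antisymm ?_ ?_ <;> by_contra hc <;> rw [not_le] at hc
          · linarith [g'.gap _ (g.fst_mem j) hc]
          · linarith [g.gap _ (g'.fst_mem j) hc]
        have e2 : e.2 j = e'.2 j := le_antisymm
          (g.gap _ (g'.snd_mem j) (by rw [e1]; exact g'.lt))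
          (g'.gap _ (g.snd_mem j) (by rw [← e1]; exact g.lt))
        refine Prod.ext (funext fun i => ?_) (funext fun i => ?_)
        · by_cases hi : i = j
          · rw [hi, e1]
          · rw [(hend e he).1.1 i hi, (hend e' he').1.1 i hi]
        · by_cases hi : i = j
          · rw [hi, e2]
          · rw [(hend e he).2.1 i hi, (hend e' he').2.1 i hi]
    _ = |s.src j - s.tgt j| := max_sub_min_eq_abs' _ _
    _ ≤ manhattanDist s.src s.tgt := abs_sub_le_manhattanDist _ _ j

/-- Each edge is charged to the first segment in the list that covers it, and a segment pays for its
edges by `edgeLength_le_of_segment`. -/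
theorem edgeLength_le_totalLength {C : Finset ℝ} (N : Network d) (E : Finset (Pt d × Pt d))
    (hE : ∀ e ∈ E, (∃ j, IsGridEdge C j e.1 e.2) ∧
      ∃ s ∈ N, segment ℝ e.1 e.2 ⊆ segment ℝ s.src s.tgt) :
    edgeLength E ≤ N.totalLength := by
  classical
  induction N generalizing E with
  | nil =>
    obtain rfl : E = ∅ := eq_empty_of_forall_notMem fun e he => by simpa using (hE e he).2
    simp [edgeLength, Network.totalLength]
  | cons s N ih =>
    have h1 := edgeLength_le_of_segment (C := C) s
      (E.filter fun e => segment ℝ e.1 e.2 ⊆ segment ℝ s.src s.tgt) fun e he =>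
        ⟨(hE e (mem_filter.1 he).1).1, (mem_filter.1 he).2⟩
    have h2 := ih (E.filter fun e => ¬ segment ℝ e.1 e.2 ⊆ segment ℝ s.src s.tgt) fun e he => by
      obtain ⟨he1, he2⟩ := mem_filter.1 he
      obtain ⟨h3, s', hs', h4⟩ := hE e he1
      rcases List.mem_cons.1 hs' with rfl | hs'
      · exact absurd h4 he2
      · exact ⟨h3, s', hs', h4⟩
    have h3 : Network.totalLength (s :: N) = manhattanDist s.src s.tgt + Network.totalLength N := by
      simp [Network.totalLength]
    unfold edgeLength at *
    rw [h3, ← sum_filter_add_sum_filter_not E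
      (fun e => segment ℝ e.1 e.2 ⊆ segment ℝ s.src s.tgt)]
    linarith

open Classical in
/-- The grid edges covered by a network. -/
noncomputable def gridEdges (C : Finset ℝ) (N : Network d) : Finset (Pt d × Pt d) :=
  ((Fintype.piFinset fun _ => C) ×ˢ (Fintype.piFinset fun _ => C)).filter fun e =>
    (∃ j, IsGridEdge C j e.1 e.2) ∧ ∃ s ∈ N, segment ℝ e.1 e.2 ⊆ segment ℝ s.src s.tgt

theorem mem_gridEdges {C : Finset ℝ} {N : Network d} {e : Pt d × Pt d} :
    e ∈ gridEdges C N ↔ (∃ j, IsGridEdge C j e.1 e.2) ∧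
      ∃ s ∈ N, segment ℝ e.1 e.2 ⊆ segment ℝ s.src s.tgt := by
  classical
  unfold gridEdges
  rw [mem_filter, mem_product, Fintype.mem_piFinset, Fintype.mem_piFinset]
  refine ⟨fun h => h.2, fun h => ⟨?_, h⟩⟩
  obtain ⟨j, hj⟩ := h.1
  exact ⟨hj.fst_mem, hj.snd_mem⟩

/-- A grid edge that is covered by a network is covered by one of its segments. -/
theorem IsGridEdge.exists_seg {C : Finset ℝ} {N : Network d}
    (hN : ∀ s ∈ N, ∀ i, s.src i ∈ C ∧ s.tgt i ∈ C) {j : Fin d} {x y : Pt d}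
    (h : IsGridEdge C j x y) (hs : segment ℝ x y ⊆ N.support) :
    ∃ s ∈ N, segment ℝ x y ⊆ segment ℝ s.src s.tgt := by
  -- The midpoint has a j-th coordinate strictly inside a gap of C. A segment through it must
  -- therefore run in direction j, and its ends, having coordinates in C, lie outside the gap.
  have hmid : Function.update x j ((x j + y j) / 2) ∈ segment ℝ x y := by
    rw [mem_segment_iff h.eq]
    have := h.lt
    refine ⟨fun i hi => by simp [hi], ?_⟩
    rw [Function.update_self, Set.uIcc_of_le h.lt.le]
    constructor <;> linarith
  obtain ⟨s, hsN, hm⟩ := hs hmid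
  obtain ⟨j', hj'⟩ := s.axis
  have hlt := h.lt
  have hjj : j' = j := by
    by_contra hne
    have h1 := ((mem_segment_iff hj' _).1 hm).1 j (fun h => hne h.symm)
    rw [Function.update_self] at h1
    have h2 := h.gap _ (hN s hsN j).1 (by rw [← h1]; linarith)
    linarith
  subst hjj
  obtain ⟨h1, h2, h3⟩ := (mem_segment_iff hj' _).1 hm
  rw [Function.update_self] at h2 h3
  have h4 : min (s.src j') (s.tgt j') ≤ x j' := by
    by_contra hc
    rw [not_le] at hc
    have := h.gap (min (s.src j') (s.tgt j')) (by
      rcases min_choice (s.src j') (s.tgt j') with h | h <;> rw [h]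
      exacts [(hN s hsN _).1, (hN s hsN _).2]) hc
    change min (s.src j') (s.tgt j') ≤ _ at h2
    linarith
  have h5 : y j' ≤ max (s.src j') (s.tgt j') := by
    refine h.gap _ ?_ ?_
    · rcases max_choice (s.src j') (s.tgt j') with h | h <;> rw [h]
      exacts [(hN s hsN _).1, (hN s hsN _).2]
    · change _ ≤ max (s.src j') (s.tgt j') at h3
      linarith
  refine ⟨s, hsN, fun z hz => ?_⟩
  rw [mem_segment_iff h.eq, Set.uIcc_of_le h.lt.le] at hz
  rw [mem_segment_iff hj']
  refine ⟨fun i hi => ?_, h4.trans hz.2.1, hz.2.2.trans h5⟩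
  rw [hz.1 i hi, ← h1 i hi, Function.update_of_ne hi]

open Classical in
/-- A covered segment between grid points is a path of grid edges. -/
theorem reach_of_segment {C : Finset ℝ} {N : Network d}
    (hN : ∀ s ∈ N, ∀ i, s.src i ∈ C ∧ s.tgt i ∈ C) (B : Pt d → Prop) (j : Fin d) {y : Pt d}
    (hy : ∀ i, y i ∈ C) {x : Pt d} (hx : ∀ i, x i ∈ C) (hxy : ∀ i, i ≠ j → x i = y i)
    (hle : x j ≤ y j) (hs : segment ℝ x y ⊆ N.support) (hB : ∀ z ∈ segment ℝ x y, B z) :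
    ReflTransGen (EdgeAdj ((gridEdges C N).filter fun e => B e.1)) x y := by
  -- Advance to the next grid value above x j; fewer grid values then remain ahead.
  induction hk : (C.filter fun c => x j < c).card using Nat.strong_induction_on generalizing x with
  | _ k ih =>
    rcases hle.eq_or_lt with heq | hlt
    · have : x = y := by
        funext i
        by_cases hi : i = j
        · rw [hi, heq]
        · exact hxy i hi
      rw [this]
    · have hne : (C.filter fun c => x j < c).Nonempty := ⟨y j, mem_filter.2 ⟨hy j, hlt⟩⟩
      obtain ⟨c, hc, hcmin⟩ := exists_min_image _ id hne
      obtain ⟨hcC, hxc⟩ := mem_filter.1 hc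
      have hcy : c ≤ y j := hcmin _ (mem_filter.2 ⟨hy j, hlt⟩)
      set z := Function.update x j c
      have hzj : z j = c := Function.update_self _ _ _
      have hzi : ∀ i, i ≠ j → z i = x i := fun i hi => Function.update_of_ne hi _ _
      have hzC : ∀ i, z i ∈ C := by
        intro i
        by_cases hi : i = j
        · rw [hi, hzj]; exact hcC
        · rw [hzi i hi]; exact hx i
      have hedge : IsGridEdge C j x z :=
        ⟨hx, hzC, fun i hi => (hzi i hi).symm, by rw [hzj]; exact hxc, fun c' hc' hlt' => by
          rw [hzj]; exact hcmin c' (mem_filter.2 ⟨hc', hlt'⟩)⟩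
      have hzy : ∀ i, i ≠ j → z i = y i := fun i hi => (hzi i hi).trans (hxy i hi)
      have hsub1 : segment ℝ x z ⊆ segment ℝ x y := by
        intro w hw
        rw [mem_segment_iff hedge.eq, Set.uIcc_of_le hedge.lt.le, hzj] at hw
        rw [mem_segment_iff hxy, Set.uIcc_of_le hle]
        exact ⟨hw.1, hw.2.1, hw.2.2.trans hcy⟩
      have hsub2 : segment ℝ z y ⊆ segment ℝ x y := by
        intro w hw
        rw [mem_segment_iff hzy, hzj, Set.uIcc_of_le hcy] at hw
        rw [mem_segment_iff hxy, Set.uIcc_of_le hle]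
        exact ⟨fun i hi => (hw.1 i hi).trans (hzi i hi), hxc.le.trans hw.2.1, hw.2.2⟩
      refine .head (b := z) (.inl ?_) (ih _ ?_ hzC hzy (by rw [hzj]; exact hcy)
        (hsub2.trans hs) (fun w hw => hB w (hsub2 hw)) rfl)
      · rw [mem_filter, mem_gridEdges]
        exact ⟨⟨⟨j, hedge⟩, hedge.exists_seg hN (hsub1.trans hs)⟩,
          hB x (left_mem_segment _ _ _)⟩
      · rw [← hk, hzj]
        refine card_lt_card ⟨fun c' hc' => ?_, fun hsub => ?_⟩
        · rw [mem_filter] at hc' ⊢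
          exact ⟨hc'.1, hxc.trans hc'.2⟩
        · exact lt_irrefl _ (mem_filter.1 (hsub hc)).2

open Classical in
/-- A covered Manhattan path between grid points is a path of grid edges. -/
theorem reach_of_path {C : Finset ℝ} {N : Network d}
    (hN : ∀ s ∈ N, ∀ i, s.src i ∈ C ∧ s.tgt i ∈ C) (B : Pt d → Prop) {k : ℕ} {v : ℕ → Pt d}
    (hv : ∀ i ≤ k, ∀ j, v i j ∈ C)
    (hs : ∀ i < k, AxisParallel (v i) (v (i + 1)) ∧ segment ℝ (v i) (v (i + 1)) ⊆ N.support)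
    (hl : ∑ i ∈ range k, manhattanDist (v i) (v (i + 1)) = manhattanDist (v 0) (v k))
    (hB : ∀ z : Pt d, (∀ j, z j ∈ Set.uIcc (v 0 j) (v k j)) → B z) :
    ReflTransGen (EdgeAdj ((gridEdges C N).filter fun e => B e.1)) (v 0) (v k) := by
  have key : ∀ m ≤ k,
      ReflTransGen (EdgeAdj ((gridEdges C N).filter fun e => B e.1)) (v 0) (v m) := by
    intro m
    induction m with
    | zero => exact fun _ => .refl
    | succ m ih =>
      intro hm
      refine (ih (by omega)).trans ?_
      obtain ⟨⟨j, hj⟩, h2⟩ := hs m hm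
      have hbox : ∀ z ∈ segment ℝ (v m) (v (m + 1)), B z := by
        intro z hz
        refine hB z fun i => ?_
        have h3 := vertex_mem_uIcc hl (by omega : m ≤ k) i
        have h4 := vertex_mem_uIcc hl hm i
        rw [mem_segment_iff hj] at hz
        by_cases hi : i = j
        · rw [hi] at h3 h4 ⊢
          exact Set.uIcc_subset_uIcc h3 h4 hz.2
        · rw [hz.1 i hi]; exact h3
      rcases le_total (v m j) (v (m + 1) j) with hle | hle
      · exact reach_of_segment hN B j (hv _ hm) (hv _ (by omega)) hj hle h2 hbox
      · refine edgeAdj_reach_symm (reach_of_segment hN B j (hv _ (by omega)) (hv _ hm)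
          (fun i hi => (hj i hi).symm) hle ?_ ?_)
        · rwa [segment_symm]
        · rwa [segment_symm]
  exact key k le_rfl

/-! ### Projections to the centre -/

open Classical in
/-- The edges projected to all coordinate subspaces through `o`. -/
noncomputable def projEdges (o : Pt d) (E : Finset (Pt d × Pt d)) : Finset (Pt d × Pt d) :=
  ((univ : Finset (Finset (Fin d))) ×ˢ E).image fun q =>
    (q.1.piecewise o q.2.1, q.1.piecewise o q.2.2)

theorem manhattanDist_piecewise_le [DecidableEq (Fin d)] (S : Finset (Fin d)) (o x y : Pt d) :
    manhattanDist (S.piecewise o x) (S.piecewise o y) ≤ manhattanDist x y := by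
  refine sum_le_sum fun i _ => ?_
  by_cases hi : i ∈ S
  · simp [hi]
  · simp [hi]

theorem edgeLength_projEdges_le (o : Pt d) (E : Finset (Pt d × Pt d)) :
    edgeLength (projEdges o E) ≤ 2 ^ d * edgeLength E := by
  classical
  unfold edgeLength projEdges
  refine (sum_image_le_of_nonneg fun _ _ => manhattanDist_nonneg _ _).trans ?_
  rw [sum_product]
  calc _ ≤ ∑ _S : Finset (Fin d), ∑ e ∈ E, manhattanDist e.1 e.2 :=
        sum_le_sum fun S _ => sum_le_sum fun e _ => manhattanDist_piecewise_le S o e.1 e.2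
    _ = _ := by simp

/-- Connection of the end points of a path of grid edges with a point of its bounding box. -/
theorem reach_projEdges {C : Finset ℝ} {E : Finset (Pt d × Pt d)}
    (hE : ∀ e ∈ E, ∃ j, IsGridEdge C j e.1 e.2) {o p q : Pt d} (ho : ∀ i, o i ∈ C)
    (hmem : ∀ i, o i ∈ Set.uIcc (p i) (q i)) (h : ReflTransGen (EdgeAdj E) p q) :
    ReflTransGen (EdgeAdj (projEdges o E)) o p ∧ ReflTransGen (EdgeAdj (projEdges o E)) o q := by
  classical
  -- Clamping at o on the side of q: p is fixed and q goes to o, because o lies in their bounding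
  -- box.
  let φ : Pt d → Pt d := fun x i => if p i ≤ q i then min (x i) (o i) else max (x i) (o i)
  have hφ : ∀ e ∈ E, (φ e.1, φ e.2) ∈ projEdges o E := by
    intro e he
    obtain ⟨j, hj⟩ := hE e he
    let S : Finset (Fin d) :=
      univ.filter fun i => if p i ≤ q i then o i ≤ e.1 i else e.2 i ≤ o i
    have hle : ∀ i, e.1 i ≤ e.2 i := by
      intro i
      by_cases hi : i = j
      · rw [hi]; exact hj.lt.le
      · exact (hj.eq i hi).le
    -- The coordinates of o belong to the grid, so no edge crosses a hyperplane through o; hence φ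
    -- acts on the whole edge as the projection given by S.
    have hgap : ∀ i, o i ≤ e.1 i ∨ e.2 i ≤ o i := by
      intro i
      by_cases hi : i = j
      · rw [hi]
        by_contra hc
        push Not at hc
        exact absurd (hj.gap _ (ho j) hc.1) (not_le.2 hc.2)
      · rw [hj.eq i hi]; exact le_total _ _
    refine mem_image.2 ⟨(S, e), mem_product.2 ⟨mem_univ _, he⟩, ?_⟩
    have hS : ∀ i, i ∈ S ↔ if p i ≤ q i then o i ≤ e.1 i else e.2 i ≤ o i := fun i => by
      simp only [S, mem_filter, mem_univ, true_and]
    have key : ∀ x : Pt d, (∀ i, e.1 i ≤ x i ∧ x i ≤ e.2 i) → S.piecewise o x = φ x := by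
      intro x hx
      funext i
      have h1 := hx i
      by_cases hi : i ∈ S
      · rw [piecewise_eq_of_mem _ _ _ hi]
        rw [hS] at hi
        simp only [φ]
        split_ifs at hi ⊢ with hpq
        · rw [min_eq_right (by linarith)]
        · rw [max_eq_right (by linarith)]
      · rw [piecewise_eq_of_notMem _ _ _ hi]
        rw [hS] at hi
        simp only [φ]
        split_ifs at hi ⊢ with hpq
        · have := (hgap i).resolve_left hi
          rw [min_eq_left (by linarith)]
        · have := (hgap i).resolve_right hi
          rw [max_eq_left (by linarith)]
    exact Prod.ext (key e.1 fun i => ⟨le_rfl, hle i⟩) (key e.2 fun i => ⟨hle i, le_rfl⟩)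
  have h1 : ReflTransGen (EdgeAdj (projEdges o E)) (φ p) (φ q) :=
    h.lift φ fun a b hab => by
      rcases hab with hab | hab
      exacts [.inl (hφ _ hab), .inr (hφ _ hab)]
  have hp : φ p = p := by
    funext i
    simp only [φ]
    split_ifs with hpq
    · have := hmem i
      rw [Set.uIcc_of_le hpq] at this
      exact min_eq_left this.1
    · have := hmem i
      rw [Set.uIcc_of_ge (not_le.1 hpq).le] at this
      exact max_eq_left this.2
  have hq : φ q = o := by
    funext i
    simp only [φ]
    split_ifs with hpq
    · have := hmem i
      rw [Set.uIcc_of_le hpq] at this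
      exact min_eq_right this.2
    · have := hmem i
      rw [Set.uIcc_of_ge (not_le.1 hpq).le] at this
      exact max_eq_right this.1
  rw [hp, hq] at h1
  have h2 : ReflTransGen (EdgeAdj (projEdges o E)) p q := by
    have hsub : ∀ e ∈ E, e ∈ projEdges o E := fun e he =>
      mem_image.2 ⟨(∅, e), mem_product.2 ⟨mem_univ _, he⟩, by simp⟩
    refine ReflTransGen.mono (fun a b hab => ?_) _ _ h
    rcases hab with hab | hab
    exacts [.inl (hsub _ hab), .inr (hsub _ hab)]
  exact ⟨edgeAdj_reach_symm h1, (edgeAdj_reach_symm h1).trans h2⟩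

end GMMN

namespace GMMN

open Finset Relation

/-! ### The approximation ratio -/

variable {d : ℕ}

theorem site_of_lt {n : ℕ} {X : ℕ → ℝ} {r v : ℕ} (hv : v < 2 * n) :
    (site n X r v : Pt d) = terminal X v := by
  funext j
  simp [site, hv]

/-- A feasible network contains, for each pair, a path of short grid edges in the bounding box. -/
theorem exists_grid (R : Instance d) (N : Network d) (h : Feasible R N) :
    ∃ C : Finset ℝ,
      (∀ r < R.length, ∀ j, (centre R.length (input R).real r : Pt d) j ∈ C) ∧
      ∀ r < R.length, ∀ B : Pt d → Prop,
        (∀ z : Pt d, (∀ j, z j ∈ Set.uIcc (terminal (input R).real (2 * r) j)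
          (terminal (input R).real (2 * r + 1) j)) → B z) →
        ∀ E : Finset (Pt d × Pt d), (∀ e ∈ gridEdges C N, B e.1 → e ∈ E) →
          ReflTransGen (EdgeAdj E) (terminal (input R).real (2 * r))
            (terminal (input R).real (2 * r + 1)) := by
  classical
  choose k v h0 hk hs hl using fun i : Fin R.length => h R[i] (List.getElem_mem _)
  -- The grid contains all coordinates of the network segments, of the vertices of one path per
  -- pair, and of the centres.
  let C : Finset ℝ :=
    (N.toFinset.biUnion fun s => univ.image s.src ∪ univ.image s.tgt) ∪
    ((univ.biUnion fun i => (range (k i + 1)).biUnion fun m => univ.image (v i m)) ∪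
      (range R.length).biUnion fun r => univ.image (centre R.length (input R).real r : Pt d))
  have hCN : ∀ s ∈ N, ∀ i, s.src i ∈ C ∧ s.tgt i ∈ C := by
    intro s hsN i
    constructor <;> refine mem_union_left _ (mem_biUnion.2 ⟨s, List.mem_toFinset.2 hsN, ?_⟩)
    exacts [mem_union_left _ (mem_image_of_mem _ (mem_univ _)),
      mem_union_right _ (mem_image_of_mem _ (mem_univ _))]
  have hCv : ∀ i, ∀ m ≤ k i, ∀ j, v i m j ∈ C := fun i m hm j =>
    mem_union_right _ (mem_union_left _ (mem_biUnion.2 ⟨i, mem_univ _, mem_biUnion.2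
      ⟨m, mem_range.2 (by omega), mem_image_of_mem _ (mem_univ _)⟩⟩))
  refine ⟨C, fun r hr j => mem_union_right _ (mem_union_right _ (mem_biUnion.2
    ⟨r, mem_range.2 hr, mem_image_of_mem _ (mem_univ _)⟩)), fun r hr B hB E hE => ?_⟩
  obtain ⟨t1, t2⟩ := terminal_input R hr
  rw [t1, t2] at hB ⊢
  have e0 : v ⟨r, hr⟩ 0 = R[r].1 := h0 ⟨r, hr⟩
  have ek : v ⟨r, hr⟩ (k ⟨r, hr⟩) = R[r].2 := hk ⟨r, hr⟩
  rw [← e0, ← ek] at hB ⊢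
  refine ReflTransGen.mono (fun x y hxy => ?_) _ _ (reach_of_path hCN B (hCv ⟨r, hr⟩)
    (hs ⟨r, hr⟩) ?_ hB)
  · rcases hxy with h | h <;> rw [mem_filter] at h
    exacts [.inl (hE _ h.1 h.2), .inr (hE _ h.1 h.2)]
  · rw [h0, hk]
    exact hl ⟨r, hr⟩

open Classical in
/-- Each feasible network contains the edges for a tree that connects the sites of a group. -/
theorem spannedBy_siteSet {n : ℕ} {X : ℕ → ℝ} {C : Finset ℝ} {N : Network d}
    (hC : ∀ r < n, ∀ j, (centre n X r : Pt d) j ∈ C)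
    (hE : ∀ r < n, ∀ B : Pt d → Prop,
      (∀ z : Pt d, (∀ j, z j ∈ Set.uIcc (terminal X (2 * r) j) (terminal X (2 * r + 1) j)) → B z) →
      ∀ E : Finset (Pt d × Pt d), (∀ e ∈ gridEdges C N, B e.1 → e ∈ E) →
        ReflTransGen (EdgeAdj E) (terminal X (2 * r)) (terminal X (2 * r + 1)))
    {r : ℕ} (hr : r < n) :
    SpannedBy {centre n X r} (siteSet d n X r)
      (2 * (2 ^ d * edgeLength ((gridEdges C N).filter fun e => InBox n X r e.1))) := by
  set E := (gridEdges C N).filter fun e => InBox n X r e.1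
  have hgrid : ∀ e ∈ E, ∃ j, IsGridEdge C j e.1 e.2 := fun e he =>
    (mem_gridEdges.1 (mem_filter.1 he).1).1
  have h := spannedBy_of_reach (V := siteSet d n X r) (o := centre n X r)
    ⟨2 * n, .inl rfl, site_centre n X r⟩ (projEdges (centre n X r) E) (by
      rintro _ ⟨v, hv, rfl⟩
      rcases hv with rfl | hv
      · rw [site_centre]
      · rw [site_of_lt hv.lt]
        obtain ⟨r', _, ⟨hr', hg⟩, hv⟩ := hv
        obtain ⟨h1, h2⟩ := reach_projEdges hgrid (hC r hr) (centre_mem hr hr' hg)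
          (hE r' hr' (InBox n X r) (fun z hz => inBox_of_mem hg hz) E
            fun e he hB => mem_filter.2 ⟨he, hB⟩)
        rcases hv with rfl | rfl
        exacts [h1, h2])
  obtain ⟨T, h1, h2, h3⟩ := h
  exact ⟨T, h1, h2, h3.trans (mul_le_mul_of_nonneg_left (edgeLength_projEdges_le _ _) zero_le_two)⟩

open Classical in
-- Double counting: exchange the sums and bound the number of group boxes containing the first end
-- of an edge.
theorem sum_edgeLength_inBox_le (n : ℕ) (X : ℕ → ℝ) (E : Finset (Pt d × Pt d)) (K : ℕ) :
    ∑ r ∈ (range K).filter (fun r => IsFirst d n X r),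
      edgeLength (E.filter fun e => InBox n X r e.1) ≤
      ((3 * (Nat.log 2 (2 * n + 1) + 1)) ^ d : ℕ) * edgeLength E := by
  unfold edgeLength
  simp only [sum_filter (s := E)]
  rw [sum_comm, mul_sum]
  refine sum_le_sum fun e _ => ?_
  rw [← sum_filter, sum_const, nsmul_eq_mul]
  refine mul_le_mul_of_nonneg_right ?_ (manhattanDist_nonneg _ _)
  exact_mod_cast card_inBox_le n X e.1 _ fun r hr => by
    rw [mem_filter, mem_filter] at hr
    exact ⟨hr.1.2, hr.2⟩

/-- The approximation ratio of the algorithm. -/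
noncomputable def ratio (d n : ℕ) : ℝ :=
  (Nat.log 2 (2 * n + 1) + 1) * (4 * d * (2 * 2 ^ d)) *
    ((3 * (Nat.log 2 (2 * n + 1) + 1)) ^ d : ℕ)

/-- Each group costs at most 4dLΘ, where Θ is bounded by the tree that the feasible network provides
inside the group box; the overlap bound for the boxes handles the sum over groups. -/
theorem totalLength_algNet_le (R : Instance d) (A : ℕ → ℕ → ℕ) {N : Network d}
    (hN : Feasible R N) :
    (algNet d R.length (input R).real A).totalLength ≤ ratio d R.length * N.totalLength := by
  classical
  obtain ⟨C, hC, hE⟩ := exists_grid R N hN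
  set n := R.length
  set X := (input R).real
  set L : ℝ := (Nat.log 2 (2 * n + 1) + 1 : ℝ) with hL
  have hL0 : 0 ≤ L := by positivity
  have hgroup : ∀ r, IsFirst d n X r → (groupNet d n X r (tour d n X r (A r))).totalLength ≤
      L * (4 * d * (2 * 2 ^ d)) *
        edgeLength ((gridEdges C N).filter fun e => InBox n X r e.1) := by
    intro r hr
    obtain ⟨τ, Θ, h1, _, h2⟩ := tour_spec d n X r (A r)
    -- The remainder c − Θ is the bound of a spanning set of edges, hence nonnegative; this gives Θ
    -- ≤ c.
    have h3 := (h1.span _ (spannedBy_siteSet hC hE hr.1)).nonneg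
    calc _ ≤ L * (4 * d * Θ) := totalLength_groupNet_le h1 h2
      _ ≤ L * (4 * d * (2 * (2 ^ d *
          edgeLength ((gridEdges C N).filter fun e => InBox n X r e.1)))) := by
        refine mul_le_mul_of_nonneg_left (mul_le_mul_of_nonneg_left ?_ (by positivity)) hL0
        linarith
      _ = _ := by ring
  have hc : 0 ≤ L * (4 * d * (2 * 2 ^ d)) := by positivity
  unfold algNet
  rw [totalLength_flatMap_range]
  calc _ ≤ ∑ r ∈ range (2 * n + 2), if IsFirst d n X r then L * (4 * d * (2 * 2 ^ d)) *
        edgeLength ((gridEdges C N).filter fun e => InBox n X r e.1) else 0 := by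
        refine sum_le_sum fun r _ => ?_
        split_ifs with h
        · exact hgroup r h
        · simp [Network.totalLength]
    _ = L * (4 * d * (2 * 2 ^ d)) * ∑ r ∈ (range (2 * n + 2)).filter (fun r => IsFirst d n X r),
        edgeLength ((gridEdges C N).filter fun e => InBox n X r e.1) := by
        rw [← sum_filter, mul_sum]
    _ ≤ L * (4 * d * (2 * 2 ^ d)) *
        (((3 * (Nat.log 2 (2 * n + 1) + 1)) ^ d : ℕ) * edgeLength (gridEdges C N)) :=
        mul_le_mul_of_nonneg_left (sum_edgeLength_inBox_le n X _ _) hc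
    _ ≤ L * (4 * d * (2 * 2 ^ d)) *
        (((3 * (Nat.log 2 (2 * n + 1) + 1)) ^ d : ℕ) * N.totalLength) := by
        refine mul_le_mul_of_nonneg_left (mul_le_mul_of_nonneg_left ?_ (by positivity)) hc
        exact edgeLength_le_totalLength N _ fun e he => mem_gridEdges.1 he
    _ = _ := by rw [ratio, hL]; ring

/-! ### Asymptotics of the ratio -/

theorem natLog_isBigO : (fun n : ℕ => (Nat.log 2 (2 * n + 1) + 1 : ℝ)) =O[Filter.atTop]
    fun n : ℕ => Real.log n := by
  -- For n ≥ 2 one has 2n+1 ≤ n³ and log 2 > 1/2, so the binary logarithm is at most 6 log n, and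
  -- the summand 1 is at most 2 log n.
  refine Asymptotics.IsBigO.of_bound 8 (Filter.eventually_atTop.2 ⟨2, fun n hn => ?_⟩)
  have h2 : (0 : ℝ) < Real.log 2 := Real.log_pos (by norm_num)
  have hn' : (2 : ℝ) ≤ n := by exact_mod_cast hn
  have h3 : Real.log 2 ≤ Real.log n := Real.log_le_log (by norm_num) hn'
  have h4 : 2 ^ Nat.log 2 (2 * n + 1) ≤ n ^ 3 :=
    (Nat.pow_log_le_self 2 (by omega)).trans (by nlinarith [Nat.mul_le_mul hn hn])
  have h5 : (Nat.log 2 (2 * n + 1) : ℝ) * Real.log 2 ≤ 3 * Real.log n := by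
    have h6 : Real.log ((2 : ℝ) ^ Nat.log 2 (2 * n + 1)) ≤ Real.log ((n : ℝ) ^ 3) :=
      Real.log_le_log (by positivity) (by exact_mod_cast h4)
    rw [Real.log_pow, Real.log_pow] at h6
    exact_mod_cast h6
  have h7 : (1 / 2 : ℝ) < Real.log 2 := by linarith [Real.log_two_gt_d9]
  rw [Real.norm_of_nonneg (by positivity), Real.norm_of_nonneg (by linarith)]
  nlinarith

theorem ratio_isBigO (d : ℕ) :
    ratio d =O[Filter.atTop] fun n : ℕ => Real.log n ^ (d + 1) := by
  have h : ratio d = fun n => (4 * d * (2 * 2 ^ d) * 3 ^ d : ℝ) *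
      ((Nat.log 2 (2 * n + 1) + 1 : ℝ) ^ (d + 1)) := by
    funext n
    rw [ratio]
    push_cast
    rw [mul_pow]
    ring
  rw [h]
  exact (natLog_isBigO.pow (d + 1)).const_mul_left _

end GMMN

theorem mainTheorem1 (d : ℕ) (hd : 1 ≤ d) :
    ∃ ρ : ℕ → ℝ,
      ρ =O[Filter.atTop] (fun n : ℕ => Real.log n ^ (d + 1)) ∧ GMMN.AdmitsApproximation d ρ := by
  obtain ⟨P, p, h⟩ := GMMN.exists_program d
  refine ⟨GMMN.ratio d, GMMN.ratio_isBigO d, P, p, fun R => ?_⟩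
  obtain ⟨t, s, A, h1, h2, h3⟩ := h R
  exact ⟨t, s, _, h1, h2, h3, GMMN.feasible_algNet R A,
    fun N hN => GMMN.totalLength_algNet_le R A hN⟩
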